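/- Let $k$ be a field and let $\mathscr C$ be a $k$-linear, Hom-finite, Krull--Schmidt, reduced $0$-Auslander extriangulated category with $\operatorname{proj}\mathscr C=\operatorname{add}P$. (An extriangulated category is \emph{reduced $0$-Auslander} if it has enough projectives, every object $X$ has a conflation $P_1\rightarrowtail P_0\twoheadrightarrow X$ with $P_0,P_1$ projective, every projective $Q$ has a conflation $Q\rightarrowtail Q'\twoheadrightarrow J$ with $Q'$ projective-injective and $J$ injective, and its only projective-injective object is $0$.) For $X$ projective or $Y$ injective, $\Sigma X$ and $\Omega Y$ are defined by conflations $X\rightarrowtail 0\twoheadrightarrow\Sigma X$ and $\Omega Y\rightarrowtail 0\twoheadrightarrow Y$. For an object $X$ (of $\mathscr C$ or of a module category), $\operatorname{ind}X$ denotes the set of isomorphism classes of indecomposable direct summands of $X$, and $|X|$ its cardinality. Let $U\in\mathscr C$ be presilting, i.e. $\mathbb E(U,U)=0$. Let $U'\to\Sigma P$ be a minimal right $\operatorname{add}U$-approximation and $P\to U''$ a minimal left one; complete them to conflations $K\rightarrowtail U'\twoheadrightarrow\Sigma P$ and $P\rightarrowtail U''\twoheadrightarrow L$. The Bongartz complement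 $B=B[U]$ (resp. the co-Bongartz complement $C=C[U]$) is obtained from $K$ (resp. $L$) by splitting off all direct summands lying in $\operatorname{add}U$. These complements exist, and the following hold. \textbf{(1)} There is an $\mathbb E$-triangle $B\overset{b}{\rightarrowtail}\overline U\overset{c}{\twoheadrightarrow}C$ in which $b$ (resp. $c$) is a minimal left (resp. right) $\operatorname{add}U$-approximation. For every such $\mathbb E$-triangle and every decomposition $B\cong\bigoplus_iB_i$ into indecomposables, it is isomorphic to a direct sum of $\mathbb E$-triangles $$B_i\overset{b_i}{\rightarrowtail}\overline U_i\overset{c_i}{\twoheadrightarrow}C_i$$ with $C_i$ indecomposable and $b_i$ (resp. $c_i$) a minimal left (resp. right) $\operatorname{add}U$-approximation. Every minimal left $\operatorname{add}U$-approximation of an indecomposable summand of $B$, and every minimal right $\operatorname{add}U$-approximation of an indecomposable summand of $C$, occurs in an $\mathbb E$-triangle of this kind joining an indecomposable summand of $B$ to one of $C$. These $\mathbb E$-triangles define a bijection $\rho:\operatorname{ind}B\to\operatorname{ind}C$, where $\rho(X)=Y$ if and only if there is an $\mathbb E$-triangle $X\rightarrowtail V\twoheadrightarrow Y$ whose maps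 are minimal left and right $\operatorname{add}U$-approximations. Moreover $|B|=|P|-|U|$. \textbf{(2)} Suppose that $U$ has no nonzero injective direct summand. Let $\Lambda$ be the endomorphism algebra of $P$, acting on $\mathscr C(P,-)$ so that $\mathscr C(P,X)$ is a left $\Lambda$-module (with the composition convention $fg=f\circ g$, left modules over $\operatorname{End}_{\mathscr C}(P)^{\mathrm{op}}$), and put $M=\mathscr C(P,U)$. Write $C\cong C'\oplus I_C$ with $I_C$ injective and $C'$ without nonzero injective summands; such decompositions exist, and for each of them the following holds. $M$ is $\tau$-rigid. The module $\mathscr C(P,B)$ is its Bongartz complement: $\mathscr C(P,B)\oplus M$ is a $\tau$-tilting module, $\operatorname{add}(\mathscr C(P,B)\oplus M)$ is the class of $\operatorname{Ext}$-projectives in ${}^{\perp_0}(\tau M)$, and $\mathscr C(P,B)$ has no nonzero summand in $\operatorname{add}M$. The object $\mathscr C(P,C')\oplus\mathscr C(P,\Omega I_C)[1]$ is its co-Bongartz complement: its sum with $M$ is support $\tau$-tilting, $\operatorname{add}(\mathscr C(P,C')\oplus M)$ is the class of $\operatorname{Ext}$-projectives in $\operatorname{Gen}M$, and $\mathscr C(P,C')$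 has no nonzero summand in $\operatorname{add}M$. There is a decomposition $B\cong B'\oplus B''$ such that $\rho$ restricts to bijections $\rho':\operatorname{ind}B'\to\operatorname{ind}C'$ and $\rho'':\operatorname{ind}B''\to\operatorname{ind}I_C$. The minimal left $\operatorname{add}M$-approximation of an indecomposable summand of $\mathscr C(P,B'')$ is an epimorphism, and that of an indecomposable summand of $\mathscr C(P,B')$ is not. The Buan--Marsh exchange for $M$ consists of the following two bijections. \begin{itemize} \item[(i)] $\sigma':\operatorname{ind}\mathscr C(P,B')\to\operatorname{ind}\mathscr C(P,C')$, where $\sigma'(X)=Y$ if and only if there is an exact sequence $X\xrightarrow{\mu}V\xrightarrow{\gamma}Y\to0$ with $\mu$ a minimal left and $\gamma$ a right $\operatorname{add}M$-approximation. \item[(ii)] $\sigma'':\operatorname{ind}\mathscr C(P,B'')\to\operatorname{ind}\mathscr C(P,\Omega I_C)$, where $\sigma''(X)=Q$ if and only if there is an exact sequence $Q\xrightarrow{\delta}X\xrightarrow{\mu}V\to0$ with $\delta$ a minimal left $\operatorname{add}\mathscr C(P,B)$-approximation and $\mu$ a minimal left $\operatorname{add}M$-approximation. \end{itemize} The functor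 $\mathscr C(P,-)$ induces bijections from $\operatorname{ind}B$, $\operatorname{ind}B'$, $\operatorname{ind}B''$ and $\operatorname{ind}C'$ to $\operatorname{ind}\mathscr C(P,B)$, $\operatorname{ind}\mathscr C(P,B')$, $\operatorname{ind}\mathscr C(P,B'')$ and $\operatorname{ind}\mathscr C(P,C')$, and $J\mapsto\mathscr C(P,\Omega J)$ induces a bijection $\operatorname{ind}I_C\to\operatorname{ind}\mathscr C(P,\Omega I_C)$. Under these bijections $\rho'$ corresponds to $\sigma'$ and $\rho''$ to $\sigma''$. -/

import Mathlib

open CategoryTheory CategoryTheory.Limits Opposite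

universe w v u

namespace ZeroAuslander

/-! ### Summands, additive closures and approximations -/

section Additive

variable {C : Type u} [Category.{v} C] [Preadditive C] [HasZeroObject C]
  [HasBinaryBiproducts C] [HasFiniteBiproducts C]

/-- `X` is (isomorphic to) a direct summand of `B`. -/
def IsSummand (X B : C) : Prop := ∃ Y : C, Nonempty (B ≅ X ⊞ Y)

/-- `X` lies in `add U`: it is a direct summand of a finite direct sum of copies of `U`. -/
def InAdd (U X : C) : Prop := ∃ n : ℕ, IsSummand X (⨁ fun _ : Fin n => U)

/-- Every object is a finite direct sum of objects with local endomorphism rings. -/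
def IsKrullSchmidt (C : Type u) [Category.{v} C] [Preadditive C] [HasFiniteBiproducts C] : Prop :=
  ∀ X : C, ∃ (n : ℕ) (F : Fin n → C),
    (∀ i, IsLocalRing (End (F i))) ∧ Nonempty (X ≅ ⨁ F)

/-- The indecomposable direct summands of `B`. -/
def IndSummand (B : C) : Type u := {X : C // Indecomposable X ∧ IsSummand X B}

instance indSetoid (B : C) : Setoid (IndSummand B) where
  r X Y := Nonempty (X.1 ≅ Y.1)
  iseqv := ⟨fun _ => ⟨Iso.refl _⟩, fun ⟨e⟩ => ⟨e.symm⟩, fun ⟨e⟩ ⟨f⟩ => ⟨e.trans f⟩⟩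

/-- `ind (add B)`: isomorphism classes of indecomposable direct summands of `B`. -/
def IndClass (B : C) : Type u := Quotient (indSetoid B)

/-- The isomorphism class of an indecomposable direct summand. -/
def cls {B : C} (X : IndSummand B) : IndClass B := Quotient.mk (indSetoid B) X

/-- `|B|`: the number of pairwise non-isomorphic indecomposable direct summands of `B`. -/
noncomputable def numInd (B : C) : ℕ := Nat.card (IndClass B)

/-- `B` and `U` have no nonzero direct summand in common. -/
def NoCommonSummand (U B : C) : Prop := ∀ X : C, IsSummand X B → InAdd U X → IsZero X

/-- `f : X ⟶ V` is a left `add U`-approximation. -/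
def IsLeftApprox (U : C) {X V : C} (f : X ⟶ V) : Prop :=
  InAdd U V ∧ ∀ (W : C) (g : X ⟶ W), InAdd U W → ∃ h : V ⟶ W, f ≫ h = g

/-- `f : V ⟶ X` is a right `add U`-approximation. -/
def IsRightApprox (U : C) {V X : C} (f : V ⟶ X) : Prop :=
  InAdd U V ∧ ∀ (W : C) (g : W ⟶ X), InAdd U W → ∃ h : W ⟶ V, h ≫ f = g

/-- A left `add U`-approximation that is a left minimal morphism. -/
def IsMinLeftApprox (U : C) {X V : C} (f : X ⟶ V) : Prop :=
  IsLeftApprox U f ∧ ∀ h : V ⟶ V, f ≫ h = f → IsIso h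

/-- A right `add U`-approximation that is a right minimal morphism. -/
def IsMinRightApprox (U : C) {V X : C} (f : V ⟶ X) : Prop :=
  IsRightApprox U f ∧ ∀ h : V ⟶ V, h ≫ f = f → IsIso h

end Additive

/-! ### Extriangulated categories -/

section Extensions

variable {C : Type u} [Category.{v} C] (E : Cᵒᵖ ⥤ C ⥤ AddCommGrpCat.{w})

/-- The group `𝔼(Z, A)` of extensions. -/
abbrev Extn (Z A : C) : Type w := (E.obj (op Z)).obj A

/-- `f_* δ`. -/
def push {Z A A' : C} (f : A ⟶ A') (δ : Extn E Z A) : Extn E Z A' :=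
  (E.obj (op Z)).map f δ

/-- `h^* δ`. -/
def pull {Z Z' A : C} (h : Z' ⟶ Z) (δ : Extn E Z A) : Extn E Z' A :=
  (E.map h.op).app A δ

/-- `δ ⊕ δ'`. -/
noncomputable def extSum [Preadditive C] [HasBinaryBiproducts C] {Z A Z' A' : C}
    (δ : Extn E Z A) (δ' : Extn E Z' A') : Extn E (Z ⊞ Z') (A ⊞ A') :=
  push E biprod.inl (pull E biprod.fst δ) + push E biprod.inr (pull E biprod.snd δ')

/-- `⨁ᵢ δᵢ`. -/
noncomputable def extBigSum [Preadditive C] [HasFiniteBiproducts C] {n : ℕ} {Z A : Fin n → C}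
    (δ : ∀ i, Extn E (Z i) (A i)) : Extn E (⨁ Z) (⨁ A) :=
  ∑ i, push E (biproduct.ι A i) (pull E (biproduct.π Z i) (δ i))

end Extensions

/-- An extriangulated structure on an additive category: a biadditive functor `𝔼` together with
an additive realization. `Realizes a b δ` says that the sequence `A ⟶ B ⟶ Z` belongs to the
equivalence class `𝔰(δ)`; the first three fields on `Realizes` say that `𝔰(δ)` is exactly one
equivalence class of sequences. -/
structure Extriangulated (C : Type u) [Category.{v} C] [Preadditive C] [HasZeroObject C]
    [HasBinaryBiproducts C] where
  E : Cᵒᵖ ⥤ C ⥤ AddCommGrpCat.{w}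
  additive_left : E.Additive
  additive_right : ∀ Z : Cᵒᵖ, (E.obj Z).Additive
  Realizes : ∀ {A B Z : C}, (A ⟶ B) → (B ⟶ Z) → Extn E Z A → Prop
  realizes_exists : ∀ {A Z : C} (δ : Extn E Z A),
    ∃ (B : C) (a : A ⟶ B) (b : B ⟶ Z), Realizes a b δ
  realizes_unique : ∀ {A B B' Z : C} (a : A ⟶ B) (b : B ⟶ Z) (a' : A ⟶ B') (b' : B' ⟶ Z)
    (δ : Extn E Z A), Realizes a b δ → Realizes a' b' δ →
      ∃ e : B ≅ B', a ≫ e.hom = a' ∧ e.hom ≫ b' = b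
  realizes_of_equiv : ∀ {A B B' Z : C} (a : A ⟶ B) (b : B ⟶ Z) (δ : Extn E Z A) (e : B ≅ B'),
    Realizes a b δ → Realizes (a ≫ e.hom) (e.inv ≫ b) δ
  realizes_map : ∀ {A B Z A' B' Z' : C} (a : A ⟶ B) (b : B ⟶ Z) (δ : Extn E Z A)
    (a' : A' ⟶ B') (b' : B' ⟶ Z') (δ' : Extn E Z' A') (f : A ⟶ A') (h : Z ⟶ Z'),
    Realizes a b δ → Realizes a' b' δ' → push E f δ = pull E h δ' →
      ∃ g : B ⟶ B', a ≫ g = f ≫ a' ∧ b ≫ h = g ≫ b'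
  realizes_zero : ∀ A Z : C,
    Realizes (biprod.inl : A ⟶ A ⊞ Z) (biprod.snd : A ⊞ Z ⟶ Z) (0 : Extn E Z A)
  realizes_sum : ∀ {A B Z A' B' Z' : C} (a : A ⟶ B) (b : B ⟶ Z) (δ : Extn E Z A)
    (a' : A' ⟶ B') (b' : B' ⟶ Z') (δ' : Extn E Z' A'),
    Realizes a b δ → Realizes a' b' δ' →
      Realizes (biprod.map a a') (biprod.map b b') (extSum E δ δ')
  et3 : ∀ {A B Z A' B' Z' : C} (a : A ⟶ B) (b : B ⟶ Z) (δ : Extn E Z A)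
    (a' : A' ⟶ B') (b' : B' ⟶ Z') (δ' : Extn E Z' A') (f : A ⟶ A') (g : B ⟶ B'),
    Realizes a b δ → Realizes a' b' δ' → a ≫ g = f ≫ a' →
      ∃ h : Z ⟶ Z', b ≫ h = g ≫ b' ∧ push E f δ = pull E h δ'
  et3_op : ∀ {A B Z A' B' Z' : C} (a : A ⟶ B) (b : B ⟶ Z) (δ : Extn E Z A)
    (a' : A' ⟶ B') (b' : B' ⟶ Z') (δ' : Extn E Z' A') (g : B ⟶ B') (h : Z ⟶ Z'),
    Realizes a b δ → Realizes a' b' δ' → b ≫ h = g ≫ b' →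
      ∃ f : A ⟶ A', a ≫ g = f ≫ a' ∧ push E f δ = pull E h δ'
  et4 : ∀ {A B D X F : C} (f : A ⟶ B) (f' : B ⟶ D) (δ : Extn E D A)
    (g : B ⟶ X) (g' : X ⟶ F) (δ' : Extn E F B),
    Realizes f f' δ → Realizes g g' δ' →
      ∃ (G : C) (h : A ⟶ X) (h' : X ⟶ G) (d : D ⟶ G) (e : G ⟶ F) (δ'' : Extn E G A),
        Realizes h h' δ'' ∧ Realizes d e (push E f' δ') ∧
        f ≫ g = h ∧ f' ≫ d = g ≫ h' ∧ h' ≫ e = g' ∧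
        pull E d δ'' = δ ∧ push E f δ'' = pull E e δ'
  et4_op : ∀ {A B D X F : C} (f' : D ⟶ B) (f : B ⟶ A) (δ : Extn E A D)
    (g' : F ⟶ X) (g : X ⟶ B) (δ' : Extn E B F),
    Realizes f' f δ → Realizes g' g δ' →
      ∃ (G : C) (h' : G ⟶ X) (h : X ⟶ A) (e : F ⟶ G) (d : G ⟶ D) (δ'' : Extn E A G),
        Realizes h' h δ'' ∧ Realizes e d (pull E f' δ') ∧
        g ≫ f = h ∧ d ≫ f' = h' ≫ g ∧ e ≫ h' = g' ∧
        push E d δ'' = δ ∧ pull E f δ'' = push E e δ'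

namespace Extriangulated

variable {C : Type u} [Category.{v} C] [Preadditive C] [HasZeroObject C]
  [HasBinaryBiproducts C] (T : Extriangulated.{w} C)

def Conflation {A B Z : C} (a : A ⟶ B) (b : B ⟶ Z) : Prop := ∃ δ : Extn T.E Z A, T.Realizes a b δ

def Inflation {A B : C} (a : A ⟶ B) : Prop := ∃ (Z : C) (b : B ⟶ Z), T.Conflation a b

def Deflation {B Z : C} (b : B ⟶ Z) : Prop := ∃ (A : C) (a : A ⟶ B), T.Conflation a b

def Projective (P : C) : Prop :=
  ∀ {B Z : C} (b : B ⟶ Z), T.Deflation b → ∀ g : P ⟶ Z, ∃ h : P ⟶ B, h ≫ b = g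

def Injective (I : C) : Prop :=
  ∀ {A B : C} (a : A ⟶ B), T.Inflation a → ∀ g : A ⟶ I, ∃ h : B ⟶ I, a ≫ h = g

/-- Reduced `0`-Auslander extriangulated categories. -/
structure IsReducedZeroAuslander : Prop where
  enoughProjectives : ∀ X : C, ∃ (P : C) (p : P ⟶ X), T.Projective P ∧ T.Deflation p
  resolution : ∀ X : C, ∃ (P₁ P₀ : C) (i : P₁ ⟶ P₀) (p : P₀ ⟶ X),
    T.Projective P₁ ∧ T.Projective P₀ ∧ T.Conflation i p
  coresolution : ∀ P : C, T.Projective P → ∃ (Q I : C) (i : P ⟶ Q) (p : Q ⟶ I),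
    T.Projective Q ∧ T.Injective Q ∧ T.Injective I ∧ T.Conflation i p
  reduced : ∀ Q : C, T.Projective Q → T.Injective Q → IsZero Q

/-- There is a conflation `X ⟶ 0 ⟶ Y`; for `X` projective this says `Y ≅ ΣX`, and for `Y`
injective it says `X ≅ ΩY`. -/
def IsSuspension (X Y : C) : Prop :=
  ∃ (Z : C) (a : X ⟶ Z) (b : Z ⟶ Y), IsZero Z ∧ T.Conflation a b

/-- `P` is a projective generator: `proj C = add P`. -/
def IsProjectiveGenerator [HasFiniteBiproducts C] (P : C) : Prop :=
  ∀ X : C, T.Projective X ↔ InAdd P X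

def Presilting (U : C) : Prop := ∀ δ : Extn T.E U U, δ = 0

/-- `B` is the Bongartz complement of `U`: with `I = ΣP` and `K ⟶ U' ⟶ I` an `𝔼`-triangle whose
second map is a minimal right `add U`-approximation, `B` is the part of `K` that is left after
splitting off the direct summands in `add U`. -/
def IsBongartzComplement [HasFiniteBiproducts C] (P U B : C) : Prop :=
  ∃ (I K U' U₀ : C) (b : K ⟶ U') (f : U' ⟶ I), T.IsSuspension P I ∧
    IsMinRightApprox U f ∧ T.Conflation b f ∧
    InAdd U U₀ ∧ Nonempty (K ≅ B ⊞ U₀) ∧ NoCommonSummand U B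

/-- `Z` is the co-Bongartz complement of `U`: with `P ⟶ U'' ⟶ L` an `𝔼`-triangle whose first map
is a minimal left `add U`-approximation, `Z` is the part of `L` that is left after splitting off
the direct summands in `add U`. -/
def IsCoBongartzComplement [HasFiniteBiproducts C] (P U Z : C) : Prop :=
  ∃ (L U'' U₀ : C) (g : P ⟶ U'') (c : U'' ⟶ L),
    IsMinLeftApprox U g ∧ T.Conflation g c ∧
    InAdd U U₀ ∧ Nonempty (L ≅ Z ⊞ U₀) ∧ NoCommonSummand U Z

/-- `X ⟶ V ⟶ Y` with class `δ` is an `𝔼`-triangle whose first map is a minimal left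
`add U`-approximation and whose second map is a minimal right `add U`-approximation. -/
def IsExchangeTriangle [HasFiniteBiproducts C] (U : C) {X V Y : C} (b : X ⟶ V) (c : V ⟶ Y)
    (δ : Extn T.E Y X) : Prop :=
  T.Realizes b c δ ∧ IsMinLeftApprox U b ∧ IsMinRightApprox U c

/-- The exchange relation: `X` and `Y` are the ends of an exchange `𝔼`-triangle. -/
def Exchange [HasFiniteBiproducts C] (U X Y : C) : Prop :=
  ∃ (V : C) (b : X ⟶ V) (c : V ⟶ Y) (δ : Extn T.E Y X), T.IsExchangeTriangle U b c δ

/-- `C = C' ⊕ J` where `J` is the largest injective direct summand, and `W = ΩJ`. -/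
def IsInjectiveSplitting (Z Z' J W : C) : Prop :=
  Nonempty (Z ≅ Z' ⊞ J) ∧ T.Injective J ∧
    (∀ X : C, IsSummand X Z' → T.Injective X → IsZero X) ∧
    T.Projective W ∧ T.IsSuspension W J

end Extriangulated

/-! ### Support `τ`-tilting theory over a finite dimensional algebra -/

section Modules

variable (k : Type*) [Field k] (Λ : Type v) [Ring Λ] [Algebra k Λ]

/-- A submodule is superfluous if it is not a proper part of any generating sum. -/
def IsSuperfluous {M : Type*} [AddCommGroup M] [Module Λ M] (N : Submodule Λ M) : Prop :=
  ∀ L : Submodule Λ M, L ⊔ N = ⊤ → L = ⊤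

/-- A minimal projective presentation `P₁ ⟶ P₀ ⟶ M ⟶ 0` by finitely generated projectives. -/
structure MinProjPresentation (M : ModuleCat.{v} Λ) where
  P₁ : ModuleCat.{v} Λ
  P₀ : ModuleCat.{v} Λ
  d : P₁ ⟶ P₀
  p : P₀ ⟶ M
  finite₁ : Module.Finite Λ P₁
  finite₀ : Module.Finite Λ P₀
  projective₁ : Module.Projective Λ P₁
  projective₀ : Module.Projective Λ P₀
  surjective : Function.Surjective p.hom
  exact : LinearMap.range d.hom = LinearMap.ker p.hom
  minimal₀ : IsSuperfluous Λ (LinearMap.ker p.hom)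
  minimal₁ : IsSuperfluous Λ (LinearMap.ker d.hom)

variable {Λ}

/-- The map `Hom_Λ(P₀, Λ) ⟶ Hom_Λ(P₁, Λ)` of right `Λ`-modules induced by `d : P₁ ⟶ P₀`. -/
def starMap {P₁ P₀ : ModuleCat.{v} Λ} (d : P₁ ⟶ P₀) : (P₀ →ₗ[Λ] Λ) →ₗ[Λᵐᵒᵖ] (P₁ →ₗ[Λ] Λ) where
  toFun f := f ∘ₗ d.hom
  map_add' _ _ := rfl
  map_smul' _ _ := rfl

/-- The transpose `Tr M = coker (Hom_Λ(P₀, Λ) ⟶ Hom_Λ(P₁, Λ))`, a right `Λ`-module. -/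
abbrev MinProjPresentation.Tr {M : ModuleCat.{v} Λ} (p : MinProjPresentation Λ M) : Type v :=
  (p.P₁ →ₗ[Λ] Λ) ⧸ LinearMap.range (starMap p.d)

end Modules

section Dual

/-- The `k`-dual `Hom_k(N, k)` of a right `Λ`-module `N`, with its left `Λ`-action
`(a • f) x = f (x a)`. -/
def KDual (k Λ N : Type*) [Field k] [Ring Λ] [Algebra k Λ] [AddCommGroup N] [Module Λᵐᵒᵖ N]
    [Module k N] [IsScalarTower k Λᵐᵒᵖ N] := N →ₗ[k] k

variable (k Λ N : Type*) [Field k] [Ring Λ] [Algebra k Λ] [AddCommGroup N] [Module Λᵐᵒᵖ N]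
  [Module k N] [IsScalarTower k Λᵐᵒᵖ N]

instance : AddCommGroup (KDual k Λ N) := inferInstanceAs (AddCommGroup (N →ₗ[k] k))

theorem op_smul_comm (c : k) (a : Λ) (x : N) :
    MulOpposite.op a • (c • x) = c • (MulOpposite.op a • x) := by
  rw [← smul_one_smul Λᵐᵒᵖ c x, ← smul_one_smul Λᵐᵒᵖ c (MulOpposite.op a • x), smul_smul,
    smul_smul, mul_smul_comm, mul_one, smul_mul_assoc, one_mul]

instance : Module Λ (KDual k Λ N) where
  smul a f :=
    ({ toFun := fun x => (show N →ₗ[k] k from f) (MulOpposite.op a • x)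
       map_add' := fun x y => by rw [smul_add, map_add]
       map_smul' := fun c x => by rw [op_smul_comm k Λ N, map_smul, RingHom.id_apply] } :
      N →ₗ[k] k)
  one_smul f := LinearMap.ext fun x => congrArg (show N →ₗ[k] k from f) (one_smul Λᵐᵒᵖ x)
  mul_smul a b f := LinearMap.ext fun x =>
    congrArg (show N →ₗ[k] k from f) (mul_smul (MulOpposite.op b) (MulOpposite.op a) x)
  smul_zero _ := LinearMap.ext fun _ => rfl
  smul_add _ _ _ := LinearMap.ext fun _ => rfl
  add_smul a b f := LinearMap.ext fun x =>
    (congrArg (show N →ₗ[k] k from f)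
      (add_smul (MulOpposite.op a) (MulOpposite.op b) x)).trans (map_add _ _ _)
  zero_smul f := LinearMap.ext fun x =>
    (congrArg (show N →ₗ[k] k from f) (zero_smul Λᵐᵒᵖ x)).trans (map_zero _)

end Dual

section TauTilting

variable (k : Type*) [Field k] {Λ : Type v} [Ring Λ] [Algebra k Λ]

/-- The Auslander-Reiten translate `τM = Hom_k(Tr M, k)`, computed from a minimal projective
presentation of `M`. -/
abbrev MinProjPresentation.tau {M : ModuleCat.{v} Λ} (p : MinProjPresentation Λ M) :=
  KDual k Λ p.Tr

/-- `Hom_Λ(X, τM) = 0`. -/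
def HomTauVanishes (X M : ModuleCat.{v} Λ) : Prop :=
  ∃ p : MinProjPresentation Λ M, ∀ f : X →ₗ[Λ] p.tau k, f = 0

/-- `M` is a (finitely generated) `τ`-rigid module. -/
def IsTauRigid (M : ModuleCat.{v} Λ) : Prop := Module.Finite Λ M ∧ HomTauVanishes k M M

/-- `M ⊕ Q[1]` is a support `τ`-tilting object. -/
def IsSupportTauTilting (M Q : ModuleCat.{v} Λ) : Prop :=
  IsTauRigid k M ∧ Module.Finite Λ Q ∧ Module.Projective Λ Q ∧ (∀ f : Q ⟶ M, f = 0) ∧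
    numInd M + numInd Q = numInd (ModuleCat.of Λ Λ)

/-- `𝒫(𝒳)`: the `Ext`-projective modules in a subcategory `𝒳`. -/
def ExtProjective (𝒳 : ModuleCat.{v} Λ → Prop) (X : ModuleCat.{v} Λ) : Prop :=
  𝒳 X ∧ ∀ Y, 𝒳 Y → Subsingleton (Abelian.Ext X Y 1)

/-- The finitely generated modules `X` with `Hom_Λ(X, τM) = 0`. -/
def PerpTau (M X : ModuleCat.{v} Λ) : Prop := Module.Finite Λ X ∧ HomTauVanishes k X M

/-- `Gen M`: the factor modules of modules in `add M`. -/
def Gen (M X : ModuleCat.{v} Λ) : Prop :=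
  ∃ (V : ModuleCat.{v} Λ) (f : V ⟶ X), InAdd M V ∧ Epi f

/-- `B` is the Bongartz complement of the `τ`-rigid module `M`. -/
def IsBongartzModule (M B : ModuleCat.{v} Λ) : Prop :=
  IsSupportTauTilting k (B ⊞ M) (ModuleCat.of Λ PUnit.{v + 1}) ∧
    (∀ X, InAdd (B ⊞ M) X ↔ ExtProjective (PerpTau k M) X) ∧ NoCommonSummand M B

/-- `N ⊕ Q[1]` is the co-Bongartz complement of the `τ`-rigid module `M`. -/
def IsCoBongartzModule (M N Q : ModuleCat.{v} Λ) : Prop :=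
  IsSupportTauTilting k (N ⊞ M) Q ∧
    (∀ X, InAdd (N ⊞ M) X ↔ ExtProjective (Gen M) X) ∧ NoCommonSummand M N

/-- The first case of the Buan-Marsh exchange for `M`: an exact sequence
`X ⟶ V ⟶ Y ⟶ 0` whose first map is a minimal left, and whose second map is a right,
`add M`-approximation. -/
def BuanMarshModule (M X Y : ModuleCat.{v} Λ) : Prop :=
  ∃ (V : ModuleCat.{v} Λ) (m : X ⟶ V) (g : V ⟶ Y), Function.Exact m.hom g.hom ∧
    Function.Surjective g.hom ∧ IsMinLeftApprox M m ∧ IsRightApprox M g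

/-- The second case of the Buan-Marsh exchange for `M` with Bongartz complement `B`: an exact
sequence `Q ⟶ X ⟶ V ⟶ 0` whose first map is a minimal left `add B`-approximation and whose
second map is a minimal left `add M`-approximation. Then `X` is exchanged with `Q[1]`. -/
def BuanMarshShifted (M B X Q : ModuleCat.{v} Λ) : Prop :=
  ∃ (V : ModuleCat.{v} Λ) (d : Q ⟶ X) (m : X ⟶ V), Function.Exact d.hom m.hom ∧
    Function.Surjective m.hom ∧ IsMinLeftApprox B d ∧ IsMinLeftApprox M m

/-- Some (equivalently, every) minimal left `add M`-approximation of `X` is an epimorphism. -/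
def HasEpiApprox (M X : ModuleCat.{v} Λ) : Prop :=
  ∃ (V : ModuleCat.{v} Λ) (m : X ⟶ V), IsMinLeftApprox M m ∧ Epi m

end TauTilting

end ZeroAuslander

open ZeroAuslander

/-!
The argument has a part inside the extriangulated category and a part that transports the result
to modules.

**Exchange triangles.** Endomorphism algebras are finite dimensional, so every endomorphism has a
Fitting decomposition. Hence endomorphisms of indecomposable objects are invertible or nilpotent, and
morphisms between objects without common summands are radical. Minimal `add U`-approximations
exist, are unique up to isomorphism, and are inflations (deflations) as soon as some approximation
is. Desuspending the conflation `K ⟶ U' ⟶ ΣP` gives `P ⟶ K ⟶ U'`, and its pushout along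
`P ⟶ U''` has middle term `U'' ⊞ U'` because `𝔼(U, U) = 0`. This is a conflation
`K ⟶ U'' ⊞ U' ⟶ L`; removing the summands in `add U` leaves the exchange triangle from the Bongartz
to the co-Bongartz complement (`IsBongartzComplement.exchange`). An object `B` with
`𝔼(U, B) = 0`, without summands in `add U`, and with an inflation as left approximation is the left
end of an exchange triangle, and these three properties pass to summands. Since either end of an
exchange triangle determines the other, exchange triangles decompose along decompositions of one
end (`IsExchangeTriangle.exists_decomposition`), have indecomposable right end exactly if the left
end is indecomposable, and define the bijection `ρ` (`Exchange.exists_equiv`).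

**Counting.** `S = B ⊞ U` is presilting, and `P` has an `add S`-coresolution `P ⟶ K ⟶ U'`. The
multiplicity vectors of `add P`-resolutions of the summands of `S` and those of
`add S`-coresolutions of the summands of `P` form mutually inverse matrices, so `|S| = |P|`
(`numInd_eq_of_coresolution`).

**Modules.** The functor `C(P, -)` is full (`exists_map_eq`), dense on finitely generated modules
(`exists_obj_iso`), and the morphisms it kills are those that factor through injective objects
(`exists_factorization_of_map_eq_zero`). Objects without injective summands therefore correspond to
finitely generated modules. Lifting projective presentations to conflations, one finds that
`Hom(C(P, Y), τ C(P, X)) = 0` if and only if `𝔼(X, Y) = 0`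
(`NoInjectiveSummand.homTauVanishes_iff`), so presilting objects give `τ`-rigid modules, and the
`Ext`-projective modules of the two torsion classes in question are identified by
`inAdd_iff_extProjective`.

**Comparison.** The functor sends an exchange triangle `X ⟶ V ⟶ Y` to an exact sequence
`C(P, X) ⟶ C(P, V) ⟶ C(P, Y) ⟶ 0` whose first map is a minimal left approximation. If `Y` is not
injective, this is the Buan-Marsh exchange of modules (`IsExchangeTriangle.buanMarshModule_iff`).
If `Y = ΣW` is injective, then `C(P, Y) = 0` and the rotated conflation `W ⟶ X ⟶ V` gives the
exchange with a shifted projective module (`IsExchangeTriangle.buanMarshShifted_iff`).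
-/

namespace ZeroAuslander

open scoped ZeroObject
set_option linter.unusedSectionVars false

/-! ### Fitting decompositions and splitting of idempotents -/

/-- Every endomorphism `h` is invertible on the image of an idempotent `e` commuting with it, and
nilpotent on the complement. -/
class FittingCategory (C : Type u) [Category.{v} C] [Preadditive C] : Prop where
  fitting : ∀ {X : C} (h : End X), ∃ e g : End X, e * e = e ∧ h * g = e ∧ g * h = e ∧
    ∃ n : ℕ, h ^ n * (1 - e) = 0 ∧ (1 - e) * h ^ n = 0

/-- The Fitting decomposition in a finite dimensional algebra, from the factorization
`X ^ n * q` of the minimal polynomial with `q` prime to `X`. -/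
lemma exists_fitting_of_finite (k : Type*) [Field k] {A : Type*} [Ring A] [Algebra k A]
    [Module.Finite k A] (h : A) : ∃ e g : A, e * e = e ∧ h * g = e ∧ g * h = e ∧
    ∃ n : ℕ, h ^ n * (1 - e) = 0 ∧ (1 - e) * h ^ n = 0 := by
  open Polynomial in
  obtain ⟨q, hq, hX⟩ := exists_eq_pow_rootMultiplicity_mul_and_not_dvd (minpoly k h)
    (minpoly.ne_zero (Algebra.IsIntegral.isIntegral h)) 0
  set n := rootMultiplicity 0 (minpoly k h)
  rw [C_0, sub_zero] at hq hX
  have hc : IsCoprime (X ^ (n + 1)) q :=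
    IsCoprime.pow_left ((prime_X.irreducible.coprime_iff_not_dvd).2 hX)
  obtain ⟨a, b, hab⟩ := hc
  have hz : h ^ n * aeval h q = 0 := by
    have := minpoly.aeval k h
    rwa [hq, map_mul, map_pow, aeval_X] at this
  have comm : ∀ r s : k[X], aeval h r * aeval h s = aeval h s * aeval h r := fun r s => by
    rw [← map_mul, mul_comm, map_mul]
  have hh : ∀ r : k[X], aeval h r * h = h * aeval h r := fun r => by
    simpa using comm r X
  have he : 1 - aeval h (a * X ^ (n + 1)) = aeval h (b * q) := by
    rw [sub_eq_iff_eq_add, ← map_add, add_comm, hab, map_one]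
  have hz' : h ^ n * (1 - aeval h (a * X ^ (n + 1))) = 0 := by
    rw [he, mul_comm b, map_mul, ← mul_assoc, hz, zero_mul]
  have hz2 : (1 - aeval h (a * X ^ (n + 1))) * h ^ n = 0 := by
    rw [he]
    have := comm (b * q) (X ^ n)
    rw [map_pow, aeval_X] at this
    rw [this, ← he, hz']
  refine ⟨aeval h (a * X ^ (n + 1)), aeval h (a * X ^ n), ?_, ?_, ?_, n, hz', hz2⟩
  · have : aeval h (a * X ^ (n + 1)) * (1 - aeval h (a * X ^ (n + 1))) = 0 := by
      conv_lhs => enter [1]; rw [pow_succ', ← mul_assoc, map_mul, map_pow, aeval_X]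
      rw [mul_assoc, hz', mul_zero]
    rw [mul_sub, mul_one, sub_eq_zero] at this
    exact this.symm
  · rw [← hh, pow_succ, ← mul_assoc, map_mul _ _ X, aeval_X]
  · rw [pow_succ, ← mul_assoc, map_mul _ _ X, aeval_X]

lemma fittingCategory_of_finite (k : Type*) [Field k] {C : Type u} [Category.{v} C] [Preadditive C]
    [Linear k C] (homFinite : ∀ X Y : C, Module.Finite k (X ⟶ Y)) : FittingCategory C where
  fitting {X} h :=
    have : Module.Finite k (End X) := homFinite X X
    exists_fitting_of_finite k h

section Split

variable {C : Type u} [Category.{v} C] [Preadditive C]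

/-- If `X` decomposes into `F` and `V` and `b : X ⟶ F` retracts `F ⟶ X`, then an idempotent of `X`
killed by `b` is determined by its compression to `V`. -/
lemma idempotent_splits_of_comp_eq_zero {X F V : C} (i : F ⟶ X) (j : V ⟶ X) (p : X ⟶ F) (q : X ⟶ V)
    (hX : p ≫ i + q ≫ j = 𝟙 X)
    (hV : ∀ t : V ⟶ V, t ≫ t = t → ∃ (Y : C) (s : Y ⟶ V) (r : V ⟶ Y), s ≫ r = 𝟙 Y ∧ r ≫ s = t)
    (b : X ⟶ F) (hb : i ≫ b = 𝟙 F) (e : X ⟶ X) (he : e ≫ e = e) (heb : e ≫ b = 0) :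
    ∃ (Y : C) (s : Y ⟶ X) (r : X ⟶ Y), s ≫ r = 𝟙 Y ∧ r ≫ s = e := by
  set j' : V ⟶ X := j ≫ (𝟙 X - b ≫ i) with hj'
  have key : q ≫ j' = 𝟙 X - b ≫ i := by
    have : q ≫ j = 𝟙 X - p ≫ i := by rw [← hX]; abel
    rw [hj', reassoc_of% this]
    simp [Preadditive.comp_sub, Preadditive.sub_comp, reassoc_of% hb]
  have hkey : e ≫ q ≫ j' = e := by
    rw [key, Preadditive.comp_sub, Category.comp_id, reassoc_of% heb, zero_comp, sub_zero]
  obtain ⟨Y, s, r, hsr, hrs⟩ := hV (j' ≫ e ≫ q) (by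
    simp only [Category.assoc]
    rw [reassoc_of% hkey, reassoc_of% he])
  refine ⟨Y, s ≫ j' ≫ e, e ≫ q ≫ r, ?_, ?_⟩
  · have : s ≫ (j' ≫ e ≫ q) ≫ r = 𝟙 Y := by rw [← hrs]; simp [hsr]
    simp only [Category.assoc] at this ⊢
    rw [reassoc_of% he, this]
  · have : (e ≫ q) ≫ (r ≫ s) ≫ (j' ≫ e) = e := by
      rw [hrs]; simp only [Category.assoc]
      rw [reassoc_of% hkey, reassoc_of% hkey, he, he]
    simpa only [Category.assoc] using this

/-- Splitting off an object with local endomorphism ring preserves splitting of idempotents. -/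
lemma idempotent_splits_of_isLocalRing [HasBinaryBiproducts C] {X F V : C} [IsLocalRing (End F)]
    (i : F ⟶ X) (j : V ⟶ X) (p : X ⟶ F) (q : X ⟶ V)
    (hX : p ≫ i + q ≫ j = 𝟙 X) (hi : i ≫ p = 𝟙 F)
    (hV : ∀ t : V ⟶ V, t ≫ t = t → ∃ (Y : C) (s : Y ⟶ V) (r : V ⟶ Y), s ≫ r = 𝟙 Y ∧ r ≫ s = t)
    (e : X ⟶ X) (he : e ≫ e = e) :
    ∃ (Y : C) (s : Y ⟶ X) (r : X ⟶ Y), s ≫ r = 𝟙 Y ∧ r ≫ s = e := by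
  have hu : IsUnit (show End F from i ≫ e ≫ p) ∨ IsUnit (show End F from i ≫ (𝟙 X - e) ≫ p) := by
    refine IsLocalRing.isUnit_or_isUnit_of_add_one ?_
    change i ≫ e ≫ p + i ≫ (𝟙 X - e) ≫ p = 𝟙 F
    rw [← Preadditive.comp_add, ← Preadditive.add_comp]
    simp [hi]
  rcases hu with hu | hu
  · obtain ⟨c, hc⟩ := ((isUnit_iff_isIso _).1 hu).out
    have hc : i ≫ e ≫ p ≫ c = 𝟙 F := by simpa using hc.1
    set b : X ⟶ F := e ≫ p ≫ c
    have hib : i ≫ b = 𝟙 F := hc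
    have heb : e ≫ b = b := by simp only [b, reassoc_of% he]
    have hbe : ∀ {Z : C} (z : X ⟶ Z), i ≫ e ≫ b ≫ i ≫ z = i ≫ z := fun z => by
      rw [reassoc_of% heb, reassoc_of% hib]
    obtain ⟨Y, s, r, hsr, hrs⟩ := idempotent_splits_of_comp_eq_zero i j p q hX hV b hib
      (e - b ≫ i ≫ e) (by
        simp only [Preadditive.comp_sub, Preadditive.sub_comp, Category.assoc, he, reassoc_of% heb,
          reassoc_of% hib]
        abel) (by
        simp only [Preadditive.sub_comp, Category.assoc, heb, hib, Category.comp_id, sub_self])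
    have h1 : r ≫ s ≫ b = 0 := by
      rw [reassoc_of% hrs]
      simp only [Preadditive.sub_comp, Category.assoc, heb, hib, Category.comp_id, sub_self]
    have hsb : s ≫ b = 0 := by
      rw [← Category.id_comp (s ≫ b), ← hsr, Category.assoc, h1, comp_zero]
    have h2 : i ≫ e ≫ r ≫ s = 0 := by
      rw [hrs]
      simp only [Preadditive.comp_sub, reassoc_of% heb, reassoc_of% hib, he, sub_self]
    have hir : i ≫ e ≫ r = 0 := by
      rw [← Category.comp_id (i ≫ e ≫ r), ← hsr]
      simp only [Category.assoc]
      rw [reassoc_of% h2, zero_comp]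
    refine ⟨F ⊞ Y, biprod.desc (i ≫ e) s, biprod.lift b r, ?_, ?_⟩
    · ext <;> simp [heb, hib, hsr, hsb, hir]
    · rw [biprod.lift_desc, hrs]; abel
  · obtain ⟨c, hc⟩ := ((isUnit_iff_isIso _).1 hu).out
    have hc : i ≫ (𝟙 X - e) ≫ p ≫ c = 𝟙 F := by simpa using hc.1
    refine idempotent_splits_of_comp_eq_zero i j p q hX hV ((𝟙 X - e) ≫ p ≫ c) hc e he ?_
    rw [← Category.assoc, Preadditive.comp_sub, he, Category.comp_id, sub_self, zero_comp]

/-- A Krull-Schmidt category is idempotent complete. -/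
lemma IsKrullSchmidt.isIdempotentComplete [HasBinaryBiproducts C]
    [HasFiniteBiproducts C] (h : IsKrullSchmidt C) : IsIdempotentComplete C := by
  have key : ∀ (n : ℕ) (F : Fin n → C), (∀ i, IsLocalRing (End (F i))) → ∀ e : (⨁ F) ⟶ (⨁ F),
      e ≫ e = e → ∃ (Y : C) (s : Y ⟶ ⨁ F) (r : ⨁ F ⟶ Y), s ≫ r = 𝟙 Y ∧ r ≫ s = e := by
    intro n
    induction n with
    | zero =>
      intro F _ e _
      have : ∀ f g : (⨁ F) ⟶ (⨁ F), f = g := fun f g => biproduct.hom_ext _ _ fun i => i.elim0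
      exact ⟨_, 𝟙 _, 𝟙 _, by simp, this _ _⟩
    | succ n ih =>
      intro F hF e he
      have := hF 0
      refine idempotent_splits_of_isLocalRing (F := F 0) (V := ⨁ fun i : Fin n => F i.succ)
        (biproduct.ι F 0) (biproduct.desc fun i => biproduct.ι F i.succ)
        (biproduct.π F 0) (biproduct.lift fun i => biproduct.π F i.succ) ?_ (by simp)
        (ih _ fun i => hF i.succ) e he
      rw [biproduct.lift_desc, ← biproduct.total, Fin.sum_univ_succ]
  refine ⟨fun X e he => ?_⟩
  obtain ⟨n, F, hF, ⟨φ⟩⟩ := h X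
  obtain ⟨Y, s, r, hsr, hrs⟩ := key n F hF (φ.inv ≫ e ≫ φ.hom) (by simp [reassoc_of% he])
  refine ⟨Y, s ≫ φ.inv, φ.hom ≫ r, by simp [hsr], ?_⟩
  rw [Category.assoc, reassoc_of% hrs]; simp

end Split

/-! ### Summands, the radical and additive closures -/

section Radical

variable {C : Type u} [Category.{v} C] [Preadditive C]

/-- The Jacobson radical of a preadditive category. -/
def IsRadical {X Y : C} (f : X ⟶ Y) : Prop := ∀ g : Y ⟶ X, IsIso (𝟙 X - f ≫ g)

/-- `1 - f g` is invertible if `1 - g f` is. -/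
lemma isIso_id_sub_comp_symm {X Y : C} (f : X ⟶ Y) (g : Y ⟶ X) [IsIso (𝟙 Y - g ≫ f)] :
    IsIso (𝟙 X - f ≫ g) := by
  set c := inv (𝟙 Y - g ≫ f)
  have h1 : c - g ≫ f ≫ c = 𝟙 Y := by
    have := IsIso.hom_inv_id (𝟙 Y - g ≫ f)
    simpa only [Preadditive.sub_comp, Category.id_comp, Category.assoc] using this
  have h2 : c - c ≫ g ≫ f = 𝟙 Y := by
    have := IsIso.inv_hom_id (𝟙 Y - g ≫ f)
    simpa only [Preadditive.comp_sub, Category.comp_id] using this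
  refine ⟨𝟙 X + f ≫ c ≫ g, ?_, ?_⟩
  · have : g ≫ f ≫ c = c - 𝟙 Y := by rw [← h1]; abel
    simp only [Preadditive.sub_comp, Preadditive.comp_add, Category.comp_id,
      Category.id_comp, Category.assoc, reassoc_of% this]
    simp
  · have : c ≫ g ≫ f = c - 𝟙 Y := by rw [← h2]; abel
    have h3 : c ≫ g ≫ f ≫ g = c ≫ g - g := by
      rw [reassoc_of% this, Preadditive.sub_comp, Category.id_comp]
    simp only [Preadditive.add_comp, Preadditive.comp_sub, Category.comp_id,
      Category.id_comp, Category.assoc, h3]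
    simp

namespace IsRadical

lemma comp_right {X Y Z : C} {f : X ⟶ Y} (hf : IsRadical f) (a : Y ⟶ Z) : IsRadical (f ≫ a) :=
  fun g => by simpa using hf (a ≫ g)

lemma comp_left {X Y Z : C} {f : X ⟶ Y} (hf : IsRadical f) (a : Z ⟶ X) : IsRadical (a ≫ f) :=
  fun g => by
    have := hf (g ≫ a)
    rw [Category.assoc]
    refine @isIso_id_sub_comp_symm _ _ _ _ _ a (f ≫ g) ?_
    simpa using this

lemma zero (X Y : C) : IsRadical (0 : X ⟶ Y) := fun g => by
  rw [zero_comp, sub_zero]; infer_instance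

lemma isIso_sub {X : C} {f : X ⟶ X} (hf : IsRadical f) : IsIso (𝟙 X - f) := by
  simpa using hf (𝟙 X)

lemma neg {X Y : C} {f : X ⟶ Y} (hf : IsRadical f) : IsRadical (-f) := by
  simpa using hf.comp_right (-𝟙 Y)

lemma isIso_add {X : C} {f : X ⟶ X} (hf : IsRadical f) : IsIso (𝟙 X + f) := by
  simpa using hf.neg.isIso_sub

lemma add {X Y : C} {f f' : X ⟶ Y} (hf : IsRadical f) (hf' : IsRadical f') :
    IsRadical (f + f') := fun g => by
  have := hf g
  have h2 := (hf'.comp_left (inv (𝟙 X - f ≫ g))) g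
  have : 𝟙 X - (f + f') ≫ g =
      (𝟙 X - f ≫ g) ≫ (𝟙 X - (inv (𝟙 X - f ≫ g) ≫ f') ≫ g) := by
    rw [Preadditive.comp_sub, Category.comp_id, Category.assoc, IsIso.hom_inv_id_assoc,
      Preadditive.add_comp]
    abel
  rw [this]
  infer_instance

lemma sum {X Y : C} {ι : Type*} (s : Finset ι) (f : ι → (X ⟶ Y)) (hf : ∀ i ∈ s, IsRadical (f i)) :
    IsRadical (∑ i ∈ s, f i) := by
  classical
  induction s using Finset.induction_on with
  | empty => simpa using zero X Y
  | insert a s ha ih =>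
    rw [Finset.sum_insert ha]
    exact (hf a (by simp)).add (ih fun i hi => hf i (by simp [hi]))

end IsRadical

/-- If `X` and `J` have no nonzero common retract, every morphism between them is radical: the image
of the Fitting idempotent of `f ≫ g` is a retract of both. -/
lemma isRadical_of_no_common_retract [FittingCategory C] [IsIdempotentComplete C] {X J : C}
    (h : ∀ Y : C, Nonempty (Retract Y X) → Nonempty (Retract Y J) → IsZero Y) (f : X ⟶ J) :
    IsRadical f := fun g => by
  obtain ⟨e, a, he, hea, hae, n, hn, -⟩ := FittingCategory.fitting (show End X from f ≫ g)
  have he' : e ≫ e = e := he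
  obtain ⟨Y, s, r, hsr, hrs⟩ := IsIdempotentComplete.idempotents_split X e he
  have hae' : f ≫ g ≫ a = e := by rw [← hae]; simp [End.mul_def]
  have hY := h Y ⟨⟨s, r, hsr⟩⟩ ⟨⟨s ≫ f, g ≫ a ≫ r, by
    rw [Category.assoc, reassoc_of% hae', ← hrs]; simp [hsr]⟩⟩
  have h0 : e = 0 := by rw [← hrs, hY.eq_of_tgt r 0, zero_comp]
  have : IsNilpotent (show End X from f ≫ g) := ⟨n, by simpa [h0] using hn⟩
  exact (isUnit_iff_isIso _).1 this.isUnit_one_sub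

lemma IsRadical.eq_zero_of_idempotent {X : C} {e : X ⟶ X} (h : IsRadical e) (he : e ≫ e = e) :
    e = 0 := by
  have := h.isIso_sub
  rw [← cancel_mono (𝟙 X - e), Preadditive.comp_sub, he]; simp

lemma IsRadical.isZero {X : C} (h : IsRadical (𝟙 X)) : IsZero X :=
  (IsZero.iff_id_eq_zero X).2 (h.eq_zero_of_idempotent (by simp))

end Radical

section Additive

variable {C : Type u} [Category.{v} C] [Preadditive C] [HasZeroObject C]
  [HasBinaryBiproducts C] [HasFiniteBiproducts C]

/-- A retract of an object of an idempotent complete category has a complement. -/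
lemma exists_iso_biprod_of_retract [IsIdempotentComplete C] {X B : C} (s : X ⟶ B) (r : B ⟶ X)
    (h : s ≫ r = 𝟙 X) : ∃ (Y : C) (φ : B ≅ X ⊞ Y), φ.hom ≫ biprod.fst = r ∧
      biprod.inl ≫ φ.inv = s := by
  obtain ⟨Y, i, p, hip, hpi⟩ := IsIdempotentComplete.idempotents_split B (𝟙 B - r ≫ s) (by
    simp [Preadditive.sub_comp, Preadditive.comp_sub, reassoc_of% h])
  have h1 : s ≫ p = 0 := by
    rw [← Category.comp_id (s ≫ p), ← hip, Category.assoc, reassoc_of% hpi]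
    simp [Preadditive.sub_comp, Preadditive.comp_sub, reassoc_of% h]
  have h2 : i ≫ r = 0 := by
    rw [← Category.id_comp (i ≫ r), ← hip, Category.assoc, reassoc_of% hpi]
    simp [Preadditive.sub_comp, Preadditive.comp_sub, h]
  exact ⟨Y, ⟨biprod.lift r p, biprod.desc s i, by rw [biprod.lift_desc, hpi]; abel, by
    ext <;> simp [h, h1, h2, hip]⟩, by simp, by simp⟩

lemma IsSummand.retract {X B : C} (h : IsSummand X B) : Nonempty (Retract X B) := by
  obtain ⟨Y, ⟨e⟩⟩ := h
  exact ⟨⟨biprod.inl ≫ e.inv, e.hom ≫ biprod.fst, by simp⟩⟩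

lemma isSummand_of_retract [IsIdempotentComplete C] {X B : C} (h : Retract X B) :
    IsSummand X B := by
  obtain ⟨Y, φ, -, -⟩ := exists_iso_biprod_of_retract h.i h.r h.retract
  exact ⟨Y, ⟨φ⟩⟩

lemma IsSummand.of_iso {X B B' : C} (h : IsSummand X B) (e : B ≅ B') : IsSummand X B' := by
  obtain ⟨Y, ⟨f⟩⟩ := h
  exact ⟨Y, ⟨e.symm.trans f⟩⟩

lemma isSummand_left (X Y : C) : IsSummand X (X ⊞ Y) := ⟨Y, ⟨Iso.refl _⟩⟩

lemma isSummand_right (X Y : C) : IsSummand Y (X ⊞ Y) := ⟨X, ⟨biprod.braiding X Y⟩⟩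

/-- `X ≅ X ⊞ Y` for a zero object `Y`. -/
noncomputable def isoBiprodZeroRight (X : C) {Y : C} (hY : IsZero Y) : X ≅ X ⊞ Y where
  hom := biprod.inl
  inv := biprod.fst
  inv_hom_id := by
    refine biprod.hom_ext' _ _ (by simp) (hY.eq_of_src _ _)

lemma isSummand_self (X : C) : IsSummand X X :=
  ⟨0, ⟨isoBiprodZeroRight X (isZero_zero C)⟩⟩

lemma IsSummand.of_iso_left {X X' B : C} (h : IsSummand X B) (e : X ≅ X') : IsSummand X' B := by
  obtain ⟨Y, ⟨f⟩⟩ := h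
  exact ⟨Y, ⟨f.trans (biprod.mapIso e (Iso.refl Y))⟩⟩

lemma IsSummand.trans [IsIdempotentComplete C] {X Y Z : C} (h : IsSummand X Y)
    (h' : IsSummand Y Z) : IsSummand X Z := by
  obtain ⟨a⟩ := h.retract
  obtain ⟨b⟩ := h'.retract
  exact isSummand_of_retract (a.trans b)

/-- `X` lies in `add U` exactly if its identity is a finite sum of morphisms through `U`. -/
lemma InAdd.exists_sum {U X : C} (h : InAdd U X) :
    ∃ (n : ℕ) (s : Fin n → (X ⟶ U)) (r : Fin n → (U ⟶ X)), ∑ i, s i ≫ r i = 𝟙 X := by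
  obtain ⟨n, h⟩ := h
  obtain ⟨ρ⟩ := h.retract
  refine ⟨n, fun i => ρ.i ≫ biproduct.π (fun _ : Fin n => U) i, fun i => biproduct.ι (fun _ : Fin n => U) i ≫ ρ.r, ?_⟩
  have : ρ.i ≫ (∑ i : Fin n, biproduct.π (fun _ : Fin n => U) i ≫ biproduct.ι (fun _ : Fin n => U) i) ≫ ρ.r
      = 𝟙 X := by
    rw [biproduct.total, Category.id_comp, ρ.retract]
  simpa only [Preadditive.comp_sum, Preadditive.sum_comp, Category.assoc, Category.comp_id, Category.id_comp,
      Retract.retract] using this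

lemma InAdd.of_sum [IsIdempotentComplete C] {U X : C} {ι : Type*} [Fintype ι]
    (s : ι → (X ⟶ U)) (r : ι → (U ⟶ X)) (h : ∑ i, s i ≫ r i = 𝟙 X) : InAdd U X := by
  refine ⟨Fintype.card ι, isSummand_of_retract ⟨biproduct.lift fun i => s ((Fintype.equivFin ι).symm i),
    biproduct.desc fun i => r ((Fintype.equivFin ι).symm i), ?_⟩⟩
  rw [biproduct.lift_desc, ← h]
  exact Equiv.sum_comp (Fintype.equivFin ι).symm fun i => s i ≫ r i

lemma inAdd_self (U : C) : InAdd U U := by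
  refine ⟨1, 0, ⟨(?_ : U ≅ ⨁ fun _ : Fin 1 => U).symm.trans
    (isoBiprodZeroRight U (isZero_zero C))⟩⟩
  exact (biproductUniqueIso fun _ : Fin 1 => U).symm

lemma inAdd_of_isZero {U X : C} (hX : IsZero X) : InAdd U X := by
  have h0 : IsZero (⨁ fun _ : Fin 0 => U) := by
    rw [IsZero.iff_id_eq_zero]; exact biproduct.hom_ext _ _ fun i => i.elim0
  exact ⟨0, 0, ⟨h0.iso ((IsZero.of_iso hX (isoBiprodZeroRight X (isZero_zero C)).symm))⟩⟩

lemma InAdd.of_iso {U X X' : C} (h : InAdd U X) (e : X ≅ X') : InAdd U X' := by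
  obtain ⟨n, h⟩ := h
  exact ⟨n, h.of_iso_left e⟩

lemma indecomposable_of_iso {X Y : C} (hX : Indecomposable X) (e : X ≅ Y) : Indecomposable Y :=
  ⟨fun h => hX.1 (h.of_iso e), fun A B φ => hX.2 A B (e.trans φ)⟩

section IdempotentComplete

variable [IsIdempotentComplete C]

lemma InAdd.of_retract {U X Y : C} (h : InAdd U X) (ρ : Retract Y X) : InAdd U Y := by
  obtain ⟨n, h⟩ := h
  exact ⟨n, (isSummand_of_retract ρ).trans h⟩

lemma InAdd.of_isSummand {U X Y : C} (h : InAdd U X) (hY : IsSummand Y X) : InAdd U Y :=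
  h.of_retract hY.retract.some

lemma IsSummand.inAdd {U X : C} (h : IsSummand X U) : InAdd U X :=
  (inAdd_self U).of_isSummand h

lemma InAdd.trans {U V X : C} (h : InAdd V X) (h' : InAdd U V) : InAdd U X := by
  obtain ⟨n, s, r, hsr⟩ := h.exists_sum
  obtain ⟨m, s', r', hsr'⟩ := h'.exists_sum
  refine InAdd.of_sum (ι := Fin n × Fin m) (fun i => s i.1 ≫ s' i.2) (fun i => r' i.2 ≫ r i.1) ?_
  rw [Fintype.sum_prod_type, ← hsr]
  refine Finset.sum_congr rfl fun i _ => ?_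
  have : s i ≫ (∑ j, s' j ≫ r' j) ≫ r i = s i ≫ r i := by rw [hsr', Category.id_comp]
  simpa only [Preadditive.comp_sum, Preadditive.sum_comp, Category.assoc, Category.comp_id, Category.id_comp,
      Retract.retract] using this

lemma InAdd.biprod {U X Y : C} (hX : InAdd U X) (hY : InAdd U Y) : InAdd U (X ⊞ Y) := by
  obtain ⟨n, s, r, h⟩ := hX.exists_sum
  obtain ⟨m, s', r', h'⟩ := hY.exists_sum
  refine InAdd.of_sum (ι := Fin n ⊕ Fin m)
    (Sum.elim (fun i => biprod.fst ≫ s i) (fun i => biprod.snd ≫ s' i))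
    (Sum.elim (fun i => r i ≫ biprod.inl) (fun i => r' i ≫ biprod.inr)) ?_
  rw [Fintype.sum_sum_type]
  simp only [Sum.elim_inl, Sum.elim_inr, Category.assoc]
  have e1 : (biprod.fst : X ⊞ Y ⟶ X) ≫ (∑ i, s i ≫ r i) ≫ (biprod.inl : X ⟶ X ⊞ Y) =
      biprod.fst ≫ biprod.inl := by
    rw [h, Category.id_comp]
  have e2 : (biprod.snd : X ⊞ Y ⟶ Y) ≫ (∑ i, s' i ≫ r' i) ≫ (biprod.inr : Y ⟶ X ⊞ Y) =
      biprod.snd ≫ biprod.inr := by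
    rw [h', Category.id_comp]
  simp only [Preadditive.comp_sum, Preadditive.sum_comp, Category.assoc] at e1 e2
  rw [e1, e2, biprod.total]

lemma InAdd.biproduct {U : C} {n : ℕ} {X : Fin n → C} (h : ∀ i, InAdd U (X i)) :
    InAdd U (⨁ X) := by
  choose m s r hsr using fun i => (h i).exists_sum
  refine InAdd.of_sum (ι := Σ i, Fin (m i)) (fun i => biproduct.π X i.1 ≫ s i.1 i.2)
    (fun i => r i.1 i.2 ≫ biproduct.ι X i.1) ?_
  rw [Fintype.sum_sigma, ← biproduct.total]
  refine Finset.sum_congr rfl fun i _ => ?_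
  have : biproduct.π X i ≫ (∑ j, s i j ≫ r i j) ≫ biproduct.ι X i =
      biproduct.π X i ≫ biproduct.ι X i := by rw [hsr, Category.id_comp]
  simpa only [Preadditive.comp_sum, Preadditive.sum_comp, Category.assoc, Category.comp_id, Category.id_comp,
      Retract.retract] using this

lemma InAdd.mono {U U' X : C} (h : InAdd U X) (hU : IsSummand U U') : InAdd U' X :=
  h.trans hU.inAdd

lemma inAdd_congr {U U' : C} (e : U ≅ U') (X : C) : InAdd U X ↔ InAdd U' X :=
  ⟨fun h => h.trans ((inAdd_self U').of_iso e.symm), fun h => h.trans ((inAdd_self U).of_iso e)⟩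

variable [FittingCategory C]

lemma NoCommonSummand.isRadical {U B : C} (h : NoCommonSummand U B) {W : C} (hW : InAdd U W)
    (f : B ⟶ W) : IsRadical f :=
  isRadical_of_no_common_retract (fun _ h1 h2 => h _ (isSummand_of_retract h1.some)
    (hW.of_retract h2.some)) f

lemma NoCommonSummand.isRadical' {U B : C} (h : NoCommonSummand U B) {W : C} (hW : InAdd U W)
    (f : W ⟶ B) : IsRadical f :=
  isRadical_of_no_common_retract (fun _ h1 h2 => h _ (isSummand_of_retract h2.some)
    (hW.of_retract h1.some)) f

lemma noCommonSummand_of_isRadical {U B : C}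
    (h : ∀ (W : C), InAdd U W → ∀ f : B ⟶ W, IsRadical f) : NoCommonSummand U B := by
  intro X hX hU
  obtain ⟨ρ⟩ := hX.retract
  exact IsRadical.isZero (ρ.retract ▸ (h X hU ρ.r).comp_left ρ.i)

lemma NoCommonSummand.of_isSummand {U B X : C} (h : NoCommonSummand U B) (hX : IsSummand X B) :
    NoCommonSummand U X := fun Y hY hU => h Y (hY.trans hX) hU

/-- Cancellation of summands in `add U`. -/
lemma NoCommonSummand.cancel {U Y Z U₁ U₂ : C} (hY : NoCommonSummand U Y)
    (hZ : NoCommonSummand U Z) (h₁ : InAdd U U₁) (h₂ : InAdd U U₂) (e : Y ⊞ U₁ ≅ Z ⊞ U₂) :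
    Nonempty (Y ≅ Z) := by
  have key : ∀ {Y Z U₁ U₂ : C} (_ : NoCommonSummand U Y) (_ : InAdd U U₂) (e : Y ⊞ U₁ ≅ Z ⊞ U₂),
      IsIso ((biprod.inl ≫ e.hom ≫ biprod.fst) ≫ (biprod.inl ≫ e.inv ≫ biprod.fst) : Y ⟶ Y) := by
    intro Y Z U₁ U₂ hY h₂ e
    have : (biprod.inl ≫ e.hom ≫ biprod.fst) ≫ (biprod.inl ≫ e.inv ≫ biprod.fst) =
        𝟙 Y - (biprod.inl ≫ e.hom ≫ biprod.snd) ≫ (biprod.inr ≫ e.inv ≫ biprod.fst) := by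
      rw [eq_sub_iff_add_eq]
      have := biprod.total (X := Z) (Y := U₂)
      calc _ = biprod.inl ≫ e.hom ≫ (biprod.fst ≫ biprod.inl + biprod.snd ≫ biprod.inr) ≫
            e.inv ≫ biprod.fst := by
              simp only [Preadditive.comp_add, Preadditive.add_comp, Category.assoc]
        _ = _ := by rw [this]; simp
    rw [this]
    exact (hY.isRadical h₂ _) _
  have h1 := key hY h₂ e
  have h2 := key hZ h₁ e.symm
  rw [Iso.symm_hom, Iso.symm_inv] at h2
  set a : Y ⟶ Z := biprod.inl ≫ e.hom ≫ biprod.fst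
  set b : Z ⟶ Y := biprod.inl ≫ e.inv ≫ biprod.fst
  have : IsSplitMono a := IsSplitMono.mk' ⟨b ≫ inv (a ≫ b), by
    rw [← Category.assoc, IsIso.hom_inv_id]⟩
  have : IsSplitEpi a := IsSplitEpi.mk' ⟨inv (b ≫ a) ≫ b, by
    rw [Category.assoc, IsIso.inv_hom_id]⟩
  exact ⟨@asIso _ _ _ _ a (isIso_of_epi_of_isSplitMono a)⟩

/-- Fitting lemma. -/
lemma isIso_or_isNilpotent_of_indecomposable {X : C} (hX : Indecomposable X) (h : End X) :
    IsIso (show X ⟶ X from h) ∨ IsNilpotent h := by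
  obtain ⟨e, g, he, hg, hg', n, hn, -⟩ := FittingCategory.fitting h
  obtain ⟨Y, s, r, hsr, hrs⟩ := IsIdempotentComplete.idempotents_split X e he
  obtain ⟨Z, φ, h1, h2⟩ := exists_iso_biprod_of_retract s r hsr
  rcases hX.2 Y Z φ with h0 | h0
  · right
    have : e = 0 := by rw [← hrs, h0.eq_of_tgt r 0, zero_comp]
    exact ⟨n, by simpa [this] using hn⟩
  · left
    have he1 : e = 𝟙 X := by
      rw [← hrs, ← h1, ← h2]
      have : biprod.fst ≫ biprod.inl = 𝟙 (Y ⊞ Z) := by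
        rw [← biprod.total, h0.eq_of_tgt biprod.snd 0, zero_comp, add_zero]
      rw [Category.assoc, reassoc_of% this]; simp
    exact ⟨g, hg'.trans he1, hg.trans he1⟩

/-- The endomorphism ring of an indecomposable object is local. -/
lemma isIso_or_isIso_of_add {X : C} (hX : Indecomposable X) (f g : X ⟶ X) (h : IsIso (f + g)) :
    IsIso f ∨ IsIso g := by
  rcases isIso_or_isNilpotent_of_indecomposable hX (f ≫ inv (f + g)) with h1 | h1
  · left
    have : f = (f ≫ inv (f + g)) ≫ (f + g) := by rw [Category.assoc, IsIso.inv_hom_id, Category.comp_id]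
    rw [this]; infer_instance
  · right
    have h2 : g ≫ inv (f + g) = 𝟙 X - f ≫ inv (f + g) := by
      rw [eq_sub_iff_add_eq, ← Preadditive.add_comp, add_comm g f, IsIso.hom_inv_id]
    have h3 : IsIso (g ≫ inv (f + g)) := by
      rw [h2]; exact (isUnit_iff_isIso _).1 h1.isUnit_one_sub
    have : g = (g ≫ inv (f + g)) ≫ (f + g) := by rw [Category.assoc, IsIso.inv_hom_id, Category.comp_id]
    rw [this]; infer_instance

lemma exists_isIso_of_sum {X : C} (hX : Indecomposable X) {ι : Type*} (t : Finset ι)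
    (f : ι → (X ⟶ X)) (h : IsIso (∑ i ∈ t, f i)) : ∃ i ∈ t, IsIso (f i) := by
  classical
  induction t using Finset.induction_on with
  | empty =>
    exfalso
    rw [Finset.sum_empty] at h
    refine hX.1 ((IsZero.iff_id_eq_zero X).2 ?_)
    rw [← cancel_mono (0 : X ⟶ X)]; simp
  | insert a t ha ih =>
    rw [Finset.sum_insert ha] at h
    rcases isIso_or_isIso_of_add hX _ _ h with h | h
    · exact ⟨a, by simp, h⟩
    · obtain ⟨i, hi, h⟩ := ih h
      exact ⟨i, by simp [hi], h⟩

/-- A nonzero retract of an indecomposable object is isomorphic to it. -/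
lemma isIso_of_retract_indecomposable {X F : C} (hF : Indecomposable F) (hX : ¬ IsZero X)
    (s : X ⟶ F) (r : F ⟶ X) (h : s ≫ r = 𝟙 X) : IsIso s := by
  obtain ⟨Z, φ, h1, h2⟩ := exists_iso_biprod_of_retract s r h
  have h0 := (hF.2 X Z φ).resolve_left hX
  refine ⟨r, h, ?_⟩
  rw [← h1, ← h2]
  have : biprod.fst ≫ biprod.inl = 𝟙 (X ⊞ Z) := by
    rw [← biprod.total, h0.eq_of_tgt biprod.snd 0, zero_comp, add_zero]
  rw [Category.assoc, reassoc_of% this]; simp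

/-- An indecomposable summand of a direct sum of indecomposables is one of them. -/
lemma exists_iso_of_isSummand_biproduct {X B : C} (hX : Indecomposable X) (h : IsSummand X B)
    {n : ℕ} (F : Fin n → C) (hF : ∀ i, Indecomposable (F i)) (e : B ≅ ⨁ F) :
    ∃ i, Nonempty (X ≅ F i) := by
  obtain ⟨ρ⟩ := (h.of_iso e).retract
  have h1 : ∑ i, (ρ.i ≫ biproduct.π F i) ≫ (biproduct.ι F i ≫ ρ.r) = 𝟙 X := by
    have : ρ.i ≫ (∑ i, biproduct.π F i ≫ biproduct.ι F i) ≫ ρ.r = 𝟙 X := by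
      rw [biproduct.total, Category.id_comp, ρ.retract]
    simpa only [Preadditive.comp_sum, Preadditive.sum_comp, Category.assoc, Category.comp_id, Category.id_comp,
      Retract.retract] using this
  obtain ⟨i, -, hi⟩ := exists_isIso_of_sum hX Finset.univ _ (by rw [h1]; infer_instance)
  have := isIso_of_retract_indecomposable (hF i) hX.1 (ρ.i ≫ biproduct.π F i)
    ((biproduct.ι F i ≫ ρ.r) ≫ inv ((ρ.i ≫ biproduct.π F i) ≫ biproduct.ι F i ≫ ρ.r)) (by
      rw [← Category.assoc, IsIso.hom_inv_id])
  exact ⟨i, ⟨asIso (ρ.i ≫ biproduct.π F i)⟩⟩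

end IdempotentComplete

lemma indecomposable_of_isLocalRing {F : C} [IsLocalRing (End F)] : Indecomposable F := by
  refine ⟨fun h => ?_, fun Y Z e => ?_⟩
  · exact one_ne_zero (α := End F) ((IsZero.iff_id_eq_zero F).1 h)
  · have h : (show End F from e.hom ≫ biprod.fst ≫ biprod.inl ≫ e.inv) +
        (show End F from e.hom ≫ biprod.snd ≫ biprod.inr ≫ e.inv) = 1 := by
      change e.hom ≫ biprod.fst ≫ biprod.inl ≫ e.inv + e.hom ≫ biprod.snd ≫ biprod.inr ≫ e.inv = 𝟙 F
      have : e.hom ≫ (biprod.fst ≫ biprod.inl + biprod.snd ≫ biprod.inr) ≫ e.inv = 𝟙 F := by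
        rw [biprod.total]; simp
      simpa only [Preadditive.comp_add, Preadditive.add_comp, Category.assoc] using this
    rcases IsLocalRing.isUnit_or_isUnit_of_add_one h with h | h
    · right
      have := (isUnit_iff_isIso _).1 h
      have h2 : biprod.inr ≫ e.inv ≫ (e.hom ≫ biprod.fst ≫ biprod.inl ≫ e.inv) = 0 := by simp
      rw [← Category.assoc, ← zero_comp, cancel_mono] at h2
      rw [IsZero.iff_id_eq_zero]
      have := congrArg (· ≫ e.hom ≫ biprod.snd) h2
      simpa using this
    · left
      have := (isUnit_iff_isIso _).1 h
      have h2 : biprod.inl ≫ e.inv ≫ (e.hom ≫ biprod.snd ≫ biprod.inr ≫ e.inv) = 0 := by simp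
      rw [← Category.assoc, ← zero_comp, cancel_mono] at h2
      rw [IsZero.iff_id_eq_zero]
      have := congrArg (· ≫ e.hom ≫ biprod.fst) h2
      simpa using this

lemma IsKrullSchmidt.exists_indecomposables (h : IsKrullSchmidt C) (X : C) :
    ∃ (n : ℕ) (F : Fin n → C), (∀ i, Indecomposable (F i)) ∧ Nonempty (X ≅ ⨁ F) := by
  obtain ⟨n, F, hF, e⟩ := h X
  exact ⟨n, F, fun i => have := hF i; indecomposable_of_isLocalRing, e⟩

lemma isSummand_biproduct [IsIdempotentComplete C] {n : ℕ} (F : Fin n → C) (i : Fin n) :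
    IsSummand (F i) (⨁ F) :=
  isSummand_of_retract ⟨biproduct.ι F i, biproduct.π F i, by simp⟩

/-- Every indecomposable summand of `X` is one of the terms of a fixed decomposition. -/
lemma IsKrullSchmidt.finite_indClass [FittingCategory C] (h : IsKrullSchmidt C) (B : C) :
    Finite (IndClass B) := by
  have := h.isIdempotentComplete
  obtain ⟨n, F, hF, ⟨e⟩⟩ := h.exists_indecomposables B
  choose i hi using fun X : IndSummand B => exists_iso_of_isSummand_biproduct X.2.1 X.2.2 F hF e
  refine Finite.of_injective (fun x : IndClass B => i x.out) fun x y hxy => ?_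
  have h1 := hi x.out
  have h2 := hi y.out
  rw [← Quotient.out_eq x, ← Quotient.out_eq y]
  refine Quotient.sound ?_
  simp only at hxy
  rw [hxy] at h1
  exact ⟨h1.some.trans h2.some.symm⟩

end Additive

/-! ### Minimal approximations -/

section Approximations

variable {C : Type u} [Category.{v} C] [Preadditive C] [HasZeroObject C]
  [HasBinaryBiproducts C] [HasFiniteBiproducts C]

lemma IsMinLeftApprox.isRadical {U X V W : C} {f : X ⟶ V} (hf : IsMinLeftApprox U f) {h : V ⟶ W}
    (hh : f ≫ h = 0) : IsRadical h := fun g =>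
  hf.2 _ (by rw [Preadditive.comp_sub, reassoc_of% hh]; simp)

lemma IsMinRightApprox.isRadical {U X V W : C} {f : V ⟶ X} (hf : IsMinRightApprox U f) {h : W ⟶ V}
    (hh : h ≫ f = 0) : IsRadical h := fun g => by
  have : IsIso (𝟙 V - g ≫ h) := hf.2 _ (by
    rw [Preadditive.sub_comp, Category.assoc, hh, comp_zero, sub_zero, Category.id_comp])
  exact isIso_id_sub_comp_symm h g

lemma IsLeftApprox.isMin {U X V : C} {f : X ⟶ V} (hf : IsLeftApprox U f)
    (h : ∀ h : V ⟶ V, f ≫ h = 0 → IsRadical h) : IsMinLeftApprox U f := by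
  refine ⟨hf, fun g hg => ?_⟩
  have := (h (𝟙 V - g) (by rw [Preadditive.comp_sub, hg, Category.comp_id, sub_self])).isIso_sub
  simpa using this

lemma IsRightApprox.isMin {U X V : C} {f : V ⟶ X} (hf : IsRightApprox U f)
    (h : ∀ h : V ⟶ V, h ≫ f = 0 → IsRadical h) : IsMinRightApprox U f := by
  refine ⟨hf, fun g hg => ?_⟩
  have := (h (𝟙 V - g) (by rw [Preadditive.sub_comp, hg, Category.id_comp, sub_self])).isIso_sub
  simpa using this

lemma IsMinLeftApprox.exists_iso {U X V V' : C} {f : X ⟶ V} {f' : X ⟶ V'}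
    (hf : IsMinLeftApprox U f) (hf' : IsMinLeftApprox U f') : ∃ e : V ≅ V', f ≫ e.hom = f' := by
  obtain ⟨a, ha⟩ := hf.1.2 V' f' hf'.1.1
  obtain ⟨b, hb⟩ := hf'.1.2 V f hf.1.1
  have h1 := hf.2 (a ≫ b) (by rw [reassoc_of% ha, hb])
  have h2 := hf'.2 (b ≫ a) (by rw [reassoc_of% hb, ha])
  have : IsSplitMono a := IsSplitMono.mk' ⟨b ≫ inv (a ≫ b), by
    rw [← Category.assoc, IsIso.hom_inv_id]⟩
  have : IsSplitEpi a := IsSplitEpi.mk' ⟨inv (b ≫ a) ≫ b, by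
    rw [Category.assoc, IsIso.inv_hom_id]⟩
  exact ⟨@asIso _ _ _ _ a (isIso_of_epi_of_isSplitMono a), ha⟩

lemma IsMinRightApprox.exists_iso {U X V V' : C} {f : V ⟶ X} {f' : V' ⟶ X}
    (hf : IsMinRightApprox U f) (hf' : IsMinRightApprox U f') : ∃ e : V ≅ V', e.hom ≫ f' = f := by
  obtain ⟨a, ha⟩ := hf'.1.2 V f hf.1.1
  obtain ⟨b, hb⟩ := hf.1.2 V' f' hf'.1.1
  have h1 := hf.2 (a ≫ b) (by rw [Category.assoc, hb, ha])
  have h2 := hf'.2 (b ≫ a) (by rw [Category.assoc, ha, hb])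
  have : IsSplitMono a := IsSplitMono.mk' ⟨b ≫ inv (a ≫ b), by
    rw [← Category.assoc, IsIso.hom_inv_id]⟩
  have : IsSplitEpi a := IsSplitEpi.mk' ⟨inv (b ≫ a) ≫ b, by
    rw [Category.assoc, IsIso.inv_hom_id]⟩
  exact ⟨@asIso _ _ _ _ a (isIso_of_epi_of_isSplitMono a), ha⟩

lemma IsLeftApprox.comp_iso {U X X' V V' : C} {f : X ⟶ V} (hf : IsLeftApprox U f)
    (e : X' ≅ X) (e' : V ≅ V') : IsLeftApprox U (e.hom ≫ f ≫ e'.hom) := by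
  refine ⟨hf.1.of_iso e', fun W g hW => ?_⟩
  obtain ⟨h, hh⟩ := hf.2 W (e.inv ≫ g) hW
  exact ⟨e'.inv ≫ h, by simp [hh]⟩

lemma IsRightApprox.comp_iso {U X X' V V' : C} {f : V ⟶ X} (hf : IsRightApprox U f)
    (e : X ≅ X') (e' : V' ≅ V) : IsRightApprox U (e'.hom ≫ f ≫ e.hom) := by
  refine ⟨hf.1.of_iso e'.symm, fun W g hW => ?_⟩
  obtain ⟨h, hh⟩ := hf.2 W (g ≫ e.inv) hW
  exact ⟨h ≫ e'.inv, by simp [reassoc_of% hh]⟩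

lemma IsMinLeftApprox.comp_iso {U X X' V V' : C} {f : X ⟶ V} (hf : IsMinLeftApprox U f)
    (e : X' ≅ X) (e' : V ≅ V') : IsMinLeftApprox U (e.hom ≫ f ≫ e'.hom) := by
  refine ⟨hf.1.comp_iso e e', fun h hh => ?_⟩
  have := hf.2 (e'.hom ≫ h ≫ e'.inv) (by
    rw [← cancel_epi e.hom, ← cancel_mono e'.hom]; simpa using hh)
  have h2 : h = e'.inv ≫ (e'.hom ≫ h ≫ e'.inv) ≫ e'.hom := by simp
  rw [h2]; infer_instance

lemma IsMinRightApprox.comp_iso {U X X' V V' : C} {f : V ⟶ X} (hf : IsMinRightApprox U f)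
    (e : X ≅ X') (e' : V' ≅ V) : IsMinRightApprox U (e'.hom ≫ f ≫ e.hom) := by
  refine ⟨hf.1.comp_iso e e', fun h hh => ?_⟩
  have := hf.2 (e'.inv ≫ h ≫ e'.hom) (by
    rw [← cancel_epi e'.hom, ← cancel_mono e.hom]; simpa using hh)
  have h2 : h = e'.hom ≫ (e'.inv ≫ h ≫ e'.hom) ≫ e'.inv := by simp
  rw [h2]; infer_instance

variable [IsIdempotentComplete C]

lemma IsMinLeftApprox.biproduct {U : C} {n : ℕ} {X V : Fin n → C} {f : ∀ i, X i ⟶ V i}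
    (hf : ∀ i, IsMinLeftApprox U (f i)) : IsMinLeftApprox U (biproduct.map f) := by
  refine IsLeftApprox.isMin ⟨InAdd.biproduct fun i => (hf i).1.1, fun W g hW => ?_⟩ fun h hh => ?_
  · choose l hl using fun i => (hf i).1.2 W (biproduct.ι X i ≫ g) hW
    exact ⟨biproduct.desc l, by ext i; simp [hl]⟩
  · have : h = ∑ i, biproduct.π V i ≫ biproduct.ι V i ≫ h := by
      simp only [← Category.assoc]
      rw [← Preadditive.sum_comp, biproduct.total, Category.id_comp]
    rw [this]
    refine IsRadical.sum _ _ fun i _ => IsRadical.comp_left ((hf i).isRadical ?_) _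
    rw [← biproduct.ι_map_assoc, hh, comp_zero]

lemma IsMinLeftApprox.biprod {U X V X' V' : C} {f : X ⟶ V} {f' : X' ⟶ V'}
    (hf : IsMinLeftApprox U f) (hf' : IsMinLeftApprox U f') :
    IsMinLeftApprox U (biprod.map f f') := by
  refine IsLeftApprox.isMin ⟨hf.1.1.biprod hf'.1.1, fun W g hW => ?_⟩ fun h hh => ?_
  · obtain ⟨a, ha⟩ := hf.1.2 W (biprod.inl ≫ g) hW
    obtain ⟨b, hb⟩ := hf'.1.2 W (biprod.inr ≫ g) hW
    exact ⟨biprod.desc a b, by ext <;> simp [ha, hb]⟩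
  · have : h = biprod.fst ≫ biprod.inl ≫ h + biprod.snd ≫ biprod.inr ≫ h := by
      rw [← Category.assoc, ← Category.assoc, ← Preadditive.add_comp, biprod.total,
        Category.id_comp]
    rw [this]
    refine (IsRadical.comp_left (hf.isRadical ?_) _).add (IsRadical.comp_left (hf'.isRadical ?_) _)
    · rw [← biprod.inl_map_assoc, hh, comp_zero]
    · rw [← biprod.inr_map_assoc, hh, comp_zero]

lemma IsMinRightApprox.biprod {U X V X' V' : C} {f : V ⟶ X} {f' : V' ⟶ X'}
    (hf : IsMinRightApprox U f) (hf' : IsMinRightApprox U f') :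
    IsMinRightApprox U (biprod.map f f') := by
  refine IsRightApprox.isMin ⟨hf.1.1.biprod hf'.1.1, fun W g hW => ?_⟩ fun h hh => ?_
  · obtain ⟨a, ha⟩ := hf.1.2 W (g ≫ biprod.fst) hW
    obtain ⟨b, hb⟩ := hf'.1.2 W (g ≫ biprod.snd) hW
    exact ⟨biprod.lift a b, by ext <;> simp [ha, hb]⟩
  · have : h = (h ≫ biprod.fst) ≫ biprod.inl + (h ≫ biprod.snd) ≫ biprod.inr := by
      rw [Category.assoc, Category.assoc, ← Preadditive.comp_add, biprod.total, Category.comp_id]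
    rw [this]
    refine (IsRadical.comp_right (hf.isRadical ?_) _).add
      (IsRadical.comp_right (hf'.isRadical ?_) _)
    · rw [Category.assoc, ← biprod.map_fst, ← Category.assoc, hh, zero_comp]
    · rw [Category.assoc, ← biprod.map_snd, ← Category.assoc, hh, zero_comp]

end Approximations

section HomFinite

variable (k : Type*) [Field k] {C : Type u} [Category.{v} C] [Preadditive C] [HasZeroObject C]
  [HasBinaryBiproducts C] [HasFiniteBiproducts C] [Linear k C]
  (homFinite : ∀ X Y : C, Module.Finite k (X ⟶ Y))

include homFinite

lemma finrank_end_le_of_retract {V W : C} (s : W ⟶ V) (r : V ⟶ W) (h : s ≫ r = 𝟙 W) :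
    Module.finrank k (W ⟶ W) ≤ Module.finrank k (V ⟶ V) := by
  have := homFinite V V
  refine LinearMap.finrank_le_finrank_of_injective
    (f := (Linear.rightComp k V s) ∘ₗ (Linear.leftComp k W r)) fun a b hab => ?_
  have hab : (r ≫ a) ≫ s = (r ≫ b) ≫ s := hab
  have := congrArg (fun x => s ≫ x ≫ r) hab
  simpa [h, reassoc_of% h] using this

/-- A retract with an endomorphism algebra of the same dimension is everything. -/
lemma retract_eq_id_of_finrank_le {V W : C} (s : W ⟶ V) (r : V ⟶ W) (h : s ≫ r = 𝟙 W)
    (hle : Module.finrank k (V ⟶ V) ≤ Module.finrank k (W ⟶ W)) : r ≫ s = 𝟙 V := by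
  have := homFinite V V
  have := homFinite W W
  have hinj : Function.Injective ((Linear.rightComp k V s) ∘ₗ (Linear.leftComp k W r)) := by
    intro a b hab
    have hab : (r ≫ a) ≫ s = (r ≫ b) ≫ s := hab
    have := congrArg (fun x => s ≫ x ≫ r) hab
    simpa [h, reassoc_of% h] using this
  have hdim := le_antisymm (finrank_end_le_of_retract k homFinite s r h) hle
  obtain ⟨g, hg⟩ := (LinearMap.injective_iff_surjective_of_finrank_eq_finrank hdim).1 hinj (𝟙 V)
  have hg : (r ≫ g) ≫ s = 𝟙 V := hg
  rw [← Category.comp_id (r ≫ s), ← hg]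
  simp [reassoc_of% h]

/-- A finite spanning set of `Hom(X, U)` assembles to an approximation `X ⟶ U^n`. -/
lemma exists_isLeftApprox (U X : C) : ∃ (V : C) (f : X ⟶ V), IsLeftApprox U f := by
  have := homFinite X U
  let b := Module.finBasis k (X ⟶ U)
  refine ⟨⨁ fun _ => U, biproduct.lift b, ⟨_, isSummand_self _⟩, fun W g hW => ?_⟩
  obtain ⟨n, s, r, hsr⟩ := hW.exists_sum
  refine ⟨∑ i, biproduct.desc (fun j => b.repr (g ≫ s i) j • 𝟙 U) ≫ r i, ?_⟩
  have : ∀ i, biproduct.lift b ≫ biproduct.desc (fun j => b.repr (g ≫ s i) j • 𝟙 U) = g ≫ s i := by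
    intro i
    rw [biproduct.lift_desc]
    simpa using b.sum_repr (g ≫ s i)
  rw [Preadditive.comp_sum]
  simp only [reassoc_of% this]
  rw [← Preadditive.comp_sum, hsr, Category.comp_id]

lemma exists_isRightApprox (U X : C) : ∃ (V : C) (f : V ⟶ X), IsRightApprox U f := by
  have := homFinite U X
  let b := Module.finBasis k (U ⟶ X)
  refine ⟨⨁ fun _ => U, biproduct.desc b, ⟨_, isSummand_self _⟩, fun W g hW => ?_⟩
  obtain ⟨n, s, r, hsr⟩ := hW.exists_sum
  refine ⟨∑ i, s i ≫ biproduct.lift (fun j => b.repr (r i ≫ g) j • 𝟙 U), ?_⟩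
  have : ∀ i, biproduct.lift (fun j => b.repr (r i ≫ g) j • 𝟙 U) ≫ biproduct.desc b = r i ≫ g := by
    intro i
    rw [biproduct.lift_desc]
    simpa using b.sum_repr (r i ≫ g)
  rw [Preadditive.sum_comp]
  simp only [Category.assoc, this]
  simp only [← Category.assoc]
  rw [← Preadditive.sum_comp, hsr, Category.id_comp]

variable [IsIdempotentComplete C]

/-- An approximation `f : X ⟶ V` with `End V` of least dimension is minimal: if `h` fixes `f`, then
so does its Fitting idempotent `e`, and `f` corestricted to the image of `e` is again an
approximation, so that `e = 1` and `h` is invertible. -/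
lemma exists_isMinLeftApprox (U X : C) : ∃ (V : C) (f : X ⟶ V), IsMinLeftApprox U f := by
  have := fittingCategory_of_finite k homFinite
  classical
  have hex : ∃ (m : ℕ) (V : C) (f : X ⟶ V), IsLeftApprox U f ∧ Module.finrank k (V ⟶ V) = m := by
    obtain ⟨V, f, hf⟩ := exists_isLeftApprox k homFinite U X
    exact ⟨_, V, f, hf, rfl⟩
  obtain ⟨V, f, hf, hm⟩ := Nat.find_spec hex
  refine ⟨V, f, hf, fun h hh => ?_⟩
  obtain ⟨e, g, he, hg, hg', n, -, hn⟩ := FittingCategory.fitting (show End V from h)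
  change V ⟶ V at e
  have hpow : ∀ n : ℕ, f ≫ (show V ⟶ V from (show End V from h) ^ n) = f := by
    intro n
    induction n with
    | zero => simp [End.one_def]
    | succ n ih => rw [pow_succ, End.mul_def, reassoc_of% hh]; exact ih
  have hfe : f ≫ e = f := by
    have h1 : (show V ⟶ V from (show End V from h) ^ n) ≫ (𝟙 V - e) = 0 := hn
    have h2 : f ≫ (𝟙 V - e) = 0 := by rw [← hpow n, Category.assoc, h1, comp_zero]
    rw [Preadditive.comp_sub, Category.comp_id, sub_eq_zero] at h2
    exact h2.symm
  obtain ⟨Y, s, r, hsr, hrs⟩ := IsIdempotentComplete.idempotents_split V e he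
  have happ : IsLeftApprox U (f ≫ r) := by
    refine ⟨hf.1.of_retract ⟨s, r, hsr⟩, fun W l hW => ?_⟩
    obtain ⟨a, ha⟩ := hf.2 W l hW
    refine ⟨s ≫ a, ?_⟩
    rw [Category.assoc, reassoc_of% hrs, reassoc_of% hfe, ha]
  have hle := Nat.find_min' hex ⟨Y, f ≫ r, happ, rfl⟩
  rw [← hm] at hle
  have h1 := retract_eq_id_of_finrank_le k homFinite s r hsr hle
  rw [hrs] at h1
  exact ⟨g, hg'.trans h1, hg.trans h1⟩

/-- Dual to `exists_isMinLeftApprox`. -/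
lemma exists_isMinRightApprox (U X : C) : ∃ (V : C) (f : V ⟶ X), IsMinRightApprox U f := by
  have := fittingCategory_of_finite k homFinite
  classical
  have hex : ∃ (m : ℕ) (V : C) (f : V ⟶ X), IsRightApprox U f ∧ Module.finrank k (V ⟶ V) = m := by
    obtain ⟨V, f, hf⟩ := exists_isRightApprox k homFinite U X
    exact ⟨_, V, f, hf, rfl⟩
  obtain ⟨V, f, hf, hm⟩ := Nat.find_spec hex
  refine ⟨V, f, hf, fun h hh => ?_⟩
  obtain ⟨e, g, he, hg, hg', n, hn, -⟩ := FittingCategory.fitting (show End V from h)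
  change V ⟶ V at e
  have hpow : ∀ n : ℕ, (show V ⟶ V from (show End V from h) ^ n) ≫ f = f := by
    intro n
    induction n with
    | zero => simp [End.one_def]
    | succ n ih => rw [pow_succ', End.mul_def, Category.assoc, hh]; exact ih
  have hfe : e ≫ f = f := by
    have h1 : (𝟙 V - e) ≫ (show V ⟶ V from (show End V from h) ^ n) = 0 := hn
    have h2 : (𝟙 V - e) ≫ f = 0 := by
      rw [← hpow n, ← Category.assoc]; exact (congrArg (· ≫ f) h1).trans zero_comp
    rw [Preadditive.sub_comp, Category.id_comp, sub_eq_zero] at h2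
    exact h2.symm
  obtain ⟨Y, s, r, hsr, hrs⟩ := IsIdempotentComplete.idempotents_split V e he
  have happ : IsRightApprox U (s ≫ f) := by
    refine ⟨hf.1.of_retract ⟨s, r, hsr⟩, fun W l hW => ?_⟩
    obtain ⟨a, ha⟩ := hf.2 W l hW
    refine ⟨a ≫ r, ?_⟩
    rw [Category.assoc, reassoc_of% hrs, hfe, ha]
  have hle := Nat.find_min' hex ⟨Y, s ≫ f, happ, rfl⟩
  rw [← hm] at hle
  have h1 := retract_eq_id_of_finrank_le k homFinite s r hsr hle
  rw [hrs] at h1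
  exact ⟨g, hg'.trans h1, hg.trans h1⟩

/-- A largest direct summand with a property `Q` stable under finite direct sums can be split off:
a complement with endomorphism algebra of least dimension has no nonzero summand with `Q`. -/
lemma exists_maximal_splitting (Q : C → Prop) (h0 : ∀ X, IsZero X → Q X)
    (hsum : ∀ X Y, Q X → Q Y → Q (X ⊞ Y)) (X : C) :
    ∃ X' X'' : C, Nonempty (X ≅ X' ⊞ X'') ∧ Q X'' ∧ ∀ Y, IsSummand Y X' → Q Y → IsZero Y := by
  classical
  have hex : ∃ (m : ℕ) (X' X'' : C), Nonempty (X ≅ X' ⊞ X'') ∧ Q X'' ∧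
      Module.finrank k (X' ⟶ X') = m :=
    ⟨_, X, 0, ⟨isoBiprodZeroRight X (isZero_zero C)⟩, h0 _ (isZero_zero C), rfl⟩
  obtain ⟨X', X'', ⟨e⟩, hQ, hm⟩ := Nat.find_spec hex
  refine ⟨X', X'', ⟨e⟩, hQ, fun Y ⟨R, ⟨φ⟩⟩ hY => ?_⟩
  have hle := Nat.find_min' hex ⟨R, Y ⊞ X'', ⟨e.trans ((biprod.mapIso (φ.trans
    (biprod.braiding Y R)) (Iso.refl X'')).trans (biprod.associator R Y X''))⟩,
    hsum _ _ hY hQ, rfl⟩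
  rw [← hm] at hle
  have h1 := retract_eq_id_of_finrank_le k homFinite (biprod.inr ≫ φ.inv) (φ.hom ≫ biprod.snd)
    (by simp) hle
  rw [IsZero.iff_id_eq_zero]
  have := congrArg (fun x => biprod.inl ≫ φ.inv ≫ x ≫ φ.hom ≫ biprod.fst) h1
  simpa using this.symm

end HomFinite

/-! ### Extension groups and long exact sequences -/

section PushPull

variable {C : Type u} [Category.{v} C] (E : Cᵒᵖ ⥤ C ⥤ AddCommGrpCat.{w})

@[simp] lemma push_id {Z A : C} (δ : Extn E Z A) : push E (𝟙 A) δ = δ := by simp [push]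

@[simp] lemma pull_id {Z A : C} (δ : Extn E Z A) : pull E (𝟙 Z) δ = δ := by simp [pull]

lemma push_comp {Z A A' A'' : C} (f : A ⟶ A') (g : A' ⟶ A'') (δ : Extn E Z A) :
    push E (f ≫ g) δ = push E g (push E f δ) := by simp [push]

lemma pull_comp {Z Z' Z'' A : C} (f : Z'' ⟶ Z') (g : Z' ⟶ Z) (δ : Extn E Z A) :
    pull E (f ≫ g) δ = pull E f (pull E g δ) := by simp [pull]

lemma push_pull {Z Z' A A' : C} (f : A ⟶ A') (h : Z' ⟶ Z) (δ : Extn E Z A) :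
    push E f (pull E h δ) = pull E h (push E f δ) :=
  (ConcreteCategory.congr_hom ((E.map h.op).naturality f) δ).symm

@[simp] lemma push_add {Z A A' : C} (f : A ⟶ A') (δ δ' : Extn E Z A) :
    push E f (δ + δ') = push E f δ + push E f δ' := by simp [push]

@[simp] lemma push_zero {Z A A' : C} (f : A ⟶ A') : push E f (0 : Extn E Z A) = 0 := by simp [push]

@[simp] lemma pull_add {Z Z' A : C} (h : Z' ⟶ Z) (δ δ' : Extn E Z A) :
    pull E h (δ + δ') = pull E h δ + pull E h δ' := by simp [pull]

@[simp] lemma pull_zero {Z Z' A : C} (h : Z' ⟶ Z) : pull E h (0 : Extn E Z A) = 0 := by simp [pull]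

@[simp] lemma pull_neg {Z Z' A : C} (h : Z' ⟶ Z) (δ : Extn E Z A) :
    pull E h (-δ) = -pull E h δ := by simp [pull]

lemma push_sum {Z A A' : C} {ι : Type*} (s : Finset ι) (f : A ⟶ A') (δ : ι → Extn E Z A) :
    push E f (∑ i ∈ s, δ i) = ∑ i ∈ s, push E f (δ i) := by simp [push]

lemma pull_sum {Z Z' A : C} {ι : Type*} (s : Finset ι) (h : Z' ⟶ Z) (δ : ι → Extn E Z A) :
    pull E h (∑ i ∈ s, δ i) = ∑ i ∈ s, pull E h (δ i) := by simp [pull]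

end PushPull

namespace Extriangulated

variable {C : Type u} [Category.{v} C] [Preadditive C] [HasZeroObject C]
  [HasBinaryBiproducts C] (T : Extriangulated.{w} C)

lemma push_hom_add {Z A A' : C} (f g : A ⟶ A') (δ : Extn T.E Z A) :
    push T.E (f + g) δ = push T.E f δ + push T.E g δ := by
  have := T.additive_right (op Z)
  simp [push, Functor.map_add]

@[simp] lemma push_hom_zero {Z A A' : C} (δ : Extn T.E Z A) : push T.E (0 : A ⟶ A') δ = 0 := by
  have := T.additive_right (op Z)
  simp [push]

lemma push_hom_neg {Z A A' : C} (f : A ⟶ A') (δ : Extn T.E Z A) :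
    push T.E (-f) δ = -push T.E f δ := by
  rw [eq_neg_iff_add_eq_zero, ← push_hom_add, neg_add_cancel, push_hom_zero]

lemma push_hom_sub {Z A A' : C} (f g : A ⟶ A') (δ : Extn T.E Z A) :
    push T.E (f - g) δ = push T.E f δ - push T.E g δ := by
  rw [sub_eq_add_neg, push_hom_add, push_hom_neg, sub_eq_add_neg]

lemma pull_hom_add {Z Z' A : C} (f g : Z' ⟶ Z) (δ : Extn T.E Z A) :
    pull T.E (f + g) δ = pull T.E f δ + pull T.E g δ := by
  have := T.additive_left
  simp [pull, Functor.map_add]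

@[simp] lemma pull_hom_zero {Z Z' A : C} (δ : Extn T.E Z A) : pull T.E (0 : Z' ⟶ Z) δ = 0 := by
  have := T.additive_left
  simp [pull]

lemma pull_hom_neg {Z Z' A : C} (f : Z' ⟶ Z) (δ : Extn T.E Z A) :
    pull T.E (-f) δ = -pull T.E f δ := by
  rw [eq_neg_iff_add_eq_zero, ← pull_hom_add, neg_add_cancel, pull_hom_zero]

lemma pull_hom_sub {Z Z' A : C} (f g : Z' ⟶ Z) (δ : Extn T.E Z A) :
    pull T.E (f - g) δ = pull T.E f δ - pull T.E g δ := by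
  rw [sub_eq_add_neg, pull_hom_add, pull_hom_neg, sub_eq_add_neg]

lemma push_hom_sum {Z A A' : C} {ι : Type*} (s : Finset ι) (f : ι → (A ⟶ A')) (δ : Extn T.E Z A) :
    push T.E (∑ i ∈ s, f i) δ = ∑ i ∈ s, push T.E (f i) δ := by
  classical
  induction s using Finset.induction_on with
  | empty => simp
  | insert a s ha ih => rw [Finset.sum_insert ha, Finset.sum_insert ha, push_hom_add, ih]

lemma pull_hom_sum {Z Z' A : C} {ι : Type*} (s : Finset ι) (f : ι → (Z' ⟶ Z)) (δ : Extn T.E Z A) :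
    pull T.E (∑ i ∈ s, f i) δ = ∑ i ∈ s, pull T.E (f i) δ := by
  classical
  induction s using Finset.induction_on with
  | empty => simp
  | insert a s ha ih => rw [Finset.sum_insert ha, Finset.sum_insert ha, pull_hom_add, ih]

/-- `A ⟶ A ⟶ 0` is a conflation. -/
lemma realizes_id_left {A Z : C} (hZ : IsZero Z) (b : A ⟶ Z) :
    T.Realizes (𝟙 A) b (0 : Extn T.E Z A) := by
  have := T.realizes_of_equiv _ _ _ (isoBiprodZeroRight A hZ).symm (T.realizes_zero A Z)
  convert this using 1
  · simp [isoBiprodZeroRight]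
  · exact hZ.eq_of_tgt _ _

/-- `0 ⟶ Z ⟶ Z` is a conflation. -/
lemma realizes_id_right {A Z : C} (hA : IsZero A) (a : A ⟶ Z) :
    T.Realizes a (𝟙 Z) (0 : Extn T.E Z A) := by
  have := T.realizes_of_equiv _ _ _ ((isoBiprodZeroRight Z hA).trans (biprod.braiding Z A)).symm
    (T.realizes_zero A Z)
  convert this using 1
  · exact hA.eq_of_src _ _
  · simp [isoBiprodZeroRight]

lemma realizes_zero_symm (A Z : C) :
    T.Realizes (biprod.inr : Z ⟶ A ⊞ Z) (biprod.fst : A ⊞ Z ⟶ A) (0 : Extn T.E A Z) := by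
  have := T.realizes_of_equiv _ _ _ (biprod.braiding Z A) (T.realizes_zero Z A)
  convert this using 1
  · ext <;> simp
  · simp

variable {T}

section Exact

variable {A B Z : C} {a : A ⟶ B} {b : B ⟶ Z} {δ : Extn T.E Z A} (h : T.Realizes a b δ)

include h

lemma Realizes.comp_eq_zero : a ≫ b = 0 := by
  obtain ⟨g, hg, -⟩ := T.et3 _ _ _ _ _ _ (𝟙 A) a (T.realizes_id_left (isZero_zero C) (0 : A ⟶ 0)) h
    (by simp)
  rw [← hg, zero_comp]

lemma Realizes.desc {X : C} (g : B ⟶ X) (hg : a ≫ g = 0) : ∃ l : Z ⟶ X, b ≫ l = g := by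
  obtain ⟨l, hl, -⟩ := T.et3 _ _ _ _ _ _ (0 : A ⟶ 0) g h
    (T.realizes_id_right (isZero_zero C) (0 : 0 ⟶ X)) (by simp [hg])
  exact ⟨l, by simpa using hl⟩

lemma Realizes.lift {X : C} (g : X ⟶ B) (hg : g ≫ b = 0) : ∃ l : X ⟶ A, l ≫ a = g := by
  obtain ⟨l, hl, -⟩ := T.et3_op _ _ _ _ _ _ g (0 : (0 : C) ⟶ Z)
    (T.realizes_id_left (isZero_zero C) (0 : X ⟶ 0)) h (by simp [hg])
  exact ⟨l, by simpa using hl.symm⟩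

lemma Realizes.pull_eq_zero_iff {X : C} (g : X ⟶ Z) :
    pull T.E g δ = 0 ↔ ∃ l : X ⟶ B, l ≫ b = g := by
  constructor
  · intro hg
    obtain ⟨l, -, hl⟩ := T.realizes_map _ _ _ _ _ _ (𝟙 A) g (T.realizes_zero A X) h (by simp [hg])
    exact ⟨biprod.inr ≫ l, by rw [Category.assoc, ← hl]; simp⟩
  · rintro ⟨l, rfl⟩
    obtain ⟨f, -, hf⟩ := T.et3_op _ _ _ _ _ _ (𝟙 B) b
      (T.realizes_id_right (isZero_zero C) (0 : 0 ⟶ B)) h rfl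
    rw [pull_comp, ← hf]; simp

lemma Realizes.push_eq_zero_iff {X : C} (g : A ⟶ X) :
    push T.E g δ = 0 ↔ ∃ l : B ⟶ X, a ≫ l = g := by
  constructor
  · intro hg
    obtain ⟨l, hl, -⟩ := T.realizes_map _ _ _ _ _ _ g (𝟙 Z) h (T.realizes_zero X Z) (by simp [hg])
    exact ⟨l ≫ biprod.fst, by rw [reassoc_of% hl]; simp⟩
  · rintro ⟨l, rfl⟩
    obtain ⟨f, -, hf⟩ := T.et3 _ _ _ _ _ _ a (𝟙 B) h
      (T.realizes_id_left (isZero_zero C) (0 : B ⟶ 0)) rfl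
    rw [push_comp, hf]; simp

lemma Realizes.pull_deflation : pull T.E b δ = 0 :=
  (h.pull_eq_zero_iff b).2 ⟨𝟙 B, by simp⟩

lemma Realizes.push_inflation : push T.E a δ = 0 :=
  (h.push_eq_zero_iff a).2 ⟨𝟙 B, by simp⟩

lemma Realizes.exists_pull_eq {X : C} (θ : Extn T.E X A) (hθ : push T.E a θ = 0) :
    ∃ g : X ⟶ Z, pull T.E g δ = θ := by
  obtain ⟨M, m, n, hM⟩ := T.realizes_exists θ
  obtain ⟨l, hl⟩ := (hM.push_eq_zero_iff a).1 hθ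
  obtain ⟨g, -, hg⟩ := T.et3 _ _ _ _ _ _ (𝟙 A) l hM h (by simp [hl])
  exact ⟨g, by simpa using hg.symm⟩

lemma Realizes.exists_push_eq {X : C} (θ : Extn T.E Z X) (hθ : pull T.E b θ = 0) :
    ∃ g : A ⟶ X, push T.E g δ = θ := by
  obtain ⟨M, m, n, hM⟩ := T.realizes_exists θ
  obtain ⟨l, hl⟩ := (hM.pull_eq_zero_iff b).1 hθ
  obtain ⟨g, -, hg⟩ := T.et3_op _ _ _ _ _ _ l (𝟙 Z) h hM (by simp [hl])
  exact ⟨g, by simpa using hg⟩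

lemma Realizes.exists_pull_deflation_eq {X : C} (θ : Extn T.E B X) (hθ : pull T.E a θ = 0) :
    ∃ θ' : Extn T.E Z X, pull T.E b θ' = θ := by
  obtain ⟨M, m, n, hM⟩ := T.realizes_exists θ
  obtain ⟨G, p, p', d, e, δ'', -, h2, -, -, -, -, h3⟩ := T.et4_op _ _ _ _ _ _ h hM
  obtain ⟨s, hs⟩ := (h2.push_eq_zero_iff (𝟙 X)).1 (by rw [hθ, push_zero])
  refine ⟨push T.E s δ'', ?_⟩
  rw [← push_pull, h3, ← push_comp, hs, push_id]

/-- An endomorphism of a conflation that is the identity on both ends is unipotent on the middle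
term. -/
lemma Realizes.isIso_of_endo (g : B ⟶ B) (h1 : a ≫ g = a) (h2 : g ≫ b = b) : IsIso g := by
  obtain ⟨t, ht⟩ := h.desc (𝟙 B - g) (by rw [Preadditive.comp_sub, h1, Category.comp_id, sub_self])
  have : (𝟙 B - g) ≫ (𝟙 B - g) = 0 := by
    conv_lhs => enter [2]; rw [← ht]
    rw [← Category.assoc, Preadditive.sub_comp, h2, Category.id_comp, sub_self, zero_comp]
  have h3 : IsNilpotent (show End B from 𝟙 B - g) := ⟨2, by rw [pow_two]; exact this⟩
  have := (isUnit_iff_isIso _).1 h3.isUnit_one_sub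
  have h4 : (1 : End B) - (show End B from 𝟙 B - g) = g := sub_sub_cancel (𝟙 B) g
  rwa [h4] at this

/-- An endomorphism of a conflation that is the identity on the first two terms is unipotent on the
last one. -/
lemma Realizes.isIso_of_endo_right (g : Z ⟶ Z) (h1 : b ≫ g = b) (h2 : pull T.E g δ = δ) :
    IsIso g := by
  obtain ⟨t, ht⟩ := (h.pull_eq_zero_iff (𝟙 Z - g)).1 (by rw [pull_hom_sub, h2, pull_id, sub_self])
  have : (𝟙 Z - g) ≫ (𝟙 Z - g) = 0 := by
    conv_lhs => enter [1]; rw [← ht]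
    rw [Category.assoc, Preadditive.comp_sub, h1, Category.comp_id, sub_self, comp_zero]
  have h3 : IsNilpotent (show End Z from 𝟙 Z - g) := ⟨2, by rw [pow_two]; exact this⟩
  have := (isUnit_iff_isIso _).1 h3.isUnit_one_sub
  have h4 : (1 : End Z) - (show End Z from 𝟙 Z - g) = g := sub_sub_cancel (𝟙 Z) g
  rwa [h4] at this

/-- An endomorphism of a conflation that is the identity on the last two terms is unipotent on the
first one. -/
lemma Realizes.isIso_of_endo_left (g : A ⟶ A) (h1 : g ≫ a = a) (h2 : push T.E g δ = δ) :
    IsIso g := by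
  obtain ⟨t, ht⟩ := (h.push_eq_zero_iff (𝟙 A - g)).1 (by rw [push_hom_sub, h2, push_id, sub_self])
  have : (𝟙 A - g) ≫ (𝟙 A - g) = 0 := by
    conv_lhs => enter [2]; rw [← ht]
    rw [← Category.assoc, Preadditive.sub_comp, h1, Category.id_comp, sub_self, zero_comp]
  have h3 : IsNilpotent (show End A from 𝟙 A - g) := ⟨2, by rw [pow_two]; exact this⟩
  have := (isUnit_iff_isIso _).1 h3.isUnit_one_sub
  have h4 : (1 : End A) - (show End A from 𝟙 A - g) = g := sub_sub_cancel (𝟙 A) g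
  rwa [h4] at this

end Exact

lemma isIso_of_comp_isIso {X Y : C} (f : X ⟶ Y) (g : Y ⟶ X) [IsIso (f ≫ g)] [IsIso (g ≫ f)] :
    IsIso f := by
  have : IsSplitMono f := IsSplitMono.mk' ⟨g ≫ inv (f ≫ g), by
    rw [← Category.assoc, IsIso.hom_inv_id]⟩
  have : IsSplitEpi f := IsSplitEpi.mk' ⟨inv (g ≫ f) ≫ g, by
    rw [Category.assoc, IsIso.inv_hom_id]⟩
  exact isIso_of_epi_of_isSplitMono f

section Iso

variable {A B Z A' B' Z' : C} {a : A ⟶ B} {b : B ⟶ Z} {δ : Extn T.E Z A}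
  {a' : A' ⟶ B'} {b' : B' ⟶ Z'} {δ' : Extn T.E Z' A'}

/-- A conflation can be transported along isomorphisms of all its terms. -/
lemma Realizes.of_iso (h : T.Realizes a b δ) (eA : A ≅ A') (eB : B ≅ B') (eZ : Z ≅ Z') :
    T.Realizes (eA.inv ≫ a ≫ eB.hom) (eB.inv ≫ b ≫ eZ.hom)
      (push T.E eA.hom (pull T.E eZ.inv δ)) := by
  obtain ⟨M, m, n, hM⟩ := T.realizes_exists (push T.E eA.hom (pull T.E eZ.inv δ))
  obtain ⟨f, hf1, hf2⟩ := T.realizes_map _ _ _ _ _ _ eA.hom eZ.hom h hM (by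
    rw [← push_pull, ← pull_comp, Iso.hom_inv_id, pull_id])
  obtain ⟨g, hg1, hg2⟩ := T.realizes_map _ _ _ _ _ _ eA.inv eZ.inv hM h (by
    rw [← push_comp, Iso.hom_inv_id, push_id])
  have h1 : IsIso (f ≫ g) := h.isIso_of_endo _ (by rw [reassoc_of% hf1, hg1]; simp)
    (by rw [Category.assoc, ← hg2, ← Category.assoc, ← hf2]; simp)
  have h2 : IsIso (g ≫ f) := hM.isIso_of_endo _ (by rw [reassoc_of% hg1, hf1]; simp)
    (by rw [Category.assoc, ← hf2, ← Category.assoc, ← hg2]; simp)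
  have := isIso_of_comp_isIso f g
  have := T.realizes_of_equiv _ _ _ ((asIso f).symm.trans eB) hM
  convert this using 1
  · simp [← cancel_mono eB.inv, ← cancel_mono f, hf1]
  · simp [hf2]

lemma Realizes.exists_iso_right (h : T.Realizes a b δ) (h' : T.Realizes a' b' δ') (eA : A ≅ A')
    (eB : B ≅ B') (hab : a ≫ eB.hom = eA.hom ≫ a') :
    ∃ eZ : Z ≅ Z', b ≫ eZ.hom = eB.hom ≫ b' ∧ push T.E eA.hom δ = pull T.E eZ.hom δ' := by
  obtain ⟨f, hf1, hf2⟩ := T.et3 _ _ _ _ _ _ eA.hom eB.hom h h' hab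
  obtain ⟨g, hg1, hg2⟩ := T.et3 _ _ _ _ _ _ eA.inv eB.inv h' h (by
    rw [← cancel_epi eA.hom, ← reassoc_of% hab]; simp)
  have h1 : IsIso (f ≫ g) := h.isIso_of_endo_right _ (by rw [reassoc_of% hf1, hg1]; simp)
    (by rw [pull_comp, ← hg2, ← push_pull, ← hf2, ← push_comp]; simp)
  have h2 : IsIso (g ≫ f) := h'.isIso_of_endo_right _ (by rw [reassoc_of% hg1, hf1]; simp)
    (by rw [pull_comp, ← hf2, ← push_pull, ← hg2, ← push_comp]; simp)
  have := isIso_of_comp_isIso f g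
  exact ⟨asIso f, hf1, hf2⟩

lemma Realizes.exists_iso_left (h : T.Realizes a b δ) (h' : T.Realizes a' b' δ') (eB : B ≅ B')
    (eZ : Z ≅ Z') (hab : b ≫ eZ.hom = eB.hom ≫ b') :
    ∃ eA : A ≅ A', a ≫ eB.hom = eA.hom ≫ a' ∧ push T.E eA.hom δ = pull T.E eZ.hom δ' := by
  obtain ⟨f, hf1, hf2⟩ := T.et3_op _ _ _ _ _ _ eB.hom eZ.hom h h' hab
  obtain ⟨g, hg1, hg2⟩ := T.et3_op _ _ _ _ _ _ eB.inv eZ.inv h' h (by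
    rw [← cancel_epi eB.hom, ← reassoc_of% hab]; simp)
  have h1 : IsIso (f ≫ g) := h.isIso_of_endo_left _
    (by rw [Category.assoc, ← hg1, ← Category.assoc, ← hf1]; simp)
    (by rw [push_comp, hf2, push_pull, hg2, ← pull_comp]; simp)
  have h2 : IsIso (g ≫ f) := h'.isIso_of_endo_left _
    (by rw [Category.assoc, ← hf1, ← Category.assoc, ← hg1]; simp)
    (by rw [push_comp, hg2, push_pull, hf2, ← pull_comp]; simp)
  have := isIso_of_comp_isIso f g
  exact ⟨asIso f, hf1, hf2⟩

lemma Realizes.comp_iso_right (h : T.Realizes a b δ) (eZ : Z ≅ Z') :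
    T.Realizes a (b ≫ eZ.hom) (pull T.E eZ.inv δ) := by
  simpa using h.of_iso (Iso.refl A) (Iso.refl B) eZ

lemma Realizes.comp_iso_left (h : T.Realizes a b δ) (eA : A ≅ A') :
    T.Realizes (eA.inv ≫ a) b (push T.E eA.hom δ) := by
  simpa using h.of_iso eA (Iso.refl B) (Iso.refl Z)

/-- A conflation with class zero splits. -/
lemma Realizes.exists_iso_biprod {a : A ⟶ B} {b : B ⟶ Z} (h : T.Realizes a b 0) :
    ∃ e : B ≅ A ⊞ Z, a ≫ e.hom = biprod.inl ∧ e.hom ≫ biprod.snd = b :=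
  T.realizes_unique _ _ _ _ _ h (T.realizes_zero A Z)

end Iso

section Zero

variable {A B Z : C} {a : A ⟶ B} {b : B ⟶ Z} {δ : Extn T.E Z A}

lemma Realizes.isIso_of_isZero_left (h : T.Realizes a b δ) (hA : IsZero A) : IsIso b := by
  obtain ⟨e, he, -⟩ := (T.realizes_id_right hA a).exists_iso_right h (Iso.refl A) (Iso.refl B)
    (by simp)
  simp only [Iso.refl_hom, Category.id_comp] at he
  rw [← he]; infer_instance

lemma Realizes.isIso_of_isZero_right (h : T.Realizes a b δ) (hZ : IsZero Z) : IsIso a := by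
  obtain ⟨e, he, -⟩ := h.exists_iso_left (T.realizes_id_left hZ b) (Iso.refl B) (Iso.refl Z)
    (by simp)
  simp only [Iso.refl_hom, Category.comp_id] at he
  rw [he]; infer_instance

end Zero

section BigSum

/-- A direct sum of conflations is a conflation. The middle term of the sum of the classes is
compared with the direct sum of the middle terms through the inclusions and projections; the
composites are unipotent. -/
lemma realizes_biproduct [HasFiniteBiproducts C] {n : ℕ} {X W Y : Fin n → C} {x : ∀ i, X i ⟶ W i}
    {y : ∀ i, W i ⟶ Y i} {ε : ∀ i, Extn T.E (Y i) (X i)} (h : ∀ i, T.Realizes (x i) (y i) (ε i)) :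
    T.Realizes (biproduct.map x) (biproduct.map y) (extBigSum T.E ε) := by
  classical
  obtain ⟨M, m, m', hM⟩ := T.realizes_exists (extBigSum T.E ε)
  have hι : ∀ i, push T.E (biproduct.ι X i) (ε i) = pull T.E (biproduct.ι Y i) (extBigSum T.E ε) := by
    intro i
    rw [extBigSum, pull_sum, Finset.sum_eq_single i]
    · rw [← push_pull, ← pull_comp, biproduct.ι_π_self, pull_id]
    · intro j _ hj
      rw [← push_pull, ← pull_comp, biproduct.ι_π_ne _ (Ne.symm hj), pull_hom_zero, push_zero]
    · simp
  have hπ : ∀ i, push T.E (biproduct.π X i) (extBigSum T.E ε) = pull T.E (biproduct.π Y i) (ε i) := by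
    intro i
    rw [extBigSum, push_sum, Finset.sum_eq_single i]
    · rw [← push_comp, biproduct.ι_π_self, push_id]
    · intro j _ hj
      rw [← push_comp, biproduct.ι_π_ne _ hj, push_hom_zero]
    · simp
  choose g hg1 hg2 using fun i => T.realizes_map _ _ _ _ _ _ _ _ (h i) hM (hι i)
  choose g' hg1' hg2' using fun i => T.realizes_map _ _ _ _ _ _ _ _ hM (h i) (hπ i)
  set f : (⨁ W) ⟶ M := biproduct.desc g
  set f' : M ⟶ ⨁ W := biproduct.lift g'
  have hf1 : biproduct.map x ≫ f = m := by ext i; simp [f, hg1]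
  have hf2 : f ≫ m' = biproduct.map y := by
    refine biproduct.hom_ext' _ _ fun i => ?_
    simp [f, ← hg2]
  have hf1' : m ≫ f' = biproduct.map x := by ext i : 1; simp [f', hg1']
  have hf2' : f' ≫ biproduct.map y = m' := by ext i; simp [f', ← hg2']
  have h1 : IsIso (f' ≫ f) := hM.isIso_of_endo _ (by rw [reassoc_of% hf1', hf1])
    (by rw [Category.assoc, hf2, hf2'])
  have h2 : IsIso (f ≫ f') := by
    choose t ht using fun i => (h i).desc (biproduct.ι W i ≫ (𝟙 _ - f ≫ f')) (by
      rw [← biproduct.ι_map_assoc, Preadditive.comp_sub, reassoc_of% hf1, hf1', Category.comp_id,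
        sub_self, comp_zero])
    have hdesc : biproduct.map y ≫ biproduct.desc t = 𝟙 _ - f ≫ f' := by
      refine biproduct.hom_ext' _ _ fun i => ?_
      simp [ht]
    have : (𝟙 (⨁ W) - f ≫ f') ≫ (𝟙 (⨁ W) - f ≫ f') = 0 := by
      conv_lhs => enter [2]; rw [← hdesc]
      rw [← Category.assoc, Preadditive.sub_comp, Category.assoc, hf2', hf2, Category.id_comp,
        sub_self, zero_comp]
    have h3 : IsNilpotent (show End (⨁ W) from 𝟙 (⨁ W) - f ≫ f') := ⟨2, by rw [pow_two]; exact this⟩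
    have := (isUnit_iff_isIso _).1 h3.isUnit_one_sub
    have h4 : (1 : End (⨁ W)) - (show End (⨁ W) from 𝟙 (⨁ W) - f ≫ f') = f ≫ f' :=
      sub_sub_cancel (𝟙 (⨁ W)) _
    rwa [h4] at this
  have := isIso_of_comp_isIso f f'
  have := T.realizes_of_equiv _ _ _ (asIso f).symm hM
  convert this using 1
  · simp [← hf1]
  · simp [hf2]

end BigSum

section PushoutPullback

/-- Two conflations ending in the same object have a common pullback `M`, the middle term of the
conflation over `Z` with class `δ ⊕ δ'` in `𝔼(Z, A ⊞ A')`. -/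
lemma exists_pullback {A B A' B' Z : C} {a : A ⟶ B} {b : B ⟶ Z} {δ : Extn T.E Z A} {a' : A' ⟶ B'}
    {b' : B' ⟶ Z} {δ' : Extn T.E Z A'} (h : T.Realizes a b δ) (h' : T.Realizes a' b' δ') :
    ∃ (M : C) (m : A ⟶ M) (n : M ⟶ B') (m' : A' ⟶ M) (n' : M ⟶ B),
      T.Realizes m n (pull T.E b' δ) ∧ T.Realizes m' n' (pull T.E b δ') ∧
      m ≫ n' = a ∧ m' ≫ n = a' ∧ push T.E m δ + push T.E m' δ' = 0 := by
  set μ : Extn T.E Z (A ⊞ A') := push T.E biprod.inl δ + push T.E biprod.inr δ' with hμ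
  obtain ⟨M, p, q, hM⟩ := T.realizes_exists μ
  have h1 : push T.E biprod.fst μ = δ := by
    rw [hμ, push_add, ← push_comp, ← push_comp]; simp
  have h2 : push T.E biprod.snd μ = δ' := by
    rw [hμ, push_add, ← push_comp, ← push_comp]; simp
  have key : ∀ {A A' B' S : C} {δ : Extn T.E Z A} {a' : A' ⟶ B'}
      {b' : B' ⟶ Z} {δ' : Extn T.E Z A'} (_ : T.Realizes a' b' δ')
      {j : A ⟶ S} {r : S ⟶ A} {r' : S ⟶ A'}
      (_ : T.Realizes j r' (0 : Extn T.E A' A)) (_ : j ≫ r = 𝟙 A)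
      {μ : Extn T.E Z S} {p : S ⟶ M} {q : M ⟶ Z} (_ : T.Realizes p q μ)
      (_ : push T.E r μ = δ) (_ : push T.E r' μ = δ'),
      ∃ n : M ⟶ B', T.Realizes (j ≫ p) n (pull T.E b' δ) ∧ p ≫ n = r' ≫ a' := by
    intro A A' B' S δ a' b' δ' h' j r r' hs hr μ p q hM h1 h2
    obtain ⟨G, l, l', d, e, δ'', k1, k2, k3, k4, k5, k6, k7⟩ := T.et4 _ _ _ _ _ _ hs hM
    rw [h2] at k2
    obtain ⟨φ, hφ1, hφ2⟩ := T.realizes_unique _ _ _ _ _ k2 h'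
    refine ⟨l' ≫ φ.hom, ?_, by rw [← reassoc_of% k4, hφ1]⟩
    have := k1.comp_iso_right φ
    rw [k3]
    convert this using 1
    have h3 : δ'' = pull T.E e δ := by
      rw [← h1, ← push_pull, ← k7, ← push_comp, hr, push_id]
    rw [h3, ← pull_comp]
    rw [← hφ2, Iso.inv_hom_id_assoc]
  obtain ⟨n, hn, hpn⟩ := key h' (T.realizes_zero A A') (r := biprod.fst) (by simp) hM h1 h2
  have hs := T.realizes_zero_symm A A'
  obtain ⟨n', hn', hpn'⟩ := key h hs (r := biprod.snd) (by simp) hM h2 h1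
  refine ⟨M, _, n, _, n', hn, hn', by rw [Category.assoc, hpn']; simp,
    by rw [Category.assoc, hpn]; simp, ?_⟩
  rw [push_comp, push_comp, ← push_add, ← hμ, hM.push_inflation]

/-- Two conflations starting in the same object have a common pushout `M`, the middle term of the
conflation under `A` with class `δ ⊕ δ'` in `𝔼(Z ⊞ Z', A)`. -/
lemma exists_pushout {A B Z B' Z' : C} {a : A ⟶ B} {b : B ⟶ Z} {δ : Extn T.E Z A} {a' : A ⟶ B'}
    {b' : B' ⟶ Z'} {δ' : Extn T.E Z' A} (h : T.Realizes a b δ) (h' : T.Realizes a' b' δ') :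
    ∃ (M : C) (m : B ⟶ M) (n : M ⟶ Z') (m' : B' ⟶ M) (n' : M ⟶ Z),
      T.Realizes m n (push T.E a δ') ∧ T.Realizes m' n' (push T.E a' δ) ∧
      m ≫ n' = b ∧ m' ≫ n = b' ∧ pull T.E n' δ + pull T.E n δ' = 0 := by
  set μ : Extn T.E (Z ⊞ Z') A := pull T.E biprod.fst δ + pull T.E biprod.snd δ' with hμ
  obtain ⟨M, p, q, hM⟩ := T.realizes_exists μ
  have h1 : pull T.E biprod.inl μ = δ := by
    rw [hμ, pull_add, ← pull_comp, ← pull_comp]; simp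
  have h2 : pull T.E biprod.inr μ = δ' := by
    rw [hμ, pull_add, ← pull_comp, ← pull_comp]; simp
  have key : ∀ {Z Z' B' S : C} {δ : Extn T.E Z A} {a' : A ⟶ B'}
      {b' : B' ⟶ Z'} {δ' : Extn T.E Z' A} (_ : T.Realizes a' b' δ')
      {j : Z ⟶ S} {r : S ⟶ Z} {j' : Z' ⟶ S}
      (_ : T.Realizes j' r (0 : Extn T.E Z Z')) (_ : j ≫ r = 𝟙 Z)
      {μ : Extn T.E S A} {p : A ⟶ M} {q : M ⟶ S} (_ : T.Realizes p q μ)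
      (_ : pull T.E j μ = δ) (_ : pull T.E j' μ = δ'),
      ∃ m : B' ⟶ M, T.Realizes m (q ≫ r) (push T.E a' δ) ∧ m ≫ q = b' ≫ j' := by
    intro Z Z' B' S δ a' b' δ' h' j r j' hs hr μ p q hM h1 h2
    obtain ⟨G, l, l', e, d, δ'', k1, k2, k3, k4, k5, k6, k7⟩ := T.et4_op _ _ _ _ _ _ hs hM
    rw [h2] at k2
    obtain ⟨φ, hφ1, hφ2⟩ := T.realizes_unique _ _ _ _ _ k2 h'
    refine ⟨φ.inv ≫ l, ?_, by rw [Category.assoc, ← k4, ← hφ2, Category.assoc, Iso.inv_hom_id_assoc]⟩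
    have := k1.comp_iso_left φ
    rw [k3]
    convert this using 1
    have h3 : δ'' = push T.E e δ := by
      rw [← h1, push_pull, ← k7, ← pull_comp, hr, pull_id]
    rw [h3, ← push_comp, hφ1]
  have hs := T.realizes_zero_symm Z Z'
  obtain ⟨m', hm', hmq'⟩ := key h' hs (j := biprod.inl) (by simp) hM h1 h2
  obtain ⟨m, hm, hmq⟩ := key h (T.realizes_zero Z Z') (j := biprod.inr) (by simp) hM h2 h1
  refine ⟨M, m, _, m', _, hm, hm', by rw [← Category.assoc, hmq]; simp,
    by rw [← Category.assoc, hmq']; simp, ?_⟩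
  rw [pull_comp, pull_comp, ← pull_add, ← hμ, hM.pull_deflation]

/-- Rotation of a conflation whose first term has a suspension. -/
lemma Realizes.exists_rotate_right {A B Z O S : C} {a : A ⟶ B} {b : B ⟶ Z} {δ : Extn T.E Z A}
    {a' : A ⟶ O} {b' : O ⟶ S} {δ' : Extn T.E S A} (h : T.Realizes a b δ) (h' : T.Realizes a' b' δ')
    (hO : IsZero O) : ∃ g : Z ⟶ S, T.Conflation b g := by
  obtain ⟨M, m, n, m', n', hm, hm', h1, -, -⟩ := exists_pushout h h'
  have := hm'.isIso_of_isZero_left hO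
  have h2 := T.realizes_of_equiv _ _ _ (asIso n') hm
  rw [asIso_hom, h1] at h2
  exact ⟨_, _, h2⟩

/-- Rotation of a conflation whose last term has a desuspension. -/
lemma Realizes.exists_rotate_left {A B Z O S : C} {a : A ⟶ B} {b : B ⟶ Z} {δ : Extn T.E Z A}
    {a' : S ⟶ O} {b' : O ⟶ Z} {δ' : Extn T.E Z S} (h : T.Realizes a b δ) (h' : T.Realizes a' b' δ')
    (hO : IsZero O) : ∃ g : S ⟶ A, T.Conflation g a := by
  obtain ⟨M, m, n, m', n', hm, hm', h1, -, -⟩ := exists_pullback h h'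
  have := hm.isIso_of_isZero_right hO
  have h2 := T.realizes_of_equiv _ _ _ (asIso m).symm hm'
  rw [Iso.symm_inv, asIso_hom, h1] at h2
  exact ⟨_, _, h2⟩

/-- Schanuel's lemma for conflations with a common first term. -/
lemma exists_iso_of_common_left {A B Z B' Z' : C} {a : A ⟶ B} {b : B ⟶ Z} {δ : Extn T.E Z A}
    {a' : A ⟶ B'} {b' : B' ⟶ Z'} {δ' : Extn T.E Z' A} (h : T.Realizes a b δ)
    (h' : T.Realizes a' b' δ') (h1 : ∀ θ : Extn T.E Z B', θ = 0)
    (h2 : ∀ θ : Extn T.E Z' B, θ = 0) : Nonempty (B ⊞ Z' ≅ B' ⊞ Z) := by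
  obtain ⟨M, m, n, m', n', hm, hm', -, -, -⟩ := exists_pushout h h'
  rw [h2 (push T.E a δ')] at hm
  rw [h1 (push T.E a' δ)] at hm'
  obtain ⟨e, -, -⟩ := hm.exists_iso_biprod
  obtain ⟨e', -, -⟩ := hm'.exists_iso_biprod
  exact ⟨e.symm.trans e'⟩

/-- Schanuel's lemma for conflations with a common last term. -/
lemma exists_iso_of_common_right {A B A' B' Z : C} {a : A ⟶ B} {b : B ⟶ Z} {δ : Extn T.E Z A}
    {a' : A' ⟶ B'} {b' : B' ⟶ Z} {δ' : Extn T.E Z A'} (h : T.Realizes a b δ)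
    (h' : T.Realizes a' b' δ') (h1 : ∀ θ : Extn T.E B A', θ = 0)
    (h2 : ∀ θ : Extn T.E B' A, θ = 0) : Nonempty (A ⊞ B' ≅ A' ⊞ B) := by
  obtain ⟨M, m, n, m', n', hm, hm', -, -, -⟩ := exists_pullback h h'
  rw [h2 (pull T.E b' δ)] at hm
  rw [h1 (pull T.E b δ')] at hm'
  obtain ⟨e, -, -⟩ := hm.exists_iso_biprod
  obtain ⟨e', -, -⟩ := hm'.exists_iso_biprod
  exact ⟨e.symm.trans e'⟩

end PushoutPullback

end Extriangulated

/-! ### Bijections between indecomposable summands -/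

/-- A correspondence between indecomposable summands of `B` and `Z` that is total on both sides
and both well defined and injective up to isomorphism is a bijection. -/
lemma exists_indClass_equiv {C : Type*} [Category* C] [Preadditive C] [HasZeroObject C]
    [HasBinaryBiproducts C] [HasFiniteBiproducts C] {D : Type*} [Category* D] [Preadditive D]
    [HasZeroObject D] [HasBinaryBiproducts D] [HasFiniteBiproducts D] {B : C} {Z : D}
    (R : IndSummand B → IndSummand Z → Prop) (h1 : ∀ X, ∃ Y, R X Y) (h2 : ∀ Y, ∃ X, R X Y)
    (h3 : ∀ X X' Y Y', R X Y → R X' Y' → (Nonempty (X.1 ≅ X'.1) ↔ Nonempty (Y.1 ≅ Y'.1)))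
    (h4 : ∀ X Y Y', R X Y → Nonempty (Y.1 ≅ Y'.1) → R X Y') :
    ∃ ρ : IndClass B ≃ IndClass Z, ∀ X Y, ρ (cls X) = cls Y ↔ R X Y := by
  have hcls : ∀ {X X' : IndSummand B}, cls X = cls X' ↔ Nonempty (X.1 ≅ X'.1) := Quotient.eq
  have hcls' : ∀ {Y Y' : IndSummand Z}, cls Y = cls Y' ↔ Nonempty (Y.1 ≅ Y'.1) := Quotient.eq
  choose f hf using h1
  let F : IndClass B → IndClass Z := Quotient.lift (fun X => cls (f X)) fun X X' hX =>
    hcls'.2 ((h3 _ _ _ _ (hf X) (hf X')).1 hX)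
  have hF : ∀ X, F (cls X) = cls (f X) := fun _ => rfl
  have hbij : Function.Bijective F := by
    constructor
    · rintro ⟨X⟩ ⟨X'⟩ h
      exact hcls.2 ((h3 _ _ _ _ (hf X) (hf X')).2 (hcls'.1 h))
    · rintro ⟨Y⟩
      obtain ⟨X, hX⟩ := h2 Y
      exact ⟨cls X, hcls'.2 ((h3 _ _ _ _ (hf X) hX).1 ⟨Iso.refl _⟩)⟩
  refine ⟨Equiv.ofBijective F hbij, fun X Y => ?_⟩
  rw [Equiv.ofBijective_apply, hF, hcls']
  exact ⟨fun h => h4 _ _ _ (hf X) h, fun h => (h3 _ _ _ _ (hf X) h).1 ⟨Iso.refl _⟩⟩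

namespace Extriangulated

variable {C : Type u} [Category.{v} C] [Preadditive C] [HasZeroObject C]
  [HasBinaryBiproducts C] [HasFiniteBiproducts C] (T : Extriangulated.{w} C)

/-! ### Vanishing of extensions -/

/-- `𝔼(X, Y) = 0`. -/
def ExtVanishes (X Y : C) : Prop := ∀ θ : Extn T.E X Y, θ = 0

variable {T}

lemma ExtVanishes.of_retract_left {X X' Y : C} (h : T.ExtVanishes X Y) (ρ : Retract X' X) :
    T.ExtVanishes X' Y := fun θ => by
  rw [← pull_id T.E θ, ← ρ.retract, pull_comp, h (pull T.E ρ.r θ), pull_zero]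

lemma ExtVanishes.of_retract_right {X Y Y' : C} (h : T.ExtVanishes X Y) (ρ : Retract Y' Y) :
    T.ExtVanishes X Y' := fun θ => by
  rw [← push_id T.E θ, ← ρ.retract, push_comp, h (push T.E ρ.i θ), push_zero]

lemma ExtVanishes.of_iso_right {X Y Y' : C} (h : T.ExtVanishes X Y) (e : Y ≅ Y') :
    T.ExtVanishes X Y' := h.of_retract_right ⟨e.inv, e.hom, by simp⟩

lemma ExtVanishes.inAdd_left {U W Y : C} (h : T.ExtVanishes U Y) (hW : InAdd U W) :
    T.ExtVanishes W Y := fun θ => by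
  obtain ⟨n, s, r, hsr⟩ := hW.exists_sum
  rw [← pull_id T.E θ, ← hsr, pull_hom_sum]
  refine Finset.sum_eq_zero fun i _ => ?_
  rw [pull_comp, h (pull T.E (r i) θ), pull_zero]

lemma ExtVanishes.inAdd_right {U W X : C} (h : T.ExtVanishes X U) (hW : InAdd U W) :
    T.ExtVanishes X W := fun θ => by
  obtain ⟨n, s, r, hsr⟩ := hW.exists_sum
  rw [← push_id T.E θ, ← hsr, push_hom_sum]
  refine Finset.sum_eq_zero fun i _ => ?_
  rw [push_comp, h (push T.E (s i) θ), push_zero]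

lemma ExtVanishes.biprod_left {X X' Y : C} (h : T.ExtVanishes X Y) (h' : T.ExtVanishes X' Y) :
    T.ExtVanishes (X ⊞ X') Y := fun θ => by
  rw [← pull_id T.E θ, ← biprod.total, pull_hom_add, pull_comp, pull_comp,
    h (pull T.E biprod.inl θ), h' (pull T.E biprod.inr θ), pull_zero, pull_zero, add_zero]

lemma ExtVanishes.biprod_right {X Y Y' : C} (h : T.ExtVanishes X Y) (h' : T.ExtVanishes X Y') :
    T.ExtVanishes X (Y ⊞ Y') := fun θ => by
  rw [← push_id T.E θ, ← biprod.total, push_hom_add, push_comp, push_comp,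
    h (push T.E biprod.fst θ), h' (push T.E biprod.snd θ), push_zero, push_zero, add_zero]

lemma ExtVanishes.of_isZero_left {X Y : C} (hX : IsZero X) : T.ExtVanishes X Y := fun θ => by
  rw [← pull_id T.E θ, hX.eq_of_src (𝟙 X) 0, pull_hom_zero]

lemma ExtVanishes.of_isZero_right {X Y : C} (hY : IsZero Y) : T.ExtVanishes X Y := fun θ => by
  rw [← push_id T.E θ, hY.eq_of_src (𝟙 Y) 0, push_hom_zero]

lemma Presilting.extVanishes {U V W : C} (hU : T.Presilting U) (hV : InAdd U V) (hW : InAdd U W) :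
    T.ExtVanishes V W :=
  (ExtVanishes.inAdd_left (T := T) hU hV).inAdd_right hW

/-! ### Splitting summands off conflations -/

section Strip

variable [IsIdempotentComplete C]

/-- If an inflation `f` vanishes on a summand of its target, its other component is an inflation:
the complementary summand splits off the third term. -/
lemma Realizes.exists_strip_left {X V Y V' V₀ : C} {f : X ⟶ V} {c : V ⟶ Y} {δ : Extn T.E Y X}
    (h : T.Realizes f c δ) (φ : V ≅ V' ⊞ V₀) (hf : f ≫ φ.hom ≫ biprod.snd = 0) :
    T.Inflation (f ≫ φ.hom ≫ biprod.fst) := by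
  obtain ⟨q, hq⟩ := h.desc _ hf
  obtain ⟨Y', ψ, hψ, -⟩ := exists_iso_biprod_of_retract (biprod.inr ≫ φ.inv ≫ c) q (by
    simp [hq])
  have hY : T.Realizes (biprod.inr ≫ ψ.inv) q (0 : Extn T.E V₀ Y') := by
    have := T.realizes_of_equiv _ _ _ ψ.symm (T.realizes_zero_symm V₀ Y')
    simpa [hψ] using this
  obtain ⟨G, l, l', e, d, δ'', k1, k2, k3, -, k5, k6, k7⟩ := T.et4_op _ _ _ _ _ _ hY h
  rw [hq] at k3
  have hδ : δ'' = 0 := by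
    have hs : (biprod.inr ≫ φ.inv) ≫ l' = 𝟙 V₀ := by rw [← k3]; simp
    rw [← pull_id T.E δ'', ← hs, pull_comp, k1.pull_deflation, pull_zero]
  obtain ⟨r, hr⟩ := (k1.push_eq_zero_iff (𝟙 G)).1 (by rw [hδ, push_zero])
  obtain ⟨t, ht⟩ := k1.lift (biprod.inl ≫ φ.inv) (by rw [← k3]; simp)
  -- `G` is the kernel of `V ⟶ V₀`, hence isomorphic to `V'`
  have h1 : t ≫ l ≫ φ.hom ≫ biprod.fst = 𝟙 V' := by rw [reassoc_of% ht]; simp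
  have h2 : (l ≫ φ.hom ≫ biprod.fst) ≫ t = 𝟙 G := by
    have h3 : l ≫ φ.hom ≫ biprod.snd = 0 := by rw [k3]; exact k1.comp_eq_zero
    have : ((l ≫ φ.hom ≫ biprod.fst) ≫ t) ≫ l = l := by
      have htot := biprod.total (X := V') (Y := V₀)
      have : l ≫ φ.hom ≫ (biprod.fst ≫ biprod.inl + biprod.snd ≫ biprod.inr) ≫ φ.inv = l := by
        rw [htot]; simp
      simp only [Preadditive.add_comp, Preadditive.comp_add, Category.assoc] at this
      simp only [Category.assoc, ht]
      conv_rhs => rw [← this]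
      rw [reassoc_of% h3, zero_comp, add_zero]
    have := congrArg (· ≫ r) this
    simpa only [Category.assoc, hr, Category.comp_id] using this
  have := T.realizes_of_equiv _ _ _ ⟨_, t, h2, h1⟩ k2
  simp only [reassoc_of% k5] at this
  exact ⟨_, _, _, this⟩

/-- A summand of the middle term on which the deflation vanishes can be removed. -/
lemma Realizes.exists_strip_right {A V Z V' V₀ : C} {a : A ⟶ V} {f : V ⟶ Z} {δ : Extn T.E Z A}
    (h : T.Realizes a f δ) (φ : V ≅ V' ⊞ V₀) (hf : biprod.inr ≫ φ.inv ≫ f = 0) :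
    T.Deflation (biprod.inl ≫ φ.inv ≫ f) := by
  obtain ⟨q, hq⟩ := h.lift (biprod.inr ≫ φ.inv) (by simpa using hf)
  obtain ⟨A', ψ, -, hψ⟩ := exists_iso_biprod_of_retract q (a ≫ φ.hom ≫ biprod.snd) (by
    simp [reassoc_of% hq])
  have hA : T.Realizes q (ψ.hom ≫ biprod.snd) (0 : Extn T.E A' V₀) := by
    have := T.realizes_of_equiv _ _ _ ψ.symm (T.realizes_zero V₀ A')
    simpa [hψ] using this
  obtain ⟨G, l, l', d, e, δ'', k1, k2, k3, -, k5, k6, k7⟩ := T.et4 _ _ _ _ _ _ hA h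
  rw [hq] at k3
  have hδ : δ'' = 0 := by
    have hs : l ≫ (φ.hom ≫ biprod.snd) = 𝟙 V₀ := by rw [← k3]; simp
    rw [← push_id T.E δ'', ← hs, push_comp, k1.push_inflation, push_zero]
  obtain ⟨r, hr⟩ := (k1.pull_eq_zero_iff (𝟙 G)).1 (by rw [hδ, pull_zero])
  obtain ⟨t, ht⟩ := k1.desc (φ.hom ≫ biprod.fst) (by rw [← k3]; simp)
  have h1 : (biprod.inl ≫ φ.inv ≫ l') ≫ t = 𝟙 V' := by simp [ht]
  have h2 : t ≫ biprod.inl ≫ φ.inv ≫ l' = 𝟙 G := by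
    have h3 : biprod.inr ≫ φ.inv ≫ l' = 0 := by
      rw [← Category.assoc, k3]; exact k1.comp_eq_zero
    have : l' ≫ t ≫ biprod.inl ≫ φ.inv ≫ l' = l' := by
      have htot := biprod.total (X := V') (Y := V₀)
      have : φ.hom ≫ (biprod.fst ≫ biprod.inl + biprod.snd ≫ biprod.inr) ≫ φ.inv ≫ l' = l' := by
        rw [htot]; simp
      simp only [Preadditive.add_comp, Preadditive.comp_add, Category.assoc] at this
      rw [reassoc_of% ht]
      conv_rhs => rw [← this]
      rw [h3, comp_zero, comp_zero, add_zero]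
    have := congrArg (r ≫ ·) this
    simpa only [reassoc_of% hr, hr] using this
  have := T.realizes_of_equiv _ _ _ ⟨t, _, h2, h1⟩ k2
  simp only [Category.assoc, k5] at this
  exact ⟨_, _, _, this⟩

/-- A minimal left approximation is an inflation if some left approximation is. -/
lemma inflation_of_isMinLeftApprox {U X V V' : C} {f : X ⟶ V} {b : X ⟶ V'} (hb : IsMinLeftApprox U b)
    (hf : IsLeftApprox U f) (h : T.Inflation f) : T.Inflation b := by
  obtain ⟨Y, c, δ, h⟩ := h
  obtain ⟨r, hr⟩ := hf.2 V' b hb.1.1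
  obtain ⟨s, hs⟩ := hb.1.2 V f hf.1
  have := hb.2 (s ≫ r) (by rw [reassoc_of% hs, hr])
  obtain ⟨V₀, φ, h1, h2⟩ := exists_iso_biprod_of_retract s (r ≫ inv (s ≫ r)) (by
    rw [← Category.assoc, IsIso.hom_inv_id])
  have h3 : f ≫ φ.hom = b ≫ biprod.inl := by rw [← hs, ← h2]; simp
  have := h.exists_strip_left φ (by rw [reassoc_of% h3]; simp)
  rw [reassoc_of% h3] at this
  simpa using this

/-- A minimal right approximation is a deflation if some right approximation is. -/
lemma deflation_of_isMinRightApprox {U X V V' : C} {f : V ⟶ X} {b : V' ⟶ X} (hb : IsMinRightApprox U b)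
    (hf : IsRightApprox U f) (h : T.Deflation f) : T.Deflation b := by
  obtain ⟨Y, c, δ, h⟩ := h
  obtain ⟨s, hs⟩ := hf.2 V' b hb.1.1
  obtain ⟨r, hr⟩ := hb.1.2 V f hf.1
  have := hb.2 (s ≫ r) (by rw [Category.assoc, hr, hs])
  obtain ⟨V₀, φ, h1, h2⟩ := exists_iso_biprod_of_retract (inv (s ≫ r) ≫ s) r (by
    rw [Category.assoc, IsIso.inv_hom_id])
  have h3 : φ.inv ≫ f = biprod.fst ≫ b := by
    rw [Iso.inv_comp_eq, ← hr, ← h1, Category.assoc]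
  have := h.exists_strip_right φ (by rw [h3]; simp)
  rw [h3] at this
  simpa using this

end Strip

/-! ### Exchange triangles -/

section Approx

variable {U X V Y : C} {b : X ⟶ V} {c : V ⟶ Y} {δ : Extn T.E Y X}

lemma Realizes.isLeftApprox (h : T.Realizes b c δ) (hV : InAdd U V) (hY : T.ExtVanishes Y U) :
    IsLeftApprox U b :=
  ⟨hV, fun _ g hW => (h.push_eq_zero_iff g).1 (hY.inAdd_right hW _)⟩

lemma Realizes.isRightApprox (h : T.Realizes b c δ) (hV : InAdd U V) (hX : T.ExtVanishes U X) :
    IsRightApprox U c :=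
  ⟨hV, fun _ g hW => (h.pull_eq_zero_iff g).1 (hX.inAdd_left hW _)⟩

lemma Realizes.extVanishes_of_isLeftApprox (h : T.Realizes b c δ) (hb : IsLeftApprox U b)
    (hU : T.Presilting U) : T.ExtVanishes Y U := fun θ => by
  obtain ⟨g, rfl⟩ := h.exists_push_eq θ (hU.extVanishes hb.1 (inAdd_self U) _)
  exact (h.push_eq_zero_iff g).2 (hb.2 _ g (inAdd_self U))

lemma Realizes.extVanishes_of_isRightApprox (h : T.Realizes b c δ) (hc : IsRightApprox U c)
    (hU : T.Presilting U) : T.ExtVanishes U X := fun θ => by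
  obtain ⟨g, rfl⟩ := h.exists_pull_eq θ (hU.extVanishes (inAdd_self U) hc.1 _)
  exact (h.pull_eq_zero_iff g).2 (hc.2 _ g (inAdd_self U))

variable [IsIdempotentComplete C] [FittingCategory C]

/-- The second map is right minimal because endomorphisms of `V` killed by `c` factor through `X`,
and morphisms between `V` and `X` are radical. -/
lemma Realizes.isMinRightApprox (h : T.Realizes b c δ) (hb : IsMinLeftApprox U b)
    (hX : T.ExtVanishes U X) (hUX : NoCommonSummand U X) : IsMinRightApprox U c :=
  (h.isRightApprox hb.1.1 hX).isMin fun g hg => by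
    obtain ⟨l, rfl⟩ := h.lift g hg
    exact (hUX.isRadical' hb.1.1 l).comp_right b

/-- Dual to `Realizes.isMinRightApprox`. -/
lemma Realizes.isMinLeftApprox (h : T.Realizes b c δ) (hc : IsMinRightApprox U c)
    (hY : T.ExtVanishes Y U) (hUY : NoCommonSummand U Y) : IsMinLeftApprox U b :=
  (h.isLeftApprox hc.1.1 hY).isMin fun g hg => by
    obtain ⟨l, rfl⟩ := h.desc g hg
    exact (hUY.isRadical hc.1.1 l).comp_left c

/-- A morphism `Y ⟶ W` with `W` in `add U` is radical after composition with `c`, by minimality of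
`b`, and morphisms `W ⟶ Y` lift along `c`. -/
lemma IsExchangeTriangle.noCommonSummand_right (h : T.IsExchangeTriangle U b c δ) :
    NoCommonSummand U Y := noCommonSummand_of_isRadical fun W hW f g => by
  have h1 : IsRadical (c ≫ f) := h.2.1.isRadical (by
    rw [← Category.assoc, h.1.comp_eq_zero, zero_comp])
  obtain ⟨l, rfl⟩ := h.2.2.1.2 W g hW
  have := (h1.comp_left l).isIso_sub
  refine @isIso_id_sub_comp_symm _ _ _ _ _ f (l ≫ c) ?_
  simpa using this

end Approx

/-- Conditions under which `X` can be mutated at `U` from the left: some left `add U`-approximation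
of `X` is an inflation, `𝔼(U, X) = 0`, and `X` has no nonzero summand in `add U`. -/
structure IsLeftMutable (T : Extriangulated.{w} C) (U X : C) : Prop where
  exists_inflation : ∃ (V : C) (b : X ⟶ V), T.Inflation b ∧ IsLeftApprox U b
  extVanishes : T.ExtVanishes U X
  noCommonSummand : NoCommonSummand U X

/-- Conditions under which `Y` can be mutated at `U` from the right: some right
`add U`-approximation of `Y` is a deflation, `𝔼(Y, U) = 0`, and `Y` has no nonzero summand in `add U`. -/
structure IsRightMutable (T : Extriangulated.{w} C) (U Y : C) : Prop where
  exists_deflation : ∃ (V : C) (c : V ⟶ Y), T.Deflation c ∧ IsRightApprox U c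
  extVanishes : T.ExtVanishes Y U
  noCommonSummand : NoCommonSummand U Y

section Mutable

variable [IsIdempotentComplete C] [FittingCategory C] {U : C}

lemma exists_inflation_of_isSummand {X B : C}
    (h : ∃ (V : C) (b : B ⟶ V), T.Inflation b ∧ IsLeftApprox U b) (hX : IsSummand X B) :
    ∃ (V : C) (b : X ⟶ V), T.Inflation b ∧ IsLeftApprox U b := by
  obtain ⟨R, ⟨e⟩⟩ := hX
  obtain ⟨V, b, ⟨Y, c, δ, hb⟩, hbU⟩ := h
  have hs := T.realizes_of_equiv _ _ _ e.symm (T.realizes_zero X R)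
  obtain ⟨G, l, l', d, e', δ'', k1, -, k3, -⟩ := T.et4 _ _ _ _ _ _ hs hb
  refine ⟨V, l, ⟨_, _, _, k1⟩, hbU.1, fun W g hW => ?_⟩
  obtain ⟨t, ht⟩ := hbU.2 W (e.hom ≫ biprod.fst ≫ g) hW
  exact ⟨t, by rw [← k3, Category.assoc, ht]; simp⟩

lemma IsLeftMutable.of_isSummand {X B : C} (h : T.IsLeftMutable U B) (hX : IsSummand X B) :
    T.IsLeftMutable U X :=
  ⟨exists_inflation_of_isSummand h.exists_inflation hX,
    h.extVanishes.of_retract_right hX.retract.some, h.noCommonSummand.of_isSummand hX⟩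

lemma IsRightMutable.of_isSummand {Y Z : C} (h : T.IsRightMutable U Z) (hY : IsSummand Y Z) :
    T.IsRightMutable U Y := by
  refine ⟨?_, h.extVanishes.of_retract_left hY.retract.some, h.noCommonSummand.of_isSummand hY⟩
  obtain ⟨R, ⟨e⟩⟩ := hY
  obtain ⟨V, c, ⟨X, b, δ, hc⟩, hcU⟩ := h.exists_deflation
  have hs := T.realizes_of_equiv _ _ _ e.symm (T.realizes_zero_symm Y R)
  obtain ⟨G, l, l', d, e', δ'', k1, -, k3, -⟩ := T.et4_op _ _ _ _ _ _ hs hc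
  refine ⟨V, l', ⟨_, _, _, k1⟩, hcU.1, fun W g hW => ?_⟩
  obtain ⟨t, ht⟩ := hcU.2 W (g ≫ biprod.inl ≫ e.inv) hW
  exact ⟨t, by rw [← k3, reassoc_of% ht]; simp⟩

/-- Every minimal left approximation of a left mutable object is the first map of an exchange
triangle. -/
lemma IsLeftMutable.exists_isExchangeTriangle {X V : C} (h : T.IsLeftMutable U X) {b : X ⟶ V}
    (hb : IsMinLeftApprox U b) :
    ∃ (Y : C) (c : V ⟶ Y) (δ : Extn T.E Y X), T.IsExchangeTriangle U b c δ := by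
  obtain ⟨V', f, hf, hfU⟩ := h.exists_inflation
  obtain ⟨Y, c, δ, hδ⟩ := inflation_of_isMinLeftApprox hb hfU hf
  exact ⟨Y, c, δ, hδ, hb, hδ.isMinRightApprox hb h.extVanishes h.noCommonSummand⟩

/-- Every minimal right approximation of a right mutable object is the second map of an exchange
triangle. -/
lemma IsRightMutable.exists_isExchangeTriangle {Y V : C} (h : T.IsRightMutable U Y) {c : V ⟶ Y}
    (hc : IsMinRightApprox U c) :
    ∃ (X : C) (b : X ⟶ V) (δ : Extn T.E Y X), T.IsExchangeTriangle U b c δ := by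
  obtain ⟨V', f, hf, hfU⟩ := h.exists_deflation
  obtain ⟨X, b, δ, hδ⟩ := deflation_of_isMinRightApprox hc hfU hf
  exact ⟨X, b, δ, hδ, hδ.isMinLeftApprox hc h.extVanishes h.noCommonSummand, hc⟩

lemma IsExchangeTriangle.isRightMutable {X V Y : C} {b : X ⟶ V} {c : V ⟶ Y} {δ : Extn T.E Y X}
    (h : T.IsExchangeTriangle U b c δ) (hU : T.Presilting U) : T.IsRightMutable U Y :=
  ⟨⟨V, c, ⟨X, b, δ, h.1⟩, h.2.2.1⟩, h.1.extVanishes_of_isLeftApprox h.2.1.1 hU,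
    h.noCommonSummand_right⟩

lemma Exchange.isRightMutable {X Y : C} (h : T.Exchange U X Y) (hU : T.Presilting U) :
    T.IsRightMutable U Y := by
  obtain ⟨V, b, c, δ, h⟩ := h
  exact h.isRightMutable hU

lemma IsExchangeTriangle.biprod {X V Y X' V' Y' : C} {b : X ⟶ V} {c : V ⟶ Y} {δ : Extn T.E Y X}
    {b' : X' ⟶ V'} {c' : V' ⟶ Y'} {δ' : Extn T.E Y' X'} (h : T.IsExchangeTriangle U b c δ)
    (h' : T.IsExchangeTriangle U b' c' δ') :
    T.IsExchangeTriangle U (biprod.map b b') (biprod.map c c') (extSum T.E δ δ') :=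
  ⟨T.realizes_sum _ _ _ _ _ _ h.1 h'.1, h.2.1.biprod h'.2.1, h.2.2.biprod h'.2.2⟩

lemma Exchange.biprod {X Y X' Y' : C} (h : T.Exchange U X Y) (h' : T.Exchange U X' Y') :
    T.Exchange U (X ⊞ X') (Y ⊞ Y') := by
  obtain ⟨V, b, c, δ, h⟩ := h
  obtain ⟨V', b', c', δ', h'⟩ := h'
  exact ⟨_, _, _, _, h.biprod h'⟩

lemma IsExchangeTriangle.of_iso {X V Y X' V' Y' : C} {b : X ⟶ V} {c : V ⟶ Y} {δ : Extn T.E Y X}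
    (h : T.IsExchangeTriangle U b c δ) (eX : X ≅ X') (eV : V ≅ V') (eY : Y ≅ Y') :
    T.IsExchangeTriangle U (eX.inv ≫ b ≫ eV.hom) (eV.inv ≫ c ≫ eY.hom)
      (push T.E eX.hom (pull T.E eY.inv δ)) :=
  ⟨h.1.of_iso eX eV eY, h.2.1.comp_iso eX.symm eV, h.2.2.comp_iso eY eV.symm⟩

lemma Exchange.of_iso {X Y X' Y' : C} (h : T.Exchange U X Y) (eX : X ≅ X') (eY : Y ≅ Y') :
    T.Exchange U X' Y' := by
  obtain ⟨V, b, c, δ, h⟩ := h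
  exact ⟨_, _, _, _, h.of_iso eX (Iso.refl V) eY⟩

/-- Minimal left approximations are unique, so the left end of an exchange triangle determines the
right end. -/
lemma Exchange.exists_iso_right {X Y X' Y' : C} (h : T.Exchange U X Y) (h' : T.Exchange U X' Y')
    (e : X ≅ X') : Nonempty (Y ≅ Y') := by
  obtain ⟨V, b, c, δ, h⟩ := h.of_iso e (Iso.refl Y)
  obtain ⟨V', b', c', δ', h'⟩ := h'
  obtain ⟨φ, hφ⟩ := h.2.1.exists_iso h'.2.1
  obtain ⟨ψ, -⟩ := h.1.exists_iso_right h'.1 (Iso.refl X') φ (by simpa using hφ)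
  exact ⟨ψ⟩

/-- The right end of an exchange triangle determines the left end. -/
lemma Exchange.exists_iso_left {X Y X' Y' : C} (h : T.Exchange U X Y) (h' : T.Exchange U X' Y')
    (e : Y ≅ Y') : Nonempty (X ≅ X') := by
  obtain ⟨V, b, c, δ, h⟩ := h.of_iso (Iso.refl X) e
  obtain ⟨V', b', c', δ', h'⟩ := h'
  obtain ⟨φ, hφ⟩ := h.2.2.exists_iso h'.2.2
  obtain ⟨ψ, -⟩ := h.1.exists_iso_left h'.1 φ (Iso.refl Y') (by simpa using hφ.symm)
  exact ⟨ψ⟩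

lemma Exchange.isZero_right {X Y : C} (h : T.Exchange U X Y) (hX : IsZero X) : IsZero Y := by
  obtain ⟨V, b, c, δ, h⟩ := h
  obtain ⟨e, -⟩ := h.1.exists_iso_right (T.realizes_id_right hX b) (Iso.refl X) (Iso.refl V)
    (by simp)
  exact h.noCommonSummand_right Y (isSummand_self Y) (h.2.1.1.1.of_iso e.symm)

lemma Exchange.isZero_left {X Y : C} (h : T.Exchange U X Y) (hX : NoCommonSummand U X)
    (hY : IsZero Y) : IsZero X := by
  obtain ⟨V, b, c, δ, h⟩ := h
  obtain ⟨e, -⟩ := h.1.exists_iso_left (T.realizes_id_left hY c) (Iso.refl V) (Iso.refl Y)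
    (by simp)
  exact hX X (isSummand_self X) (h.2.1.1.1.of_iso e.symm)

end Mutable

section Bijection

variable (k : Type*) [Field k] [Linear k C] (homFinite : ∀ X Y : C, Module.Finite k (X ⟶ Y))
  [IsIdempotentComplete C] {U : C}

include homFinite

lemma IsLeftMutable.exists_exchange {X : C} (h : T.IsLeftMutable U X) : ∃ Y, T.Exchange U X Y := by
  have := fittingCategory_of_finite k homFinite
  obtain ⟨V, b, hb⟩ := exists_isMinLeftApprox k homFinite U X
  obtain ⟨Y, c, δ, h⟩ := h.exists_isExchangeTriangle hb
  exact ⟨Y, V, b, c, δ, h⟩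

lemma IsRightMutable.exists_exchange {Y : C} (h : T.IsRightMutable U Y) :
    ∃ X, T.Exchange U X Y := by
  have := fittingCategory_of_finite k homFinite
  obtain ⟨V, c, hc⟩ := exists_isMinRightApprox k homFinite U Y
  obtain ⟨X, b, δ, h⟩ := h.exists_isExchangeTriangle hc
  exact ⟨X, V, b, c, δ, h⟩

variable (hU : T.Presilting U)

include hU

/-- A decomposition of `Y` can be exchanged back to one of `X`. -/
lemma Exchange.indecomposable_right {X Y : C} (h : T.Exchange U X Y) (hX : T.IsLeftMutable U X)
    (hi : Indecomposable X) : Indecomposable Y := by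
  have := fittingCategory_of_finite k homFinite
  refine ⟨fun h0 => hi.1 (h.isZero_left hX.noCommonSummand h0), fun A A' e => ?_⟩
  have hY := h.isRightMutable hU
  obtain ⟨XA, hA⟩ := (hY.of_isSummand ⟨A', ⟨e⟩⟩).exists_exchange k homFinite
  obtain ⟨XA', hA'⟩ := (hY.of_isSummand
    (⟨A, ⟨e.trans (biprod.braiding A A')⟩⟩ : IsSummand A' Y)).exists_exchange k homFinite
  obtain ⟨φ⟩ := h.exists_iso_left (hA.biprod hA') e
  exact (hi.2 _ _ φ).imp hA.isZero_right hA'.isZero_right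

/-- A decomposition of `X` can be exchanged to one of `Y`. -/
lemma Exchange.indecomposable_left {X Y : C} (h : T.Exchange U X Y) (hX : T.IsLeftMutable U X)
    (hi : Indecomposable Y) : Indecomposable X := by
  have := fittingCategory_of_finite k homFinite
  refine ⟨fun h0 => hi.1 (h.isZero_right h0), fun A A' e => ?_⟩
  have hXA := hX.of_isSummand (⟨A', ⟨e⟩⟩ : IsSummand A X)
  have hXA' := hX.of_isSummand (⟨A, ⟨e.trans (biprod.braiding A A')⟩⟩ : IsSummand A' X)
  obtain ⟨YA, hA⟩ := hXA.exists_exchange k homFinite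
  obtain ⟨YA', hA'⟩ := hXA'.exists_exchange k homFinite
  obtain ⟨φ⟩ := h.exists_iso_right (hA.biprod hA') e
  exact (hi.2 _ _ φ).imp (hA.isZero_left hXA.noCommonSummand)
    (hA'.isZero_left hXA'.noCommonSummand)

lemma Exchange.isSummand_right {B Z X Y : C} (h : T.Exchange U B Z) (hB : T.IsLeftMutable U B)
    (hX : IsSummand X B) (hXY : T.Exchange U X Y) : IsSummand Y Z := by
  have := fittingCategory_of_finite k homFinite
  obtain ⟨R, ⟨e⟩⟩ := hX
  obtain ⟨S, hS⟩ := (hB.of_isSummand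
    (⟨X, ⟨e.trans (biprod.braiding X R)⟩⟩ : IsSummand R B)).exists_exchange k homFinite
  obtain ⟨φ⟩ := h.exists_iso_right (hXY.biprod hS) e
  exact ⟨S, ⟨φ⟩⟩

lemma Exchange.isSummand_left {B Z X Y : C} (h : T.Exchange U B Z)
    (hY : IsSummand Y Z) (hXY : T.Exchange U X Y) : IsSummand X B := by
  have := fittingCategory_of_finite k homFinite
  obtain ⟨R, ⟨e⟩⟩ := hY
  obtain ⟨S, hS⟩ := ((h.isRightMutable hU).of_isSummand
    (⟨Y, ⟨e.trans (biprod.braiding Y R)⟩⟩ : IsSummand R Z)).exists_exchange k homFinite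
  obtain ⟨φ⟩ := h.exists_iso_left (hXY.biprod hS) e
  exact ⟨S, ⟨φ⟩⟩

/-- Minimal left approximations of indecomposable summands of `B` lie in exchange triangles. -/
lemma Exchange.exists_triangle_left {B Z : C} (h : T.Exchange U B Z) (hB : T.IsLeftMutable U B)
    (X : IndSummand B) (V : C) (b : X.1 ⟶ V) (hb : IsMinLeftApprox U b) :
    ∃ (Y : IndSummand Z) (c : V ⟶ Y.1) (δ : Extn T.E Y.1 X.1), T.IsExchangeTriangle U b c δ := by
  have := fittingCategory_of_finite k homFinite
  have hX := hB.of_isSummand X.2.2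
  obtain ⟨Y, c, δ, hY⟩ := hX.exists_isExchangeTriangle hb
  have hXY : T.Exchange U X.1 Y := ⟨V, b, c, δ, hY⟩
  exact ⟨⟨Y, hXY.indecomposable_right k homFinite hU hX X.2.1,
    h.isSummand_right k homFinite hU hB X.2.2 hXY⟩, c, δ, hY⟩

/-- Minimal right approximations of indecomposable summands of `Z` lie in exchange triangles. -/
lemma Exchange.exists_triangle_right {B Z : C} (h : T.Exchange U B Z) (hB : T.IsLeftMutable U B)
    (Y : IndSummand Z) (V : C) (c : V ⟶ Y.1) (hc : IsMinRightApprox U c) :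
    ∃ (X : IndSummand B) (b : X.1 ⟶ V) (δ : Extn T.E Y.1 X.1), T.IsExchangeTriangle U b c δ := by
  have := fittingCategory_of_finite k homFinite
  obtain ⟨X, b, δ, hX⟩ := ((h.isRightMutable hU).of_isSummand Y.2.2).exists_isExchangeTriangle hc
  have hXY : T.Exchange U X Y.1 := ⟨V, b, c, δ, hX⟩
  have hXB := h.isSummand_left k homFinite hU Y.2.2 hXY
  exact ⟨⟨X, hXY.indecomposable_left k homFinite hU (hB.of_isSummand hXB) Y.2.1, hXB⟩, b, δ, hX⟩

/-- Exchange triangles define a bijection between indecomposable summands. -/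
lemma Exchange.exists_equiv {B Z : C} (h : T.Exchange U B Z) (hB : T.IsLeftMutable U B) :
    ∃ ρ : IndClass B ≃ IndClass Z, ∀ (X : IndSummand B) (Y : IndSummand Z),
      ρ (cls X) = cls Y ↔ T.Exchange U X.1 Y.1 := by
  have := fittingCategory_of_finite k homFinite
  refine exists_indClass_equiv (fun X Y => T.Exchange U X.1 Y.1) (fun X => ?_) (fun Y => ?_)
    (fun X X' Y Y' h h' => ⟨fun ⟨e⟩ => h.exists_iso_right h' e,
      fun ⟨e⟩ => h.exists_iso_left h' e⟩) (fun X Y Y' h ⟨e⟩ => h.of_iso (Iso.refl _) e)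
  · obtain ⟨V, b, hb⟩ := exists_isMinLeftApprox k homFinite U X.1
    obtain ⟨Y, c, δ, hY⟩ := h.exists_triangle_left k homFinite hU hB X V b hb
    exact ⟨Y, V, b, c, δ, hY⟩
  · obtain ⟨V, c, hc⟩ := exists_isMinRightApprox k homFinite U Y.1
    obtain ⟨X, b, δ, hX⟩ := h.exists_triangle_right k homFinite hU hB Y V c hc
    exact ⟨X, V, b, c, δ, hX⟩

/-- An exchange triangle decomposes along any decomposition of its first term. -/
lemma IsExchangeTriangle.exists_decomposition {B V Z : C} {b : B ⟶ V} {c : V ⟶ Z}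
    {δ : Extn T.E Z B} (h : T.IsExchangeTriangle U b c δ) (hB : T.IsLeftMutable U B)
    (n : ℕ) (X : Fin n → C) (e : B ≅ ⨁ X) (hX : ∀ i, Indecomposable (X i)) :
    ∃ (W Y : Fin n → C) (x : ∀ i, X i ⟶ W i) (y : ∀ i, W i ⟶ Y i)
      (ε : ∀ i, Extn T.E (Y i) (X i)) (eV : V ≅ ⨁ W) (eZ : Z ≅ ⨁ Y),
      (∀ i, Indecomposable (Y i)) ∧ (∀ i, T.IsExchangeTriangle U (x i) (y i) (ε i)) ∧
      b ≫ eV.hom = e.hom ≫ biproduct.map x ∧ c ≫ eZ.hom = eV.hom ≫ biproduct.map y ∧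
      push T.E e.hom δ = pull T.E eZ.hom (extBigSum T.E ε) := by
  have := fittingCategory_of_finite k homFinite
  have hXB : ∀ i, T.IsLeftMutable U (X i) := fun i =>
    hB.of_isSummand ((isSummand_biproduct X i).of_iso e.symm)
  choose W x hx using fun i => exists_isMinLeftApprox k homFinite U (X i)
  choose Y y ε hε using fun i => (hXB i).exists_isExchangeTriangle (hx i)
  have hsum := realizes_biproduct fun i => (hε i).1
  have hb := h.2.1.comp_iso e.symm (Iso.refl V)
  obtain ⟨eV, heV⟩ := hb.exists_iso (IsMinLeftApprox.biproduct hx)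
  have h1 : b ≫ eV.hom = e.hom ≫ biproduct.map x := by rw [← heV]; simp
  obtain ⟨eZ, h2, h3⟩ := h.1.exists_iso_right hsum e eV h1
  exact ⟨W, Y, x, y, ε, eV, eZ, fun i =>
    Exchange.indecomposable_right k homFinite hU ⟨_, _, _, _, hε i⟩ (hXB i) (hX i), hε, h1, h2, h3⟩

end Bijection

end Extriangulated

namespace Extriangulated

variable {C : Type u} [Category.{v} C] [Preadditive C] [HasZeroObject C]
  [HasBinaryBiproducts C] [HasFiniteBiproducts C] {T : Extriangulated.{w} C}

/-! ### Reduced 0-Auslander categories -/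

lemma Projective.extVanishes {Q : C} (hQ : T.Projective Q) (X : C) : T.ExtVanishes Q X := fun θ => by
  obtain ⟨M, a, b, h⟩ := T.realizes_exists θ
  rw [← pull_id T.E θ, h.pull_eq_zero_iff]
  exact hQ b ⟨_, _, _, h⟩ (𝟙 Q)

lemma Injective.extVanishes {J : C} (hJ : T.Injective J) (X : C) : T.ExtVanishes X J := fun θ => by
  obtain ⟨M, a, b, h⟩ := T.realizes_exists θ
  rw [← push_id T.E θ, h.push_eq_zero_iff]
  exact hJ a ⟨_, _, _, h⟩ (𝟙 J)

lemma projective_of_extVanishes {Q : C} (h : ∀ X, T.ExtVanishes Q X) : T.Projective Q := by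
  rintro B Z b ⟨A, a, δ, hδ⟩ g
  exact (hδ.pull_eq_zero_iff g).1 (h A _)

lemma injective_of_extVanishes {J : C} (h : ∀ X, T.ExtVanishes X J) : T.Injective J := by
  rintro A B a ⟨Z, b, δ, hδ⟩ g
  exact (hδ.push_eq_zero_iff g).1 (h Z _)

lemma injective_of_isZero {J : C} (h : IsZero J) : T.Injective J :=
  injective_of_extVanishes fun _ => ExtVanishes.of_isZero_right h

lemma Injective.of_retract {J J' : C} (h : T.Injective J) (ρ : Retract J' J) : T.Injective J' :=
  injective_of_extVanishes fun X => (h.extVanishes X).of_retract_right ρ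

lemma Injective.biprod {J J' : C} (h : T.Injective J) (h' : T.Injective J') :
    T.Injective (J ⊞ J') :=
  injective_of_extVanishes fun X => (h.extVanishes X).biprod_right (h'.extVanishes X)

lemma Realizes.extVanishes_middle_left {A B Z X : C} {a : A ⟶ B} {b : B ⟶ Z} {δ : Extn T.E Z A}
    (h : T.Realizes a b δ) (hA : T.ExtVanishes A X) (hZ : T.ExtVanishes Z X) :
    T.ExtVanishes B X := fun θ => by
  obtain ⟨θ', rfl⟩ := h.exists_pull_deflation_eq θ (hA _)
  rw [hZ θ', pull_zero]

section ZeroAuslander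

variable (hA : T.IsReducedZeroAuslander)

include hA

/-- Extension groups are right exact in the second variable, because projective dimensions are at
most one. -/
lemma Realizes.exists_push_deflation_eq {A B Z X : C} {a : A ⟶ B} {b : B ⟶ Z} {δ : Extn T.E Z A}
    (h : T.Realizes a b δ) (θ : Extn T.E X Z) : ∃ θ' : Extn T.E X B, push T.E b θ' = θ := by
  obtain ⟨P₁, P₀, i, p, h1, h0, ε, hε⟩ := hA.resolution X
  obtain ⟨g, rfl⟩ := hε.exists_push_eq θ (h0.extVanishes _ _)
  obtain ⟨l, rfl⟩ := h1 b ⟨_, _, _, h⟩ g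
  exact ⟨push T.E l ε, by rw [push_comp]⟩

/-- Extension groups are right exact in the first variable: realize `θ` by a conflation `X ⟶ Y ⟶ A`,
lift `δ` along the deflation `Y ⟶ A`, and compose the two inflations. -/
lemma Realizes.exists_pull_inflation_eq {A B Z X : C} {a : A ⟶ B} {b : B ⟶ Z} {δ : Extn T.E Z A}
    (h : T.Realizes a b δ) (θ : Extn T.E A X) : ∃ θ' : Extn T.E B X, pull T.E a θ' = θ := by
  obtain ⟨Y, f, f', hY⟩ := T.realizes_exists θ
  obtain ⟨δ', hδ'⟩ := hY.exists_push_deflation_eq hA δ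
  obtain ⟨D, g, g', hD⟩ := T.realizes_exists δ'
  obtain ⟨G, l, l', d, e, δ'', k1, k2, k3, k4, k5, k6, k7⟩ := T.et4 _ _ _ _ _ _ hY hD
  rw [hδ'] at k2
  obtain ⟨φ, hφ1, hφ2⟩ := T.realizes_unique _ _ _ _ _ h k2
  exact ⟨pull T.E φ.hom δ'', by rw [← pull_comp, hφ1, k6]⟩

lemma Realizes.extVanishes_right {A B Z X : C} {a : A ⟶ B} {b : B ⟶ Z} {δ : Extn T.E Z A}
    (h : T.Realizes a b δ) (hB : T.ExtVanishes X B) : T.ExtVanishes X Z := fun θ => by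
  obtain ⟨θ', rfl⟩ := h.exists_push_deflation_eq hA θ
  rw [hB θ', push_zero]

lemma Realizes.extVanishes_left {A B Z X : C} {a : A ⟶ B} {b : B ⟶ Z} {δ : Extn T.E Z A}
    (h : T.Realizes a b δ) (hB : T.ExtVanishes B X) : T.ExtVanishes A X := fun θ => by
  obtain ⟨θ', rfl⟩ := h.exists_pull_inflation_eq hA θ
  rw [hB θ', pull_zero]

lemma IsSuspension.projective {X Y : C} (h : T.IsSuspension X Y) : T.Projective X := by
  obtain ⟨O, a, b, hO, δ, h⟩ := h
  exact projective_of_extVanishes fun _ => h.extVanishes_left hA (ExtVanishes.of_isZero_left hO)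

lemma IsSuspension.injective {X Y : C} (h : T.IsSuspension X Y) : T.Injective Y := by
  obtain ⟨O, a, b, hO, δ, h⟩ := h
  exact injective_of_extVanishes fun _ => h.extVanishes_right hA (ExtVanishes.of_isZero_right hO)

lemma exists_suspension {Q : C} (hQ : T.Projective Q) : ∃ J, T.IsSuspension Q J := by
  obtain ⟨O, J, i, p, h1, h2, -, h⟩ := hA.coresolution Q hQ
  exact ⟨J, O, i, p, hA.reduced O h1 h2, h⟩

omit hA in
lemma IsSuspension.exists_iso_right {X Y X' Y' : C} (h : T.IsSuspension X Y)
    (h' : T.IsSuspension X' Y') (e : X ≅ X') : Nonempty (Y ≅ Y') := by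
  obtain ⟨O, a, b, hO, δ, h⟩ := h
  obtain ⟨O', a', b', hO', δ', h'⟩ := h'
  obtain ⟨φ, -⟩ := h.exists_iso_right h' e (hO.iso hO') (hO'.eq_of_tgt _ _)
  exact ⟨φ⟩

omit hA in
lemma IsSuspension.exists_iso_left {X Y X' Y' : C} (h : T.IsSuspension X Y)
    (h' : T.IsSuspension X' Y') (e : Y ≅ Y') : Nonempty (X ≅ X') := by
  obtain ⟨O, a, b, hO, δ, h⟩ := h
  obtain ⟨O', a', b', hO', δ', h'⟩ := h'
  obtain ⟨φ, -⟩ := h.exists_iso_left h' (hO.iso hO') e (hO.eq_of_src _ _)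
  exact ⟨φ⟩

omit hA in
lemma isZero_biprod {X Y : C} (hX : IsZero X) (hY : IsZero Y) : IsZero (X ⊞ Y) :=
  hX.of_iso (isoBiprodZeroRight X hY).symm

omit hA in
lemma IsSuspension.biprod {X Y X' Y' : C} (h : T.IsSuspension X Y) (h' : T.IsSuspension X' Y') :
    T.IsSuspension (X ⊞ X') (Y ⊞ Y') := by
  obtain ⟨O, a, b, hO, δ, h⟩ := h
  obtain ⟨O', a', b', hO', δ', h'⟩ := h'
  exact ⟨O ⊞ O', _, _, isZero_biprod hO hO', _, T.realizes_sum _ _ _ _ _ _ h h'⟩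

omit hA in
lemma IsSuspension.isZero_right {X Y : C} (h : T.IsSuspension X Y) (hX : IsZero X) :
    IsZero Y := by
  obtain ⟨O, a, b, hO, δ, h⟩ := h
  have := h.isIso_of_isZero_left hX
  exact hO.of_iso (asIso b).symm

omit hA in
lemma IsSuspension.isZero_left {X Y : C} (h : T.IsSuspension X Y) (hY : IsZero Y) :
    IsZero X := by
  obtain ⟨O, a, b, hO, δ, h⟩ := h
  have := h.isIso_of_isZero_right hY
  exact hO.of_iso (asIso a)

/-- Rotating a resolution `P₁ ⟶ P₀ ⟶ J` twice gives a conflation `J ⟶ ΣP₁ ⟶ ΣP₀`, which splits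
because `J` is injective. The split deflation `ΣP₁ ⟶ J`, composed with `0 ⟶ ΣP₁`, gives `ΩJ`. -/
lemma exists_desuspension {J : C} (hJ : T.Injective J) : ∃ W, T.IsSuspension W J := by
  obtain ⟨P₁, P₀, i, p, h1, h0, δ, hδ⟩ := hA.resolution J
  obtain ⟨S₁, O₁, a₁, b₁, hO₁, δ₁, hS₁⟩ := exists_suspension hA h1
  obtain ⟨S₀, O₀, a₀, b₀, hO₀, δ₀, hS₀⟩ := exists_suspension hA h0
  obtain ⟨g, ε, hε⟩ := hδ.exists_rotate_right hS₁ hO₁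
  obtain ⟨g', ε', hε'⟩ := hε.exists_rotate_right hS₀ hO₀
  rw [hJ.extVanishes _ ε'] at hε'
  obtain ⟨e, -, -⟩ := hε'.exists_iso_biprod
  have hs := T.realizes_of_equiv _ _ _ e.symm (T.realizes_zero_symm J S₀)
  obtain ⟨G, l, l', d, e', δ'', k1, -⟩ := T.et4_op _ _ _ _ _ _ hs hS₁
  exact ⟨G, O₁, l, l', hO₁, _, k1⟩

omit hA in
/-- Every morphism `f : X ⟶ Y` out of an object with a suspension is an inflation. The pullback `N`
of `X ⟶ 0 ⟶ S` and of the conflation `Y ⟶ M ⟶ S` with class `f_* δ` is isomorphic to `Y`, because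
the deflation `N ⟶ 0` has the kernel `Y`, and the inflation `X ⟶ N ≅ Y` is `f` up to sign. -/
lemma IsSuspension.inflation {X Y S : C} (h : T.IsSuspension X S) (f : X ⟶ Y) : T.Inflation f := by
  obtain ⟨O, a, b, hO, δ, h⟩ := h
  obtain ⟨M, y, y', hM⟩ := T.realizes_exists (push T.E f δ)
  obtain ⟨N, m, n, m', n', hm, hm', -, -, hrel⟩ := exists_pullback h hM
  have := hm'.isIso_of_isZero_right hO
  rw [← push_comp, ← push_hom_add, h.push_eq_zero_iff] at hrel
  obtain ⟨l, hl⟩ := hrel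
  rw [hO.eq_of_src l 0, comp_zero] at hl
  have hφ : m ≫ (-(inv m')) = f := by
    have : m = -(f ≫ m') := by rw [eq_neg_iff_add_eq_zero]; exact hl.symm
    rw [this]; simp
  have := T.realizes_of_equiv _ _ _ (⟨-(inv m'), -m', by simp, by simp⟩ : N ≅ Y) hm
  rw [hφ] at this
  exact ⟨_, _, _, this⟩

omit hA in
/-- Every morphism to a suspension is a deflation. -/
lemma IsSuspension.deflation {X Y S : C} (h : T.IsSuspension X S) (f : Y ⟶ S) : T.Deflation f := by
  obtain ⟨O, a, b, hO, δ, h⟩ := h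
  obtain ⟨M, y, y', hM⟩ := T.realizes_exists (pull T.E f δ)
  obtain ⟨N, m, n, m', n', hm, hm', -, -, hrel⟩ := exists_pushout h hM
  have := hm.isIso_of_isZero_left hO
  rw [← pull_comp, ← pull_hom_add, h.pull_eq_zero_iff] at hrel
  obtain ⟨l, hl⟩ := hrel
  rw [hO.eq_of_tgt l 0, zero_comp] at hl
  have hφ : (-(inv n)) ≫ n' = f := by
    have : n' = -(n ≫ f) := by rw [eq_neg_iff_add_eq_zero]; exact hl.symm
    rw [this]; simp
  have := T.realizes_of_equiv _ _ _ (⟨-n, -(inv n), by simp, by simp⟩ : N ≅ Y) hm'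
  rw [hφ] at this
  exact ⟨_, _, _, this⟩

/-! ### Bongartz and co-Bongartz complements -/

section Complements

variable {P U : C} (hP : T.Projective P) (hU : T.Presilting U)

include hU hP

omit hP in
lemma exists_isBongartzComplement (k : Type*) [Field k] [Linear k C]
    (homFinite : ∀ X Y : C, Module.Finite k (X ⟶ Y)) [IsIdempotentComplete C]
    (hP : T.Projective P) : ∃ B, T.IsBongartzComplement P U B := by
  obtain ⟨S, hS⟩ := exists_suspension hA hP
  obtain ⟨V, f, hf⟩ := exists_isMinRightApprox k homFinite U S
  obtain ⟨K, b, h⟩ := hS.deflation f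
  obtain ⟨B, U₀, e, hU₀, hB⟩ := exists_maximal_splitting k homFinite (InAdd U)
    (fun _ => inAdd_of_isZero) (fun _ _ => InAdd.biprod) K
  exact ⟨B, S, K, V, U₀, b, f, hS, hf, h, hU₀, e, hB⟩

omit hP in
lemma exists_isCoBongartzComplement (k : Type*) [Field k] [Linear k C]
    (homFinite : ∀ X Y : C, Module.Finite k (X ⟶ Y)) [IsIdempotentComplete C]
    (hP : T.Projective P) : ∃ Z, T.IsCoBongartzComplement P U Z := by
  obtain ⟨S, hS⟩ := exists_suspension hA hP
  obtain ⟨V, f, hf⟩ := exists_isMinLeftApprox k homFinite U P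
  obtain ⟨L, c, h⟩ := hS.inflation f
  obtain ⟨Z, U₀, e, hU₀, hZ⟩ := exists_maximal_splitting k homFinite (InAdd U)
    (fun _ => inAdd_of_isZero) (fun _ _ => InAdd.biprod) L
  exact ⟨Z, L, V, U₀, f, c, hf, h, hU₀, e, hZ⟩

/-- The conflation `P ⟶ K ⟶ U'` that presents the Bongartz complement as a summand of `K`. -/
lemma IsBongartzComplement.exists_conflation {B : C} (hB : T.IsBongartzComplement P U B) :
    ∃ (K U' U₀ : C) (g : P ⟶ K) (b : K ⟶ U'), T.Conflation g b ∧ InAdd U U' ∧ InAdd U U₀ ∧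
      Nonempty (K ≅ B ⊞ U₀) ∧ T.ExtVanishes U K := by
  obtain ⟨S, K, U', U₀, b, f, ⟨O, x, y, hO, δ', hS⟩, hf, ⟨δ, h⟩, hU₀, e, hB⟩ := hB
  obtain ⟨g, hg⟩ := h.exists_rotate_left hS hO
  exact ⟨K, U', U₀, g, b, hg, hf.1.1, hU₀, e, h.extVanishes_of_isRightApprox hf.1 hU⟩

omit hA hU in
/-- The exchange conflation `K ⟶ U'' ⊞ U' ⟶ L` between the unreduced complements. -/
lemma exists_conflation_of_pushout {K U' U'' L : C} {g : P ⟶ K} {b : K ⟶ U'} {f : P ⟶ U''}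
    {c : U'' ⟶ L} (hU : T.Presilting U) (h : T.Conflation g b) (h' : T.Conflation f c)
    (hU' : InAdd U U')
    (hf : IsLeftApprox U f) [IsIdempotentComplete C] :
    ∃ (M : C) (m : K ⟶ M) (n : M ⟶ L), T.Conflation m n ∧ IsLeftApprox U m := by
  obtain ⟨δ, h⟩ := h
  obtain ⟨δ', h'⟩ := h'
  obtain ⟨M, m, n, m', n', hm, hm', -, -, -⟩ := exists_pushout h h'
  rw [hU.extVanishes hU' hf.1 (push T.E f δ)] at hm'
  obtain ⟨e, -, -⟩ := hm'.exists_iso_biprod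
  exact ⟨M, m, n, ⟨_, hm⟩, hm.isLeftApprox ((hf.1.biprod hU').of_iso e.symm)
    (h'.extVanishes_of_isLeftApprox hf hU)⟩

variable [IsIdempotentComplete C] [FittingCategory C]

lemma IsBongartzComplement.isLeftMutable {B Z : C} (hB : T.IsBongartzComplement P U B)
    (hZ : T.IsCoBongartzComplement P U Z) : T.IsLeftMutable U B := by
  obtain ⟨K, U', U₀, g, b, hK, hU', hU₀, ⟨e⟩, hUK⟩ := hB.exists_conflation hA hP hU
  obtain ⟨L, U'', U₁, f, c, hf, hL, -⟩ := hZ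
  obtain ⟨M, m, n, hmn, hm⟩ := exists_conflation_of_pushout hP hU hK hL hU' hf.1
  refine ⟨exists_inflation_of_isSummand ⟨M, m, ⟨L, n, hmn⟩, hm⟩ ⟨U₀, ⟨e⟩⟩,
    hUK.of_retract_right (IsSummand.retract ⟨U₀, ⟨e⟩⟩).some, ?_⟩
  obtain ⟨_, _, _, _, _, _, _, _, _, _, _, hB⟩ := hB
  exact hB

/-- The Bongartz and the co-Bongartz complement are the ends of an exchange triangle. -/
lemma IsBongartzComplement.exchange (k : Type*) [Field k] [Linear k C]
    (homFinite : ∀ X Y : C, Module.Finite k (X ⟶ Y)) {B Z : C}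
    (hB : T.IsBongartzComplement P U B) (hZ : T.IsCoBongartzComplement P U Z) :
    T.Exchange U B Z := by
  have hBm := hB.isLeftMutable hA hP hU hZ
  obtain ⟨Y, V, x, y, δ, hδ⟩ := hBm.exists_exchange k homFinite
  obtain ⟨K, U', U₀, g, b, hK, hU', hU₀, ⟨e⟩, hUK⟩ := hB.exists_conflation hA hP hU
  obtain ⟨L, U'', U₁, f, c, hf, ⟨ε, hL⟩, hU₁, ⟨eL⟩, hZU⟩ := hZ
  obtain ⟨M, m, n, ⟨μ, hmn⟩, hm⟩ := exists_conflation_of_pushout hP hU hK ⟨ε, hL⟩ hU' hf.1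
  have hLU := hL.extVanishes_of_isLeftApprox hf.1 hU
  have hYU := (hδ.isRightMutable hU).extVanishes
  have h0 : IsZero (0 : C) := isZero_zero C
  have hsum := (T.realizes_sum _ _ _ _ _ _ hδ.1 (T.realizes_id_left h0 (0 : U₀ ⟶ 0))).of_iso
    e.symm (Iso.refl _) (isoBiprodZeroRight Y h0).symm
  obtain ⟨φ⟩ := exists_iso_of_common_left hsum hmn (hYU.inAdd_right hm.1)
    (hLU.inAdd_right (hδ.2.1.1.1.biprod hU₀))
  -- both `B ⊞ U₀ ⟶ V ⊞ U₀ ⟶ Y` and `K ⟶ M ⟶ L` start with an approximation of `K ≅ B ⊞ U₀`, which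
  -- gives `φ : (V ⊞ U₀) ⊞ L ≅ M ⊞ Y`; cancelling the summands in `add U` yields `Y ≅ Z`
  obtain ⟨ψ⟩ := NoCommonSummand.cancel hδ.noCommonSummand_right hZU hm.1
    (hU₁.biprod (hδ.2.1.1.1.biprod hU₀))
    ((biprod.braiding Y M).trans (φ.symm.trans ((biprod.braiding _ L).trans
      ((biprod.mapIso eL (Iso.refl (V ⊞ U₀))).trans (biprod.associator Z U₁ (V ⊞ U₀))))))
  exact Exchange.of_iso ⟨V, x, y, δ, hδ⟩ (Iso.refl B) ψ

/-- If `𝔼(U, Y)` vanishes, so does `𝔼(B, Y)`. -/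
lemma IsBongartzComplement.extVanishes_of_extVanishes {B Y : C}
    (hB : T.IsBongartzComplement P U B) (hY : T.ExtVanishes U Y) : T.ExtVanishes B Y := by
  obtain ⟨K, U', U₀, g, b, ⟨δ, hK⟩, hU', hU₀, ⟨e⟩, hUK⟩ := hB.exists_conflation hA hP hU
  exact (hK.extVanishes_middle_left (hP.extVanishes Y) (hY.inAdd_left hU')).of_retract_left
    (IsSummand.retract ⟨U₀, ⟨e⟩⟩).some

lemma IsBongartzComplement.presilting {B Z : C} (hB : T.IsBongartzComplement P U B)
    (hZ : T.IsCoBongartzComplement P U Z) : T.Presilting (B ⊞ U) := by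
  have h1 := (hB.isLeftMutable hA hP hU hZ).extVanishes
  have h2 : T.ExtVanishes U (B ⊞ U) := h1.biprod_right hU
  exact (hB.extVanishes_of_extVanishes hA hP hU h2).biprod_left h2

end Complements

end ZeroAuslander

end Extriangulated

/-! ### Multiplicities of indecomposable summands -/

section Additive

variable {C : Type u} [Category.{v} C] [Preadditive C] [HasZeroObject C]
  [HasBinaryBiproducts C] [HasFiniteBiproducts C]

/-- Splitting off the first summand of a finite direct sum. -/
noncomputable def biproductSuccIso {n : ℕ} (F : Fin (n + 1) → C) :
    (⨁ F) ≅ F 0 ⊞ (⨁ fun i : Fin n => F i.succ) where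
  hom := biprod.lift (biproduct.π F 0) (biproduct.lift fun i => biproduct.π F i.succ)
  inv := biprod.desc (biproduct.ι F 0) (biproduct.desc fun i => biproduct.ι F i.succ)
  hom_inv_id := by
    rw [biprod.lift_desc, biproduct.lift_desc, ← biproduct.total, Fin.sum_univ_succ]
  inv_hom_id := by
    refine biprod.hom_ext' _ _ ?_ ?_
    · refine biprod.hom_ext _ _ (by simp) (biproduct.hom_ext _ _ fun i => ?_)
      simp [biproduct.ι_π_ne _ (Fin.succ_ne_zero i).symm]
    · refine biproduct.hom_ext' _ _ fun j =>
        biprod.hom_ext _ _ (by simp [biproduct.ι_π_ne _ (Fin.succ_ne_zero j)])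
          (biproduct.hom_ext _ _ fun i => ?_)
      by_cases h : j = i
      · subst h; simp
      · simp [biproduct.ι_π_ne _ h, biproduct.ι_π_ne _ (fun h' => h (Fin.succ_injective _ h'))]

lemma isZero_biproduct_fin_zero (F : Fin 0 → C) : IsZero (⨁ F) :=
  (IsZero.iff_id_eq_zero (⨁ F)).2 (biproduct.hom_ext _ _ fun i => i.elim0)

/-- A function on objects that is invariant under isomorphism and additive on `add S`. -/
structure IsAdditiveOn (S : C) (φ : C → ℚ) : Prop where
  map_iso : ∀ {X Y : C}, (X ≅ Y) → InAdd S X → φ X = φ Y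
  map_biprod : ∀ {X Y : C}, InAdd S X → InAdd S Y → φ (X ⊞ Y) = φ X + φ Y

lemma IsAdditiveOn.map_zero {S : C} {φ : C → ℚ} (h : IsAdditiveOn S φ) {X : C} (hX : IsZero X) :
    φ X = 0 := by
  have h1 := h.map_iso (isoBiprodZeroRight X hX) (inAdd_of_isZero hX)
  rw [h.map_biprod (inAdd_of_isZero hX) (inAdd_of_isZero hX)] at h1
  linarith

lemma IsAdditiveOn.sum {S : C} {ι : Type*} (t : Finset ι) {φ : ι → C → ℚ}
    (h : ∀ i, IsAdditiveOn S (φ i)) (a : ι → ℚ) :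
    IsAdditiveOn S fun X => ∑ i ∈ t, φ i X * a i where
  map_iso e hX := Finset.sum_congr rfl fun i _ => by rw [(h i).map_iso e hX]
  map_biprod hX hY := by
    rw [← Finset.sum_add_distrib]
    exact Finset.sum_congr rfl fun i _ => by rw [(h i).map_biprod hX hY, add_mul]

lemma IsAdditiveOn.eq_of_indecomposable [IsIdempotentComplete C] (hC : IsKrullSchmidt C) {S : C}
    {φ ψ : C → ℚ} (hφ : IsAdditiveOn S φ) (hψ : IsAdditiveOn S ψ)
    (h : ∀ X, Indecomposable X → InAdd S X → φ X = ψ X) (X : C) (hX : InAdd S X) : φ X = ψ X := by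
  have key : ∀ (n : ℕ) (F : Fin n → C), (∀ i, Indecomposable (F i)) → (∀ i, InAdd S (F i)) →
      φ (⨁ F) = ψ (⨁ F) := by
    intro n
    induction n with
    | zero =>
      intro F _ _
      rw [hφ.map_zero (isZero_biproduct_fin_zero F), hψ.map_zero (isZero_biproduct_fin_zero F)]
    | succ n ih =>
      intro F hF hS
      have h1 : InAdd S (⨁ F) := InAdd.biproduct hS
      have h2 : InAdd S (⨁ fun i : Fin n => F i.succ) := InAdd.biproduct fun i => hS i.succ
      rw [hφ.map_iso (biproductSuccIso F) h1, hψ.map_iso (biproductSuccIso F) h1,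
        hφ.map_biprod (hS 0) h2, hψ.map_biprod (hS 0) h2, h _ (hF 0) (hS 0),
        ih _ (fun i => hF i.succ) fun i => hS i.succ]
  obtain ⟨n, F, hF, ⟨e⟩⟩ := hC.exists_indecomposables X
  have hS : ∀ i, InAdd S (F i) := fun i =>
    hX.of_isSummand ((isSummand_biproduct F i).of_iso e.symm)
  rw [hφ.map_iso e hX, hψ.map_iso e hX, key n F hF hS]

lemma exists_iso_of_indecomposable_inAdd [IsIdempotentComplete C] [FittingCategory C]
    {S X : C} (hX : Indecomposable X) (h : InAdd S X) : IsSummand X S := by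
  obtain ⟨n, s, r, hsr⟩ := h.exists_sum
  obtain ⟨i, -, hi⟩ := exists_isIso_of_sum hX Finset.univ (fun i => s i ≫ r i)
    (by rw [hsr]; infer_instance)
  exact isSummand_of_retract ⟨s i, r i ≫ inv (s i ≫ r i), by
    rw [← Category.assoc, IsIso.hom_inv_id]⟩

/-- The indecomposable summands of `B ⊞ U` are those of `B` and those of `U`. -/
lemma isSummand_biprod_iff [IsIdempotentComplete C] [FittingCategory C] {B U X : C}
    (hX : Indecomposable X) : IsSummand X (B ⊞ U) ↔ IsSummand X B ∨ IsSummand X U := by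
  refine ⟨fun h => ?_, ?_⟩
  · obtain ⟨ρ⟩ := h.retract
    have h1 : IsIso ((ρ.i ≫ biprod.fst) ≫ (biprod.inl ≫ ρ.r) +
        (ρ.i ≫ biprod.snd) ≫ (biprod.inr ≫ ρ.r)) := by
      have : (ρ.i ≫ biprod.fst) ≫ (biprod.inl ≫ ρ.r) +
        (ρ.i ≫ biprod.snd) ≫ (biprod.inr ≫ ρ.r) = ρ.i ≫
          (biprod.fst ≫ biprod.inl + biprod.snd ≫ biprod.inr) ≫ ρ.r := by
        simp only [Preadditive.add_comp, Preadditive.comp_add, Category.assoc]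
      rw [this, biprod.total, Category.id_comp, ρ.retract]
      infer_instance
    rcases isIso_or_isIso_of_add hX _ _ h1 with h1 | h1
    · exact Or.inl (isSummand_of_retract ⟨ρ.i ≫ biprod.fst, (biprod.inl ≫ ρ.r) ≫ inv _, by
        rw [← Category.assoc, IsIso.hom_inv_id]⟩)
    · exact Or.inr (isSummand_of_retract ⟨ρ.i ≫ biprod.snd, (biprod.inr ≫ ρ.r) ≫ inv _, by
        rw [← Category.assoc, IsIso.hom_inv_id]⟩)
  · rintro (h | h)
    · exact h.trans (isSummand_left B U)
    · exact h.trans (isSummand_right B U)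

/-- The number of indecomposable summands is additive for objects without common summands. -/
lemma numInd_biprod (hC : IsKrullSchmidt C) [FittingCategory C] {B U : C}
    (h : NoCommonSummand U B) : numInd (B ⊞ U) = numInd B + numInd U := by
  have := hC.isIdempotentComplete
  have := hC.finite_indClass B
  have := hC.finite_indClass U
  let f : IndClass B → IndClass (B ⊞ U) := Quotient.map
    (fun X => ⟨X.1, X.2.1, X.2.2.trans (isSummand_left B U)⟩) fun _ _ => id
  let g : IndClass U → IndClass (B ⊞ U) := Quotient.map
    (fun X => ⟨X.1, X.2.1, X.2.2.trans (isSummand_right B U)⟩) fun _ _ => id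
  have hbij : Function.Bijective (Sum.elim f g) := by
    constructor
    · have hne : ∀ x y, f x ≠ g y := by
        rintro ⟨X⟩ ⟨Y⟩ hXY
        obtain ⟨e⟩ : Nonempty (X.1 ≅ Y.1) := Quotient.exact hXY
        exact X.2.1.1 (h X.1 X.2.2 (Y.2.2.inAdd.of_iso e.symm))
      refine Function.Injective.sumElim ?_ ?_ hne
      · rintro ⟨X⟩ ⟨Y⟩ hXY
        have h1 : Nonempty (X.1 ≅ Y.1) := Quotient.exact hXY
        exact Quotient.sound h1
      · rintro ⟨X⟩ ⟨Y⟩ hXY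
        have h1 : Nonempty (X.1 ≅ Y.1) := Quotient.exact hXY
        exact Quotient.sound h1
    · rintro ⟨X⟩
      rcases (isSummand_biprod_iff X.2.1).1 X.2.2 with h1 | h1
      · exact ⟨Sum.inl (cls ⟨X.1, X.2.1, h1⟩), rfl⟩
      · exact ⟨Sum.inr (cls ⟨X.1, X.2.1, h1⟩), rfl⟩
  rw [numInd, numInd, numInd, ← Nat.card_congr (Equiv.ofBijective _ hbij), Nat.card_sum]

/-- A representative of a class of indecomposable summands. -/
noncomputable def IndClass.rep {S : C} (s : IndClass S) : C := (Quotient.out s).1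

lemma IndClass.indecomposable_rep {S : C} (s : IndClass S) : Indecomposable s.rep :=
  (Quotient.out s).2.1

lemma IndClass.inAdd_rep [IsIdempotentComplete C] {S : C} (s : IndClass S) : InAdd S s.rep :=
  (Quotient.out s).2.2.inAdd

lemma rep_cls_iso {S : C} (X : IndSummand S) : Nonempty ((cls X).rep ≅ X.1) :=
  Quotient.exact (Quotient.out_eq (cls X))

lemma IndClass.eq_of_rep_iso {S : C} {s t : IndClass S} (h : Nonempty (s.rep ≅ t.rep)) :
    s = t := by
  rw [← Quotient.out_eq s, ← Quotient.out_eq t]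
  exact Quotient.sound h

section Linear

variable (k : Type*) [Field k] [Linear k C]

/-- The radical morphisms form a subspace. -/
def radicalSubmodule (X Y : C) : Submodule k (X ⟶ Y) where
  carrier := {f | IsRadical f}
  add_mem' hf hg := hf.add hg
  zero_mem' := IsRadical.zero X Y
  smul_mem' c f hf := by
    have : c • f = f ≫ (c • 𝟙 Y) := by simp
    rw [this]
    exact hf.comp_right _

/-- The dimension of `Hom(X, S) / rad(X, S)`. -/
noncomputable def topDim (S X : C) : ℚ :=
  Module.finrank k (X ⟶ S) - Module.finrank k (radicalSubmodule k X S)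

/-- The multiplicity of an indecomposable object `S` as a summand of `X`. -/
noncomputable def multiplicity (S X : C) : ℚ := topDim k S X / topDim k S S

variable (homFinite : ∀ X Y : C, Module.Finite k (X ⟶ Y))
include homFinite

lemma topDim_iso {X Y : C} (e : X ≅ Y) (S : C) : topDim k S X = topDim k S Y := by
  have e1 : (X ⟶ S) ≃ₗ[k] (Y ⟶ S) :=
    { toFun := fun f => e.inv ≫ f
      map_add' := by simp
      map_smul' := by simp
      invFun := fun f => e.hom ≫ f
      left_inv := fun f => by simp
      right_inv := fun f => by simp }
  have e2 : radicalSubmodule k X S ≃ₗ[k] radicalSubmodule k Y S :=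
    { toFun := fun f => ⟨e.inv ≫ f.1, f.2.comp_left _⟩
      map_add' := fun f g => Subtype.ext (by simp)
      map_smul' := fun c f => Subtype.ext (by simp)
      invFun := fun f => ⟨e.hom ≫ f.1, f.2.comp_left _⟩
      left_inv := fun f => Subtype.ext (by simp)
      right_inv := fun f => Subtype.ext (by simp) }
  rw [topDim, topDim, e1.finrank_eq, e2.finrank_eq]

lemma topDim_biprod (X Y S : C) : topDim k S (X ⊞ Y) = topDim k S X + topDim k S Y := by
  have e1 : (X ⊞ Y ⟶ S) ≃ₗ[k] (X ⟶ S) × (Y ⟶ S) :=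
    { toFun := fun f => (biprod.inl ≫ f, biprod.inr ≫ f)
      map_add' := by simp
      map_smul' := by simp
      invFun := fun f => biprod.fst ≫ f.1 + biprod.snd ≫ f.2
      left_inv := fun f => by
        simp only [← Category.assoc]
        rw [← Preadditive.add_comp, biprod.total, Category.id_comp]
      right_inv := fun f => by simp }
  have e2 : radicalSubmodule k (X ⊞ Y) S ≃ₗ[k]
      radicalSubmodule k X S × radicalSubmodule k Y S :=
    { toFun := fun f => (⟨biprod.inl ≫ f.1, f.2.comp_left _⟩, ⟨biprod.inr ≫ f.1, f.2.comp_left _⟩)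
      map_add' := fun f g => by ext <;> simp
      map_smul' := fun c f => by ext <;> simp
      invFun := fun f => ⟨biprod.fst ≫ f.1.1 + biprod.snd ≫ f.2.1,
        (f.1.2.comp_left _).add (f.2.2.comp_left _)⟩
      left_inv := fun f => Subtype.ext <| by
        simp only [← Category.assoc]
        rw [← Preadditive.add_comp, biprod.total, Category.id_comp]
      right_inv := fun f => by ext <;> simp }
  have := homFinite X S
  have := homFinite Y S
  rw [topDim, topDim, topDim, e1.finrank_eq, e2.finrank_eq, Module.finrank_prod,
    Module.finrank_prod]
  push_cast
  ring

lemma topDim_self_pos {S : C} (hS : ¬ IsZero S) : 0 < topDim k S S := by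
  have := homFinite S S
  have h : radicalSubmodule k S S < ⊤ :=
    lt_top_iff_ne_top.2 fun h => hS (IsRadical.isZero (X := S)
      (show 𝟙 S ∈ radicalSubmodule k S S by rw [h]; trivial))
  have := Submodule.finrank_lt h.ne
  rw [topDim, sub_pos]
  exact_mod_cast this

lemma topDim_eq_zero [IsIdempotentComplete C] {S X : C} (hS : Indecomposable S)
    (hX : Indecomposable X) (h : ¬ Nonempty (X ≅ S)) : topDim k S X = 0 := by
  have := fittingCategory_of_finite k homFinite
  have h1 : radicalSubmodule k X S = ⊤ := by
    refine eq_top_iff.2 fun f _ => isRadical_of_no_common_retract (fun Y ⟨ρ⟩ ⟨ρ'⟩ => ?_) f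
    by_contra hY
    have := isIso_of_retract_indecomposable hX hY _ _ ρ.retract
    have := isIso_of_retract_indecomposable hS hY _ _ ρ'.retract
    exact h ⟨(asIso ρ.i).symm.trans (asIso ρ'.i)⟩
  rw [topDim, h1, finrank_top, sub_self]

lemma isAdditiveOn_multiplicity (S T : C) : IsAdditiveOn T (multiplicity k S) where
  map_iso e _ := by rw [multiplicity, multiplicity, topDim_iso k homFinite e]
  map_biprod _ _ := by
    rw [multiplicity, multiplicity, multiplicity, topDim_biprod k homFinite, add_div]

lemma multiplicity_self {S X : C} (hS : ¬ IsZero S) (e : X ≅ S) : multiplicity k S X = 1 := by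
  rw [multiplicity, topDim_iso k homFinite e, div_self (topDim_self_pos k homFinite hS).ne']

lemma multiplicity_eq_zero [IsIdempotentComplete C] {S X : C} (hS : Indecomposable S)
    (hX : Indecomposable X) (h : ¬ Nonempty (X ≅ S)) : multiplicity k S X = 0 := by
  rw [multiplicity, topDim_eq_zero k homFinite hS hX h, zero_div]

/-- An additive function on `add S` is determined by its values on indecomposable summands. -/
lemma IsAdditiveOn.eq_sum [IsIdempotentComplete C] (hC : IsKrullSchmidt C) {S : C}
    [Fintype (IndClass S)] {φ : C → ℚ} (hφ : IsAdditiveOn S φ) {X : C} (hX : InAdd S X) :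
    φ X = ∑ s : IndClass S, multiplicity k s.rep X * φ s.rep := by
  have := fittingCategory_of_finite k homFinite
  have hsum : IsAdditiveOn S fun X => ∑ s : IndClass S, multiplicity k s.rep X * φ s.rep :=
    IsAdditiveOn.sum Finset.univ (φ := fun s : IndClass S => multiplicity k s.rep)
      (fun s => isAdditiveOn_multiplicity k homFinite s.rep S) (fun s => φ s.rep)
  refine hφ.eq_of_indecomposable hC hsum (fun X hX hXS => ?_) X hX
  let x : IndSummand S := ⟨X, hX, exists_iso_of_indecomposable_inAdd hX hXS⟩
  obtain ⟨e⟩ := rep_cls_iso x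
  rw [Finset.sum_eq_single (cls x), multiplicity_self k homFinite (cls x).indecomposable_rep.1
    e.symm, one_mul, hφ.map_iso e.symm hXS]
  · intro s _ hs
    rw [multiplicity_eq_zero k homFinite s.indecomposable_rep hX, zero_mul]
    rintro ⟨f⟩
    exact hs (IndClass.eq_of_rep_iso ⟨f.symm.trans e.symm⟩)
  · simp

lemma multiplicity_rep [IsIdempotentComplete C] {S : C} [DecidableEq (IndClass S)]
    (s t : IndClass S) : multiplicity k s.rep t.rep = if t = s then 1 else 0 := by
  split_ifs with h
  · subst h; exact multiplicity_self k homFinite t.indecomposable_rep.1 (Iso.refl _)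
  · exact multiplicity_eq_zero k homFinite s.indecomposable_rep t.indecomposable_rep
      fun h' => h (IndClass.eq_of_rep_iso h')

/-- Two objects whose multiplicity vectors are related by mutually inverse matrices have the same
number of indecomposable summands. -/
lemma numInd_eq_of_isAdditiveOn [IsIdempotentComplete C] (hC : IsKrullSchmidt C) {S P : C}
    (c : IndClass S → C → ℚ) (a : IndClass P → C → ℚ)
    (hc : ∀ s, IsAdditiveOn P (c s)) (ha : ∀ p, IsAdditiveOn S (a p))
    (hca : ∀ Q, InAdd P Q → ∃ S₀ S₁, InAdd S S₀ ∧ InAdd S S₁ ∧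
      (∀ s, c s Q = multiplicity k s.rep S₀ - multiplicity k s.rep S₁) ∧
      ∀ p, a p S₀ - a p S₁ = multiplicity k p.rep Q)
    (hac : ∀ R, InAdd S R → ∃ P₀ P₁, InAdd P P₀ ∧ InAdd P P₁ ∧
      (∀ p, a p R = multiplicity k p.rep P₀ - multiplicity k p.rep P₁) ∧
      ∀ s, c s P₀ - c s P₁ = multiplicity k s.rep R) : numInd S = numInd P := by
  classical
  have := fittingCategory_of_finite k homFinite
  have := hC.finite_indClass S
  have := hC.finite_indClass P
  have := Fintype.ofFinite (IndClass S)
  have := Fintype.ofFinite (IndClass P)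
  let M : Matrix (IndClass P) (IndClass S) ℚ := fun p s => c s p.rep
  let N : Matrix (IndClass S) (IndClass P) ℚ := fun s p => a p s.rep
  have h1 : M * N = 1 := by
    ext p q
    obtain ⟨S₀, S₁, h0, h1, h2, h3⟩ := hca p.rep p.inAdd_rep
    have e0 := (ha q).eq_sum k homFinite hC h0
    have e1 := (ha q).eq_sum k homFinite hC h1
    have := h3 q
    rw [e0, e1, ← Finset.sum_sub_distrib, multiplicity_rep k homFinite] at this
    rw [Matrix.mul_apply, Matrix.one_apply, ← this]
    refine Finset.sum_congr rfl fun s _ => ?_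
    change c s _ * a q _ = _
    rw [h2]; ring
  have h2 : N * M = 1 := by
    ext s t
    obtain ⟨S₀, S₁, h0, h1, h2, h3⟩ := hac s.rep s.inAdd_rep
    have e0 := (hc t).eq_sum k homFinite hC h0
    have e1 := (hc t).eq_sum k homFinite hC h1
    have := h3 t
    rw [e0, e1, ← Finset.sum_sub_distrib, multiplicity_rep k homFinite] at this
    rw [Matrix.mul_apply, Matrix.one_apply, ← this]
    refine Finset.sum_congr rfl fun p _ => ?_
    change a p _ * c t _ = _
    rw [h2]; ring
  rw [numInd, numInd, Nat.card_eq_fintype_card, Nat.card_eq_fintype_card]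
  have hM := Matrix.rank_mul_le_left M N
  have hN := Matrix.rank_mul_le_left N M
  rw [h1, Matrix.rank_one] at hM
  rw [h2, Matrix.rank_one] at hN
  exact le_antisymm (hN.trans (Matrix.rank_le_card_width N)) (hM.trans (Matrix.rank_le_card_width M))

end Linear

end Additive

/-! ### Counting the indecomposable summands of a tilting object -/

namespace Extriangulated

section Counting

variable {C : Type u} [Category.{v} C] [Preadditive C] [HasZeroObject C]
  [HasBinaryBiproducts C] [HasFiniteBiproducts C] {T : Extriangulated.{w} C}

lemma IsProjectiveGenerator.projective {P Q : C} (hP : T.IsProjectiveGenerator P)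
    (hQ : InAdd P Q) : T.Projective Q := fun b hb g => (hP Q).2 hQ b hb g

lemma IsProjectiveGenerator.projective_self {P : C} (hP : T.IsProjectiveGenerator P) :
    T.Projective P := fun b hb g => (hP P).2 (inAdd_self P) b hb g

lemma IsProjectiveGenerator.extVanishes {P Q : C} (hP : T.IsProjectiveGenerator P)
    (hQ : InAdd P Q) (X : C) : T.ExtVanishes Q X :=
  Projective.extVanishes (fun b hb g => (hP Q).2 hQ b hb g) X

/-- `m(Y₀) - m(Y₁)` for an arbitrarily chosen conflation `X ⟶ Y₀ ⟶ Y₁` with terms in `add S`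
(and `0` if there is none). -/
noncomputable def coindex (T : Extriangulated.{w} C) (S : C) (m : C → ℚ) (X : C) : ℚ :=
  open Classical in
  if h : ∃ Y : C × C, InAdd S Y.1 ∧ InAdd S Y.2 ∧
    ∃ (i : X ⟶ Y.1) (p : Y.1 ⟶ Y.2), T.Conflation i p then m h.choose.1 - m h.choose.2 else 0

/-- `m(Q₀) - m(Q₁)` for an arbitrarily chosen conflation `Q₁ ⟶ Q₀ ⟶ X` with terms in `add P`
(and `0` if there is none). -/
noncomputable def index (T : Extriangulated.{w} C) (P : C) (m : C → ℚ) (X : C) : ℚ :=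
  open Classical in
  if h : ∃ Q : C × C, InAdd P Q.1 ∧ InAdd P Q.2 ∧
    ∃ (i : Q.2 ⟶ Q.1) (p : Q.1 ⟶ X), T.Conflation i p then m h.choose.1 - m h.choose.2 else 0

variable [IsIdempotentComplete C]

lemma Realizes.coindex_eq {S X Y₀ Y₁ : C} {i : X ⟶ Y₀} {p : Y₀ ⟶ Y₁} {δ : Extn T.E Y₁ X}
    (h : T.Realizes i p δ) (hS : T.Presilting S) (h0 : InAdd S Y₀) (h1 : InAdd S Y₁) {m : C → ℚ}
    (hm : IsAdditiveOn S m) : T.coindex S m X = m Y₀ - m Y₁ := by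
  have hex : ∃ Y : C × C, InAdd S Y.1 ∧ InAdd S Y.2 ∧
    ∃ (i : X ⟶ Y.1) (p : Y.1 ⟶ Y.2), T.Conflation i p := ⟨(Y₀, Y₁), h0, h1, i, p, δ, h⟩
  rw [coindex, dif_pos hex]
  obtain ⟨h0', h1', i', p', δ', h'⟩ := hex.choose_spec
  obtain ⟨e⟩ := exists_iso_of_common_left h h' (hS.extVanishes h1 h0') (hS.extVanishes h1' h0)
  have := hm.map_iso e (h0.biprod h1')
  rw [hm.map_biprod h0 h1', hm.map_biprod h0' h1] at this
  linarith

lemma Realizes.index_eq {P X Q₀ Q₁ : C} {i : Q₁ ⟶ Q₀} {p : Q₀ ⟶ X} {δ : Extn T.E X Q₁}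
    (h : T.Realizes i p δ) (hP : T.Presilting P) (h0 : InAdd P Q₀) (h1 : InAdd P Q₁) {m : C → ℚ}
    (hm : IsAdditiveOn P m) : T.index P m X = m Q₀ - m Q₁ := by
  have hex : ∃ Q : C × C, InAdd P Q.1 ∧ InAdd P Q.2 ∧
    ∃ (i : Q.2 ⟶ Q.1) (p : Q.1 ⟶ X), T.Conflation i p := ⟨(Q₀, Q₁), h0, h1, i, p, δ, h⟩
  rw [index, dif_pos hex]
  obtain ⟨h0', h1', i', p', δ', h'⟩ := hex.choose_spec
  obtain ⟨e⟩ := exists_iso_of_common_right h h' (hP.extVanishes h0 h1') (hP.extVanishes h0' h1)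
  have := hm.map_iso e (h1.biprod h0')
  rw [hm.map_biprod h1 h0', hm.map_biprod h1' h0] at this
  linarith

section

variable (k : Type*) [Field k] [Linear k C] (homFinite : ∀ X Y : C, Module.Finite k (X ⟶ Y))
include homFinite

/-- If `P` has an `add S`-coresolution of length one, then so has every object `Q` of `add P`: for a
complement `Q'` of `Q` in `P^n`, the cokernels of left `add S`-approximations of `Q` and `Q'` are
summands of an object of `add S`, by comparison with the `n`-fold coresolution of `P`. -/
lemma exists_coresolution_of_inAdd {P S S₀ S₁ : C} {i : P ⟶ S₀} {p : S₀ ⟶ S₁}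
    {δ : Extn T.E S₁ P} (h : T.Realizes i p δ) (hS : T.Presilting S) (h0 : InAdd S S₀)
    (h1 : InAdd S S₁) (hinf : ∀ {Q V : C} (f : Q ⟶ V), InAdd P Q → T.Inflation f)
    {Q : C} (hQ : InAdd P Q) :
    ∃ (Y₀ Y₁ : C) (i : Q ⟶ Y₀) (p : Y₀ ⟶ Y₁), InAdd S Y₀ ∧ InAdd S Y₁ ∧ T.Conflation i p := by
  obtain ⟨n, Q', ⟨e⟩⟩ := hQ
  have hQ : InAdd P Q := ⟨n, Q', ⟨e⟩⟩
  have hQ' : InAdd P Q' := InAdd.of_isSummand (X := ⨁ fun _ : Fin n => P)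
    (InAdd.biproduct fun _ => inAdd_self P) ((isSummand_right Q Q').of_iso e.symm)
  obtain ⟨V, f, hf⟩ := exists_isLeftApprox k homFinite S Q
  obtain ⟨V', f', hf'⟩ := exists_isLeftApprox k homFinite S Q'
  obtain ⟨Y, c, ε, hε⟩ := hinf f hQ
  obtain ⟨Y', c', ε', hε'⟩ := hinf f' hQ'
  refine ⟨V, Y, f, c, hf.1, ?_, ε, hε⟩
  have hsum := (T.realizes_sum _ _ _ _ _ _ hε hε').of_iso e.symm (Iso.refl _) (Iso.refl _)
  have hbig := realizes_biproduct (n := n) fun _ => h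
  have hY := hε.extVanishes_of_isLeftApprox hf hS
  have hY' := hε'.extVanishes_of_isLeftApprox hf' hS
  have h0n : InAdd S (⨁ fun _ : Fin n => S₀) := InAdd.biproduct fun _ => h0
  have h1n : InAdd S (⨁ fun _ : Fin n => S₁) := InAdd.biproduct fun _ => h1
  obtain ⟨φ⟩ := exists_iso_of_common_left hsum hbig
    ((hY.biprod_left hY').inAdd_right h0n) (hS.extVanishes h1n (hf.1.biprod hf'.1))
  refine InAdd.of_isSummand (((hf.1.biprod hf'.1).biprod h1n).of_iso φ) ?_
  exact (isSummand_left Y Y').trans (isSummand_right _ _)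

/-- If `P` has an `add S`-coresolution of length one, then `|S| = |P|`: the multiplicity vectors of
coresolutions of the summands of `P` and of resolutions of the summands of `S` form mutually inverse
matrices. -/
theorem numInd_eq_of_coresolution (hC : IsKrullSchmidt C) {P S S₀ S₁ : C} {i : P ⟶ S₀}
    {p : S₀ ⟶ S₁} {δ : Extn T.E S₁ P} (h : T.Realizes i p δ) (hS : T.Presilting S)
    (h0 : InAdd S S₀) (h1 : InAdd S S₁) (hP : T.IsProjectiveGenerator P)
    (hA : T.IsReducedZeroAuslander) : numInd S = numInd P := by
  have hPP : T.Presilting P := hP.extVanishes (inAdd_self P) P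
  have hinf : ∀ {Q V : C} (f : Q ⟶ V), InAdd P Q → T.Inflation f := fun {Q V} f hQ => by
    obtain ⟨J, hJ⟩ := exists_suspension hA (hP.projective hQ)
    exact hJ.inflation f
  have hco : ∀ Q, InAdd P Q → ∃ (Y₀ Y₁ : C) (i : Q ⟶ Y₀) (p : Y₀ ⟶ Y₁), InAdd S Y₀ ∧
      InAdd S Y₁ ∧ T.Conflation i p := fun Q hQ =>
    exists_coresolution_of_inAdd k homFinite h hS h0 h1 hinf hQ
  have hres : ∀ X : C, ∃ (Q₁ Q₀ : C) (i : Q₁ ⟶ Q₀) (p : Q₀ ⟶ X), InAdd P Q₁ ∧ InAdd P Q₀ ∧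
      T.Conflation i p := fun X => by
    obtain ⟨Q₁, Q₀, i, p, h1, h0, h⟩ := hA.resolution X
    exact ⟨Q₁, Q₀, i, p, (hP _).1 h1, (hP _).1 h0, h⟩
  have hm := isAdditiveOn_multiplicity k homFinite (C := C)
  have hcadd : ∀ R, IsAdditiveOn P (T.coindex S (multiplicity k R)) := fun R =>
    { map_iso := fun {X Y} e hX => by
        obtain ⟨Y₀, Y₁, i, p, k0, k1, ε, hε⟩ := hco X hX
        rw [hε.coindex_eq hS k0 k1 (hm R S), (hε.comp_iso_left e).coindex_eq hS k0 k1 (hm R S)]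
      map_biprod := fun {X Y} hX hY => by
        obtain ⟨Y₀, Y₁, i, p, k0, k1, ε, hε⟩ := hco X hX
        obtain ⟨Y₀', Y₁', i', p', k0', k1', ε', hε'⟩ := hco Y hY
        rw [hε.coindex_eq hS k0 k1 (hm R S), hε'.coindex_eq hS k0' k1' (hm R S),
          (T.realizes_sum _ _ _ _ _ _ hε hε').coindex_eq hS (k0.biprod k0') (k1.biprod k1')
            (hm R S), (hm R S).map_biprod k0 k0', (hm R S).map_biprod k1 k1']
        ring }
  have haadd : ∀ R, IsAdditiveOn S (T.index P (multiplicity k R)) := fun R =>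
    { map_iso := fun {X Y} e _ => by
        obtain ⟨Q₁, Q₀, i, p, k1, k0, ε, hε⟩ := hres X
        rw [hε.index_eq hPP k0 k1 (hm R P), (hε.comp_iso_right e).index_eq hPP k0 k1 (hm R P)]
      map_biprod := fun {X Y} _ _ => by
        obtain ⟨Q₁, Q₀, i, p, k1, k0, ε, hε⟩ := hres X
        obtain ⟨Q₁', Q₀', i', p', k1', k0', ε', hε'⟩ := hres Y
        rw [hε.index_eq hPP k0 k1 (hm R P), hε'.index_eq hPP k0' k1' (hm R P),
          (T.realizes_sum _ _ _ _ _ _ hε hε').index_eq hPP (k0.biprod k0') (k1.biprod k1')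
            (hm R P), (hm R P).map_biprod k0 k0', (hm R P).map_biprod k1 k1']
        ring }
  refine numInd_eq_of_isAdditiveOn k homFinite hC
    (fun s => T.coindex S (multiplicity k s.rep)) (fun p => T.index P (multiplicity k p.rep))
    (fun s => hcadd s.rep) (fun p => haadd p.rep) (fun Q hQ => ?_) fun R hR => ?_
  · obtain ⟨Y₀, Y₁, i, p, k0, k1, ε, hε⟩ := hco Q hQ
    refine ⟨Y₀, Y₁, k0, k1, fun s => hε.coindex_eq hS k0 k1 (hm s.rep S), fun p => ?_⟩
    obtain ⟨Q₁, Q₀, j, q, l1, l0, μ, hμ⟩ := hres Y₁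
    -- the pullback `N` of `Y₀ ⟶ Y₁ ⟵ Q₀` is `Q ⊞ Q₀`, and `Q₁ ⟶ N ⟶ Y₀` is a conflation
    obtain ⟨N, m, n, m', n', hm1, hm2, -⟩ := exists_pullback hε hμ
    rw [hP.extVanishes l0 _ (pull T.E q ε)] at hm1
    obtain ⟨e, -⟩ := hm1.exists_iso_biprod
    rw [hμ.index_eq hPP l0 l1 (hm p.rep P),
      hm2.index_eq hPP ((hQ.biprod l0).of_iso e.symm) l1 (hm p.rep P),
      (hm p.rep P).map_iso e.symm (hQ.biprod l0) |>.symm, (hm p.rep P).map_biprod hQ l0]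
    ring
  · obtain ⟨Q₁, Q₀, j, q, l1, l0, μ, hμ⟩ := hres R
    refine ⟨Q₀, Q₁, l0, l1, fun p => hμ.index_eq hPP l0 l1 (hm p.rep P), fun s => ?_⟩
    obtain ⟨Y₀, Y₁, i, p, k0, k1, ε, hε⟩ := hco Q₁ l1
    -- the pushout `N` of `Q₀ ⟵ Q₁ ⟶ Y₀` is `Y₀ ⊞ R`, and `Q₀ ⟶ N ⟶ Y₁` is a conflation
    obtain ⟨N, m, n, m', n', hm1, hm2, -⟩ := exists_pushout hμ hε
    rw [hS.extVanishes hR k0 (push T.E i μ)] at hm2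
    obtain ⟨e, -⟩ := hm2.exists_iso_biprod
    rw [hε.coindex_eq hS k0 k1 (hm s.rep S),
      hm1.coindex_eq hS ((k0.biprod hR).of_iso e.symm) k1 (hm s.rep S),
      (hm s.rep S).map_iso e.symm (k0.biprod hR) |>.symm, (hm s.rep S).map_biprod k0 hR]
    ring

/-- The Bongartz complement `B` of `U` satisfies `|B| + |U| = |P|`. -/
theorem IsBongartzComplement.numInd_add (hC : IsKrullSchmidt C) {P U B Z : C}
    (hA : T.IsReducedZeroAuslander) (hP : T.IsProjectiveGenerator P) (hU : T.Presilting U)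
    (hB : T.IsBongartzComplement P U B) (hZ : T.IsCoBongartzComplement P U Z) :
    numInd B + numInd U = numInd P := by
  have := fittingCategory_of_finite k homFinite
  have hPP : T.Projective P := hP.projective_self
  have hS := hB.presilting hA hPP hU hZ
  have hBU := (hB.isLeftMutable hA hPP hU hZ).noCommonSummand
  obtain ⟨K, U', U₀, g, b, ⟨δ, h⟩, hU', hU₀, ⟨e⟩, hUK⟩ := hB.exists_conflation hA hPP hU
  rw [← numInd_biprod hC hBU]
  have hB1 : InAdd (B ⊞ U) B := (isSummand_left B U).inAdd
  exact numInd_eq_of_coresolution k homFinite hC h hS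
    ((hB1.biprod (hU₀.mono (isSummand_right B U))).of_iso e.symm)
    (hU'.mono (isSummand_right B U)) hP hA

end

end Counting

end Extriangulated

/-! ### Vanishing of homomorphisms to the Auslander-Reiten translate -/

section Tau

variable {Λ : Type v} [Ring Λ]

/-- Every morphism `P₁ ⟶ N` extends along `d : P₁ ⟶ P₀`. -/
def Extends {P₁ P₀ : ModuleCat.{v} Λ} (d : P₁ ⟶ P₀) (N : ModuleCat.{v} Λ) : Prop :=
  ∀ g : P₁ ⟶ N, ∃ h : P₀ ⟶ N, d ≫ h = g

/-- A finitely generated projective module has a finite dual basis. -/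
lemma exists_dual_basis (Q : Type*) [AddCommGroup Q] [Module Λ Q] [Module.Finite Λ Q]
    [Module.Projective Λ Q] : ∃ (n : ℕ) (q : Fin n → Q) (η : Fin n → (Q →ₗ[Λ] Λ)),
      ∀ x, ∑ j, η j x • q j = x := by
  obtain ⟨n, f, hf⟩ := Module.Finite.exists_fin' Λ Q
  obtain ⟨s, hs⟩ := f.exists_rightInverse_of_surjective (LinearMap.range_eq_top.2 hf)
  refine ⟨n, fun j => f (Pi.single j 1), fun j => LinearMap.proj j ∘ₗ s, fun x => ?_⟩
  have h1 : f (s x) = x := LinearMap.congr_fun hs x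
  conv_rhs => rw [← h1, pi_eq_sum_univ (s x), map_sum]
  refine Finset.sum_congr rfl fun j _ => ?_
  rw [map_smul]
  refine congrArg (fun v => s x j • f v) ?_
  ext i
  simp [Pi.single_apply, eq_comm]

/-- The `k`-linear functional underlying an element of the `k`-dual. -/
def KDual.toLinearMap {k N : Type*} [Field k] [Algebra k Λ] [AddCommGroup N] [Module Λᵐᵒᵖ N]
    [Module k N] [IsScalarTower k Λᵐᵒᵖ N] (φ : KDual k Λ N) : N →ₗ[k] k := φ

/-- If every morphism `P₁ ⟶ N` extends along `d`, then homomorphisms `N ⟶ τM` vanish: elements of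
`τM` are functionals on `Hom(P₁, Λ)` that vanish on the maps factoring through `d`, and finite dual
bases of `P₁` and `P₀` allow the evaluation of such a functional to be rewritten in terms of maps of
this kind. -/
lemma tau_hom_eq_zero (k : Type*) [Field k] [Algebra k Λ] {M N : ModuleCat.{v} Λ}
    (p : MinProjPresentation Λ M) (h : Extends p.d N) (f : N →ₗ[Λ] p.tau k) : f = 0 := by
  have := p.finite₁
  have := p.finite₀
  have := p.projective₁
  have := p.projective₀
  obtain ⟨m, q, η, hη⟩ := exists_dual_basis (Λ := Λ) p.P₁
  obtain ⟨l, r, θ, hθ⟩ := exists_dual_basis (Λ := Λ) p.P₀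
  let F : N →+ (p.P₁ →ₗ[Λ] Λ) →+ k :=
    { toFun := fun n =>
        { toFun := fun ζ => (f n).toLinearMap (Submodule.Quotient.mk ζ)
          map_zero' := by rw [Submodule.Quotient.mk_zero]; exact map_zero _
          map_add' := fun _ _ => by rw [Submodule.Quotient.mk_add]; exact map_add _ _ _ }
      map_zero' := AddMonoidHom.ext fun ζ => by
        change (f 0).toLinearMap _ = 0
        rw [map_zero]; rfl
      map_add' := fun a b => AddMonoidHom.ext fun ζ => by
        change (f (a + b)).toLinearMap _ = _
        rw [map_add]; rfl }
  have hF1 : ∀ (a : Λ) (n : N) (ζ : p.P₁ →ₗ[Λ] Λ), F (a • n) ζ = F n (MulOpposite.op a • ζ) := by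
    intro a n ζ
    change (f (a • n)).toLinearMap _ = _
    rw [map_smul]; rfl
  have hF2 : ∀ (n : N) (ξ : p.P₀ →ₗ[Λ] Λ), F n (ξ ∘ₗ p.d.hom) = 0 := by
    intro n ξ
    have hz : (Submodule.Quotient.mk (ξ ∘ₗ p.d.hom) : p.Tr) = 0 :=
      (Submodule.Quotient.mk_eq_zero (LinearMap.range (starMap p.d))).2 ⟨ξ, rfl⟩
    exact (congrArg (f n).toLinearMap hz).trans (map_zero _)
  have hexp : ∀ ζ : p.P₁ →ₗ[Λ] Λ, ∑ j, MulOpposite.op (ζ (q j)) • η j = ζ := by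
    intro ζ
    ext x
    rw [LinearMap.sum_apply]
    conv_rhs => rw [← hη x, map_sum]
    exact Finset.sum_congr rfl fun j _ => (map_smul ζ _ _).symm
  have hF : ∀ n ζ, F n ζ = 0 := by
    intro n ζ
    obtain ⟨g, hg⟩ := h (ModuleCat.ofHom (LinearMap.toSpanSingleton Λ N n ∘ₗ ζ))
    have hg' : ∀ j, ζ (q j) • n = ∑ i, θ i (p.d.hom (q j)) • g.hom (r i) := by
      intro j
      have h1 : g.hom (p.d.hom (q j)) = ζ (q j) • n :=
        LinearMap.congr_fun (congrArg ModuleCat.Hom.hom hg) (q j)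
      rw [← h1]
      conv_lhs => rw [← hθ (p.d.hom (q j)), map_sum]
      exact Finset.sum_congr rfl fun i _ => map_smul _ _ _
    calc F n ζ = F n (∑ j, MulOpposite.op (ζ (q j)) • η j) := by rw [hexp]
      _ = ∑ j, F (ζ (q j) • n) (η j) := by
        rw [map_sum]; exact Finset.sum_congr rfl fun j _ => (hF1 _ _ _).symm
      _ = ∑ j, ∑ i, F (g.hom (r i)) (MulOpposite.op ((θ i ∘ₗ p.d.hom) (q j)) • η j) := by
        refine Finset.sum_congr rfl fun j _ => ?_
        rw [hg', map_sum, AddMonoidHom.finsetSum_apply]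
        exact Finset.sum_congr rfl fun i _ => hF1 _ _ _
      _ = ∑ i, F (g.hom (r i)) (θ i ∘ₗ p.d.hom) := by
        rw [Finset.sum_comm]
        refine Finset.sum_congr rfl fun i _ => ?_
        rw [← map_sum, hexp]
      _ = 0 := Finset.sum_eq_zero fun i _ => hF2 _ _
  ext n
  refine LinearMap.ext fun x => ?_
  obtain ⟨ζ, rfl⟩ := Submodule.Quotient.mk_surjective _ x
  exact hF n ζ

/-- Conversely, a functional on `Hom(P₁, N)` that vanishes on the morphisms which extend along `d`
defines a homomorphism `N ⟶ τM`. -/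
lemma extends_of_tau_hom_eq_zero (k : Type*) [Field k] [Algebra k Λ] {M N : ModuleCat.{v} Λ}
    (p : MinProjPresentation Λ M) (h : ∀ f : N →ₗ[Λ] p.tau k, f = 0) : Extends p.d N := by
  have := p.finite₁
  have := p.projective₁
  obtain ⟨m, q, η, hη⟩ := exists_dual_basis (Λ := Λ) p.P₁
  letI : Module k N := Module.compHom N (algebraMap k Λ)
  have hk : ∀ (c : k) (n : N), c • n = algebraMap k Λ c • n := fun _ _ => rfl
  have : SMulCommClass Λ k N := ⟨fun a c n => by
    rw [hk, hk, smul_smul, smul_smul, Algebra.commutes]⟩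
  let I : Submodule k (p.P₁ →ₗ[Λ] N) :=
    { carrier := {g | ∃ h : p.P₀ →ₗ[Λ] N, h ∘ₗ p.d.hom = g}
      add_mem' := by
        rintro _ _ ⟨a, rfl⟩ ⟨b, rfl⟩
        exact ⟨a + b, LinearMap.add_comp _ _ _⟩
      zero_mem' := ⟨0, LinearMap.zero_comp _⟩
      smul_mem' := by
        rintro c _ ⟨a, rfl⟩
        exact ⟨c • a, LinearMap.smul_comp _ _ _⟩ }
  suffices hI : ∀ g, g ∈ I by
    intro g
    obtain ⟨a, ha⟩ := hI g.hom
    exact ⟨ModuleCat.ofHom a, ModuleCat.hom_ext ha⟩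
  by_contra! hI
  obtain ⟨g, hg⟩ := hI
  -- a functional `F` on `Hom(P₁, N)` that vanishes on `I` but not at `g`
  obtain ⟨F, hFg, hF⟩ := Submodule.exists_le_ker_of_notMem hg
  have hF0 : ∀ a : p.P₀ →ₗ[Λ] N, F (a ∘ₗ p.d.hom) = 0 := fun a => hF ⟨a, rfl⟩
  let u (n : N) : (p.P₁ →ₗ[Λ] Λ) →+ k :=
    { toFun := fun ζ => F (LinearMap.toSpanSingleton Λ N n ∘ₗ ζ)
      map_zero' := by rw [LinearMap.comp_zero, map_zero]
      map_add' := fun a b => by rw [LinearMap.comp_add, map_add] }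
  have hu : ∀ n, (LinearMap.range (starMap p.d)).toAddSubgroup ≤ (u n).ker := by
    rintro n _ ⟨ξ, rfl⟩
    change F (LinearMap.toSpanSingleton Λ N n ∘ₗ (ξ ∘ₗ p.d.hom)) = 0
    rw [← LinearMap.comp_assoc]
    exact hF0 _
  let f : N →ₗ[Λ] p.tau k :=
    { toFun := fun n =>
        show p.Tr →ₗ[k] k from
        { toFun := QuotientAddGroup.lift _ (u n) (hu n)
          map_add' := map_add _
          map_smul' := fun c x => by
            obtain ⟨ζ, rfl⟩ := Submodule.Quotient.mk_surjective _ x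
            change F (LinearMap.toSpanSingleton Λ N n ∘ₗ (c • ζ)) =
              c • F (LinearMap.toSpanSingleton Λ N n ∘ₗ ζ)
            rw [← map_smul]
            congr 1
            ext x
            change (c • ζ x) • n = c • (ζ x • n)
            rw [hk, smul_smul, Algebra.smul_def] }
      map_add' := fun n n' => LinearMap.ext fun x => by
        obtain ⟨ζ, rfl⟩ := Submodule.Quotient.mk_surjective _ x
        change F (LinearMap.toSpanSingleton Λ N (n + n') ∘ₗ ζ) =
          F (LinearMap.toSpanSingleton Λ N n ∘ₗ ζ) + F (LinearMap.toSpanSingleton Λ N n' ∘ₗ ζ)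
        rw [← map_add]
        congr 1
        ext x
        exact smul_add _ _ _
      map_smul' := fun a n => LinearMap.ext fun x => by
        obtain ⟨ζ, rfl⟩ := Submodule.Quotient.mk_surjective _ x
        change F (LinearMap.toSpanSingleton Λ N (a • n) ∘ₗ ζ) =
          F (LinearMap.toSpanSingleton Λ N n ∘ₗ (MulOpposite.op a • ζ))
        congr 1
        ext x
        exact smul_smul _ _ _ }
  have hf : ∀ n ζ, F (LinearMap.toSpanSingleton Λ N n ∘ₗ ζ) = 0 := fun n ζ =>
    LinearMap.congr_fun (show (f n).toLinearMap = 0 by rw [h f]; rfl)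
      (Submodule.Quotient.mk ζ)
  refine hFg ?_
  have hg : g = ∑ j, LinearMap.toSpanSingleton Λ N (g (q j)) ∘ₗ η j := by
    ext x
    rw [LinearMap.sum_apply]
    conv_lhs => rw [← hη x, map_sum]
    exact Finset.sum_congr rfl fun j _ => map_smul _ _ _
  rw [hg, map_sum]
  exact Finset.sum_eq_zero fun j _ => hf _ _

/-- `Hom(N, τM) = 0` for a translate computed from some minimal presentation of `M`, expressed
without duality. -/
lemma homTauVanishes_iff (k : Type*) [Field k] [Algebra k Λ] {M N : ModuleCat.{v} Λ} :
    HomTauVanishes k N M ↔ ∃ p : MinProjPresentation Λ M, Extends p.d N :=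
  ⟨fun ⟨p, h⟩ => ⟨p, extends_of_tau_hom_eq_zero k p h⟩, fun ⟨p, h⟩ => ⟨p, tau_hom_eq_zero k p h⟩⟩

end Tau

/-! ### Extensions of modules -/

section Ext

variable {Λ : Type v} [Ring Λ]

open Abelian

/-- Every homomorphism from the kernel of `p` to `N` extends to `P₀`, as its composite with
`P₁ ⟶ ker p` extends along `d`. -/
lemma subsingleton_ext_of_extends {P₁ P₀ X N : ModuleCat.{v} Λ} (d : P₁ ⟶ P₀) (p : P₀ ⟶ X)
    [Projective P₀] (hp : Function.Surjective p.hom) (hdp : Function.Exact d.hom p.hom)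
    (h : Extends d N) : Subsingleton (Ext X N 1) := by
  have : Epi p := (ModuleCat.epi_iff_surjective p).2 hp
  let S : ShortComplex (ModuleCat.{v} Λ) := ShortComplex.mk (kernel.ι p) p (kernel.condition p)
  have hS : S.ShortExact := ShortComplex.ShortExact.mk' (ShortComplex.exact_kernel p)
    inferInstance inferInstance
  have hd : d ≫ p = 0 := ModuleCat.hom_ext (LinearMap.ext fun x => hdp.apply_apply_eq_zero x)
  have hepi : Epi (kernel.lift p d hd) := by
    have : (ShortComplex.mk d p hd).Exact :=
      (ShortComplex.ShortExact.moduleCat_exact_iff_function_exact _).2 hdp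
    exact (ShortComplex.exact_iff_epi_kernel_lift _).1 this
  refine ⟨fun x y => ?_⟩
  suffices h0 : ∀ x : Ext X N 1, x = 0 by rw [h0 x, h0 y]
  intro x
  obtain ⟨y, rfl⟩ := Ext.contravariant_sequence_exact₃ hS N x (Ext.eq_zero_of_projective _)
    (add_zero 1)
  obtain ⟨g, rfl⟩ := (Ext.mk₀_bijective _ _).2 y
  obtain ⟨l, hl⟩ := h (kernel.lift p d hd ≫ g)
  have : g = kernel.ι p ≫ l := by
    rw [← cancel_epi (kernel.lift p d hd), ← hl, kernel.lift_ι_assoc]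
  subst this
  rw [← Ext.mk₀_comp_mk₀, ← Ext.comp_assoc_of_third_deg_zero]
  change (hS.extClass.comp (Ext.mk₀ S.f) _).comp _ _ = 0
  rw [hS.extClass_comp, Ext.zero_comp]

/-- The long exact sequence of `Ext` shows that homomorphisms extend along `S.f`. -/
lemma exists_extension_of_subsingleton_ext {S : ShortComplex (ModuleCat.{v} Λ)}
    (hS : S.ShortExact) {N : ModuleCat.{v} Λ} (h : Subsingleton (Ext S.X₃ N 1)) (g : S.X₁ ⟶ N) :
    ∃ l : S.X₂ ⟶ N, S.f ≫ l = g := by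
  obtain ⟨y, hy⟩ := Ext.contravariant_sequence_exact₁ hS N (Ext.mk₀ g) (add_zero 1)
    (Subsingleton.elim _ _)
  obtain ⟨l, rfl⟩ := (Ext.mk₀_bijective _ _).2 y
  rw [Ext.mk₀_comp_mk₀] at hy
  exact ⟨l, (Ext.mk₀_bijective _ _).1 hy⟩

lemma subsingleton_ext_of_retract {X X' N : ModuleCat.{v} Λ} (ρ : Retract X' X)
    (h : Subsingleton (Ext X N 1)) : Subsingleton (Ext X' N 1) := by
  refine ⟨fun x y => ?_⟩
  have h0 : ∀ x : Ext X' N 1, x = (Ext.mk₀ (ρ.i ≫ ρ.r)).comp x (zero_add 1) := fun x => by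
    rw [ρ.retract, Ext.mk₀_id_comp]
  rw [h0 x, h0 y, ← Ext.mk₀_comp_mk₀_assoc, ← Ext.mk₀_comp_mk₀_assoc]
  rw [Subsingleton.elim ((Ext.mk₀ ρ.r).comp x (zero_add 1)) ((Ext.mk₀ ρ.r).comp y (zero_add 1))]

end Ext

/-! ### The functor represented by the projective generator -/

section HomFunctor

variable {C : Type u} [Category.{v} C] [Preadditive C] [HasZeroObject C]
  [HasBinaryBiproducts C] [HasFiniteBiproducts C] {P : C}

/-- The functor `C(P, -)` to left modules over the opposite of `End P`. -/
def homFunctor (P : C) : C ⥤ ModuleCat.{v} (End P)ᵐᵒᵖ := preadditiveCoyonedaObj P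

instance : (homFunctor P).Additive := inferInstanceAs (preadditiveCoyonedaObj P).Additive

lemma homFunctor_hom_ext {X : C} {M : ModuleCat.{v} (End P)ᵐᵒᵖ}
    {φ ψ : (homFunctor P).obj X ⟶ M} (h : ∀ g : P ⟶ X, φ.hom g = ψ.hom g) : φ = ψ :=
  ModuleCat.hom_ext (LinearMap.ext h)

lemma comp_eq_of_map_eq {X Y : C} {f f' : X ⟶ Y} (h : (homFunctor P).map f = (homFunctor P).map f')
    (g : P ⟶ X) : g ≫ f = g ≫ f' :=
  LinearMap.congr_fun (congrArg ModuleCat.Hom.hom h) g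

/-- If every morphism `P ⟶ Q ⟶ Y` factors through `v`, then so does `u`, provided that `Q` is in
`add P`. -/
lemma exists_lift_of_range {Q W Y : C} (hQ : InAdd P Q) (u : Q ⟶ Y) (v : W ⟶ Y)
    (h : ∀ g : P ⟶ Q, ∃ l : P ⟶ W, l ≫ v = g ≫ u) : ∃ t : Q ⟶ W, t ≫ v = u := by
  obtain ⟨n, s, r, hsr⟩ := hQ.exists_sum
  choose l hl using fun i => h (r i)
  refine ⟨∑ i, s i ≫ l i, ?_⟩
  simp only [Preadditive.sum_comp, Category.assoc, hl]
  conv_rhs => rw [← Category.id_comp u, ← hsr, Preadditive.sum_comp]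
  simp only [Category.assoc]

/-- `C(P, -)` is faithful on morphisms out of objects of `add P`. -/
lemma eq_of_inAdd {Q Y : C} (hQ : InAdd P Q) {f f' : Q ⟶ Y}
    (h : (homFunctor P).map f = (homFunctor P).map f') : f = f' := by
  obtain ⟨n, s, r, hsr⟩ := hQ.exists_sum
  rw [← Category.id_comp f, ← Category.id_comp f', ← hsr, Preadditive.sum_comp,
    Preadditive.sum_comp]
  exact Finset.sum_congr rfl fun i _ => by
    rw [Category.assoc, Category.assoc, comp_eq_of_map_eq h]

/-- `C(P, -)` is full on morphisms out of objects of `add P`. -/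
lemma exists_map_eq_of_inAdd {Q Y : C} (hQ : InAdd P Q)
    (φ : (homFunctor P).obj Q ⟶ (homFunctor P).obj Y) : ∃ f, (homFunctor P).map f = φ := by
  obtain ⟨n, s, r, hsr⟩ := hQ.exists_sum
  let R : Fin n → (homFunctor P).obj Q := r
  let R' : Fin n → (P ⟶ Y) := fun i => φ.hom (R i)
  refine ⟨∑ i, s i ≫ R' i, homFunctor_hom_ext fun g => ?_⟩
  have h1 : g = ∑ i, (g ≫ s i) ≫ r i := by
    simp only [Category.assoc]
    rw [← Preadditive.comp_sum, hsr, Category.comp_id]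
  have h2 : (g : (homFunctor P).obj Q) = ∑ i, (MulOpposite.op (g ≫ s i) : (End P)ᵐᵒᵖ) • R i := h1
  refine Eq.trans ?_ (congrArg φ.hom h2).symm
  rw [map_sum]
  refine (Preadditive.comp_sum Finset.univ g fun i => s i ≫ R' i).trans
    (Finset.sum_congr rfl fun i _ => ?_)
  rw [map_smul]
  exact (Category.assoc _ _ _).symm

/-- The regular module is `C(P, P)`. -/
def regularIso (P : C) : ModuleCat.of (End P)ᵐᵒᵖ (End P)ᵐᵒᵖ ≅ (homFunctor P).obj P :=
  let e : (End P)ᵐᵒᵖ ≃ₗ[(End P)ᵐᵒᵖ] (homFunctor P).obj P :=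
    { toFun := fun a => a.unop
      map_add' := fun _ _ => rfl
      map_smul' := fun _ _ => rfl
      invFun := fun a => MulOpposite.op a
      left_inv := fun _ => rfl
      right_inv := fun _ => rfl }
  e.toModuleIso

lemma projective_obj {Q : C} (hQ : InAdd P Q) :
    Module.Projective (End P)ᵐᵒᵖ ((homFunctor P).obj Q) := by
  obtain ⟨n, s, r, hsr⟩ := hQ.exists_sum
  let i : (homFunctor P).obj Q →ₗ[(End P)ᵐᵒᵖ] (Fin n → (End P)ᵐᵒᵖ) :=
    LinearMap.pi fun j => (regularIso P).inv.hom ∘ₗ ((homFunctor P).map (s j)).hom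
  let t : (Fin n → (End P)ᵐᵒᵖ) →ₗ[(End P)ᵐᵒᵖ] (homFunctor P).obj Q :=
    ∑ j, ((homFunctor P).map (r j)).hom ∘ₗ (regularIso P).hom.hom ∘ₗ LinearMap.proj j
  refine Module.Projective.of_split i t (LinearMap.ext fun g => ?_)
  have h1 : ∀ g : P ⟶ Q, ∑ j, (g ≫ s j) ≫ r j = g := fun g => by
    simp only [Category.assoc]
    rw [← Preadditive.comp_sum, hsr, Category.comp_id]
  rw [LinearMap.comp_apply, LinearMap.sum_apply]
  exact h1 g

section Finite

variable (k : Type*) [Field k] [Linear k C] (homFinite : ∀ X Y : C, Module.Finite k (X ⟶ Y))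
include homFinite

lemma finite_obj (X : C) : Module.Finite (End P)ᵐᵒᵖ ((homFunctor P).obj X) := by
  letI : Module k ((homFunctor P).obj X) := inferInstanceAs (Module k (P ⟶ X))
  have : IsScalarTower k (End P)ᵐᵒᵖ ((homFunctor P).obj X) :=
    ⟨fun c a g => Linear.smul_comp P P X c a.unop g⟩
  have : Module.Finite k ((homFunctor P).obj X) := homFinite P X
  exact Module.Finite.of_restrictScalars_finite k _ _

lemma isNoetherianRing_end : IsNoetherianRing (End P)ᵐᵒᵖ := by
  have : Module.Finite k (End P) := homFinite P P
  have : Module.Finite k (End P)ᵐᵒᵖ := Module.Finite.equiv (MulOpposite.opLinearEquiv k)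
  have : IsNoetherian k (End P)ᵐᵒᵖ := inferInstance
  exact isNoetherian_of_tower k this

end Finite

lemma inAdd_map [IsIdempotentComplete C] {U X : C} (h : InAdd U X) :
    InAdd ((homFunctor P).obj U) ((homFunctor P).obj X) := by
  obtain ⟨n, s, r, hsr⟩ := h.exists_sum
  refine InAdd.of_sum (fun i => (homFunctor P).map (s i)) (fun i => (homFunctor P).map (r i)) ?_
  simp only [← Functor.map_comp]
  rw [← Functor.map_sum, hsr, CategoryTheory.Functor.map_id]

lemma exists_retract_of_inAdd {U : C} {M : ModuleCat.{v} (End P)ᵐᵒᵖ}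
    (h : InAdd ((homFunctor P).obj U) M) :
    ∃ n : ℕ, Nonempty (Retract M ((homFunctor P).obj (⨁ fun _ : Fin n => U))) := by
  obtain ⟨n, s, r, hsr⟩ := h.exists_sum
  refine ⟨n, ⟨⟨∑ i, s i ≫ (homFunctor P).map (biproduct.ι (fun _ : Fin n => U) i),
    ∑ i, (homFunctor P).map (biproduct.π (fun _ : Fin n => U) i) ≫ r i, ?_⟩⟩⟩
  rw [← hsr, Preadditive.sum_comp]
  refine Finset.sum_congr rfl fun i _ => ?_
  rw [Preadditive.comp_sum, Finset.sum_eq_single i]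
  · rw [Category.assoc, ← Functor.map_comp_assoc, biproduct.ι_π_self, CategoryTheory.Functor.map_id,
      Category.id_comp]
  · intro j _ hj
    rw [Category.assoc, ← Functor.map_comp_assoc, biproduct.ι_π_ne _ hj.symm, Functor.map_zero,
      zero_comp, comp_zero]
  · simp

/-- `C(P, -)` preserves direct sums. -/
noncomputable def homFunctorBiprod (P X Y : C) :
    (homFunctor P).obj (X ⊞ Y) ≅ (homFunctor P).obj X ⊞ (homFunctor P).obj Y where
  hom := biprod.lift ((homFunctor P).map biprod.fst) ((homFunctor P).map biprod.snd)
  inv := biprod.desc ((homFunctor P).map biprod.inl) ((homFunctor P).map biprod.inr)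
  hom_inv_id := by
    rw [biprod.lift_desc, ← Functor.map_comp, ← Functor.map_comp, ← Functor.map_add, biprod.total,
      CategoryTheory.Functor.map_id]
  inv_hom_id := by
    refine biprod.hom_ext' _ _ (biprod.hom_ext _ _ ?_ ?_) (biprod.hom_ext _ _ ?_ ?_) <;>
      simp [← Functor.map_comp]

end HomFunctor

namespace Extriangulated

section HomFunctor

variable {C : Type u} [Category.{v} C] [Preadditive C] [HasZeroObject C]
  [HasBinaryBiproducts C] [HasFiniteBiproducts C] {T : Extriangulated.{w} C} {P : C}

lemma Realizes.exact_map {A B Z : C} {a : A ⟶ B} {b : B ⟶ Z} {δ : Extn T.E Z A}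
    (h : T.Realizes a b δ) :
    Function.Exact ((homFunctor P).map a).hom ((homFunctor P).map b).hom := by
  intro (g : P ⟶ B)
  refine ⟨fun hg => ?_, ?_⟩
  · obtain ⟨l, hl⟩ := h.lift g hg
    exact ⟨l, hl⟩
  · have h0 : ∀ l : P ⟶ A, (l ≫ a) ≫ b = 0 := fun l => by
      rw [Category.assoc, h.comp_eq_zero, comp_zero]
    rintro ⟨l, rfl⟩
    exact h0 l

lemma surjective_map (hP : T.Projective P) {B Z : C} {b : B ⟶ Z} (h : T.Deflation b) :
    Function.Surjective ((homFunctor P).map b).hom := fun g => hP b h g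

lemma Realizes.surjective_map (hP : T.Projective P) {A B Z : C} {a : A ⟶ B} {b : B ⟶ Z}
    {δ : Extn T.E Z A} (h : T.Realizes a b δ) :
    Function.Surjective ((homFunctor P).map b).hom :=
  Extriangulated.surjective_map hP ⟨_, _, _, h⟩

/-- Two cokernels of the same map are isomorphic. -/
lemma isIso_map_desc {M N L L' : ModuleCat.{v} (End P)ᵐᵒᵖ} {f : M ⟶ N} {g : N ⟶ L} {g' : N ⟶ L'}
    (h : Function.Exact f.hom g.hom) (hg : Function.Surjective g.hom)
    (h' : Function.Exact f.hom g'.hom) (hg' : Function.Surjective g'.hom) :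
    ∃ e : L ≅ L', g ≫ e.hom = g' := by
  have hker := h.linearMap_ker_eq.trans h'.linearMap_ker_eq.symm
  let e : L ≃ₗ[(End P)ᵐᵒᵖ] L' :=
    ((LinearMap.quotKerEquivOfSurjective g.hom hg).symm.trans
      (Submodule.quotEquivOfEq _ _ hker)).trans
      (LinearMap.quotKerEquivOfSurjective g'.hom hg')
  refine ⟨e.toModuleIso, ModuleCat.hom_ext (LinearMap.ext fun x => ?_)⟩
  change LinearMap.quotKerEquivOfSurjective g'.hom hg' (Submodule.quotEquivOfEq _ _ hker
    ((LinearMap.quotKerEquivOfSurjective g.hom hg).symm (g.hom x))) = g'.hom x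
  have : (LinearMap.quotKerEquivOfSurjective g.hom hg).symm (g.hom x) = Submodule.Quotient.mk x := by
    rw [LinearEquiv.symm_apply_eq]; rfl
  rw [this]; rfl

/-- `X` has no nonzero injective direct summand. -/
def NoInjectiveSummand (T : Extriangulated.{w} C) (X : C) : Prop :=
  ∀ Y : C, IsSummand Y X → T.Injective Y → IsZero Y

section Ideal

variable (hA : T.IsReducedZeroAuslander) (hP : T.IsProjectiveGenerator P)
include hA hP

lemma exists_resolution (X : C) : ∃ (Q₁ Q₀ : C) (i : Q₁ ⟶ Q₀) (p : Q₀ ⟶ X) (δ : Extn T.E X Q₁),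
    InAdd P Q₁ ∧ InAdd P Q₀ ∧ T.Realizes i p δ := by
  obtain ⟨Q₁, Q₀, i, p, h1, h0, δ, h⟩ := hA.resolution X
  exact ⟨Q₁, Q₀, i, p, δ, (hP _).1 h1, (hP _).1 h0, h⟩

/-- The functor `C(P, -)` is full. -/
lemma exists_map_eq {X Y : C} (φ : (homFunctor P).obj X ⟶ (homFunctor P).obj Y) :
    ∃ f, (homFunctor P).map f = φ := by
  obtain ⟨Q₁, Q₀, i, p, δ, h1, h0, h⟩ := exists_resolution hA hP X
  obtain ⟨g, hg⟩ := exists_map_eq_of_inAdd h0 ((homFunctor P).map p ≫ φ)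
  have hig : i ≫ g = 0 := by
    refine eq_of_inAdd h1 ?_
    rw [Functor.map_comp, hg, ← Functor.map_comp_assoc, h.comp_eq_zero, Functor.map_zero,
      zero_comp, Functor.map_zero]
  obtain ⟨l, rfl⟩ := h.desc g hig
  refine ⟨l, homFunctor_hom_ext fun x => ?_⟩
  obtain ⟨y, rfl⟩ := h.surjective_map hP.projective_self x
  exact LinearMap.congr_fun (congrArg ModuleCat.Hom.hom
    ((Functor.map_comp (homFunctor P) p l).symm.trans hg)) y

omit hA in
lemma isZero_obj_of_isSuspension {X J : C} (h : T.IsSuspension X J) :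
    IsZero ((homFunctor P).obj J) := by
  obtain ⟨O, a, b, hO, δ, h⟩ := h
  refine (IsZero.iff_id_eq_zero _).2 (homFunctor_hom_ext fun g => ?_)
  obtain ⟨l, hl⟩ := h.surjective_map hP.projective_self g
  have h0 : ∀ l : P ⟶ O, l ≫ b = 0 := fun l => by rw [hO.eq_of_src b 0, comp_zero]
  exact hl.symm.trans (h0 l)

lemma isZero_obj_of_injective {J : C} (hJ : T.Injective J) : IsZero ((homFunctor P).obj J) := by
  obtain ⟨W, hW⟩ := exists_desuspension hA hJ
  exact isZero_obj_of_isSuspension hP hW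

/-- A morphism that vanishes under `C(P, -)` factors through an injective object: in the rotated
resolution `P₀ ⟶ X ⟶ ΣP₁` it vanishes on `P₀`. -/
lemma exists_factorization_of_map_eq_zero {X Y : C} {f : X ⟶ Y} (h : (homFunctor P).map f = 0) :
    ∃ (J : C) (j : X ⟶ J) (l : J ⟶ Y), T.Injective J ∧ j ≫ l = f := by
  obtain ⟨Q₁, Q₀, i, p, δ, h1, h0, hδ⟩ := exists_resolution hA hP X
  obtain ⟨S, hS⟩ := exists_suspension hA (hP.projective h1)
  obtain ⟨O, a, b, hO, ε, hε⟩ := id hS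
  obtain ⟨q, μ, hq⟩ := hδ.exists_rotate_right hε hO
  have hpf : p ≫ f = 0 := by
    refine eq_of_inAdd h0 ?_
    rw [Functor.map_comp, h, comp_zero, Functor.map_zero]
  obtain ⟨l, hl⟩ := hq.desc f hpf
  exact ⟨S, q, l, hS.injective hA, hl⟩

lemma map_eq_zero_of_factorization {X Y J : C} (hJ : T.Injective J) (j : X ⟶ J) (l : J ⟶ Y) :
    (homFunctor P).map (j ≫ l) = 0 := by
  rw [Functor.map_comp, (isZero_obj_of_injective hA hP hJ).eq_of_tgt ((homFunctor P).map j) 0,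
    zero_comp]

/-- The identity of `X` is killed by `C(P, -)`, so it factors through an injective object. -/
lemma injective_of_isZero_obj {X : C} (h : IsZero ((homFunctor P).obj X)) : T.Injective X := by
  obtain ⟨J, j, l, hJ, hjl⟩ := exists_factorization_of_map_eq_zero hA hP (f := 𝟙 X)
    (h.eq_of_src _ _)
  exact hJ.of_retract ⟨j, l, hjl⟩

section Conservative

variable [IsIdempotentComplete C] [FittingCategory C]

omit hA hP in
lemma NoInjectiveSummand.isRadical {X J : C} (hX : T.NoInjectiveSummand X) (hJ : T.Injective J)
    (f : X ⟶ J) : IsRadical f :=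
  isRadical_of_no_common_retract (fun Y ⟨ρ⟩ ⟨ρ'⟩ =>
    hX Y (isSummand_of_retract ρ) (hJ.of_retract ρ')) f

omit hA hP in
lemma NoInjectiveSummand.isRadical' {X J : C} (hX : T.NoInjectiveSummand X) (hJ : T.Injective J)
    (f : J ⟶ X) : IsRadical f :=
  isRadical_of_no_common_retract (fun Y ⟨ρ⟩ ⟨ρ'⟩ =>
    hX Y (isSummand_of_retract ρ') (hJ.of_retract ρ)) f

omit hA hP in
lemma NoInjectiveSummand.of_isSummand {X Y : C} (hX : T.NoInjectiveSummand X)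
    (h : IsSummand Y X) : T.NoInjectiveSummand Y := fun W hW hI => hX W (hW.trans h) hI

omit hA hP in
lemma NoInjectiveSummand.biprod {X Y : C} (hX : T.NoInjectiveSummand X)
    (hY : T.NoInjectiveSummand Y) : T.NoInjectiveSummand (X ⊞ Y) := by
  intro W hW hI
  obtain ⟨ρ⟩ := hW.retract
  refine IsRadical.isZero ?_
  have : 𝟙 W = ρ.i ≫ biprod.fst ≫ biprod.inl ≫ ρ.r + ρ.i ≫ biprod.snd ≫ biprod.inr ≫ ρ.r := by
    rw [← ρ.retract]
    conv_lhs => rw [← Category.id_comp ρ.r, ← biprod.total]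
    simp only [Preadditive.add_comp, Preadditive.comp_add, Category.assoc]
  rw [this]
  refine IsRadical.add ?_ ?_
  · rw [← Category.assoc]
    exact (hX.isRadical' hI _).comp_right _
  · rw [← Category.assoc]
    exact (hY.isRadical' hI _).comp_right _

omit hA hP in
lemma NoInjectiveSummand.inAdd {X U : C} (hU : T.NoInjectiveSummand U) (h : InAdd U X) :
    T.NoInjectiveSummand X := by
  intro W hW hI
  obtain ⟨n, s, r, hsr⟩ := (h.of_isSummand hW).exists_sum
  refine IsRadical.isZero ?_
  rw [← hsr]
  exact IsRadical.sum _ _ fun i _ => (hU.isRadical' hI (s i)).comp_right _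

lemma NoInjectiveSummand.of_inAdd {Q : C} (hQ : InAdd P Q) : T.NoInjectiveSummand Q :=
  fun W hW hI => hA.reduced W (hP.projective (hQ.of_isSummand hW)) hI

lemma NoInjectiveSummand.isIso_of_map_eq_id {X : C} (hX : T.NoInjectiveSummand X) {f : X ⟶ X}
    (h : (homFunctor P).map f = 𝟙 _) : IsIso f := by
  obtain ⟨J, j, l, hJ, hjl⟩ := exists_factorization_of_map_eq_zero hA hP (f := f - 𝟙 X)
    (by rw [Functor.map_sub, h, CategoryTheory.Functor.map_id, sub_self])
  have : IsRadical (f - 𝟙 X) := by rw [← hjl]; exact (hX.isRadical hJ j).comp_right l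
  have := this.isIso_add
  rwa [add_sub_cancel] at this

lemma NoInjectiveSummand.exists_retract {X Y : C} (hX : T.NoInjectiveSummand X)
    (ρ : Retract ((homFunctor P).obj X) ((homFunctor P).obj Y)) :
    ∃ σ : Retract X Y, (homFunctor P).map σ.i = ρ.i := by
  obtain ⟨s, hs⟩ := exists_map_eq hA hP ρ.i
  obtain ⟨r, hr⟩ := exists_map_eq hA hP ρ.r
  have := hX.isIso_of_map_eq_id hA hP (f := s ≫ r) (by rw [Functor.map_comp, hs, hr, ρ.retract])
  exact ⟨⟨s, r ≫ inv (s ≫ r), by rw [← Category.assoc, IsIso.hom_inv_id]⟩, hs⟩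

lemma NoInjectiveSummand.isIso_of_isIso_map {X Y : C} (hX : T.NoInjectiveSummand X)
    (hY : T.NoInjectiveSummand Y) (f : X ⟶ Y) [IsIso ((homFunctor P).map f)] : IsIso f := by
  obtain ⟨g, hg⟩ := exists_map_eq hA hP (inv ((homFunctor P).map f))
  have := hX.isIso_of_map_eq_id hA hP (f := f ≫ g)
    (by rw [Functor.map_comp, hg, IsIso.hom_inv_id])
  have := hY.isIso_of_map_eq_id hA hP (f := g ≫ f)
    (by rw [Functor.map_comp, hg, IsIso.inv_hom_id])
  exact isIso_of_comp_isIso f g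

lemma NoInjectiveSummand.exists_iso {X Y : C} (hX : T.NoInjectiveSummand X)
    (hY : T.NoInjectiveSummand Y) (e : (homFunctor P).obj X ≅ (homFunctor P).obj Y) :
    ∃ φ : X ≅ Y, (homFunctor P).map φ.hom = e.hom := by
  obtain ⟨f, hf⟩ := exists_map_eq hA hP e.hom
  have : IsIso ((homFunctor P).map f) := by rw [hf]; infer_instance
  have := hX.isIso_of_isIso_map hA hP hY f
  exact ⟨asIso f, hf⟩

/-- Idempotents lift along `C(P, -)`: the Fitting idempotent of a lift of `e` is a lift of `e`. -/
lemma exists_idempotent_lift {X : C} (e : (homFunctor P).obj X ⟶ (homFunctor P).obj X)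
    (he : e ≫ e = e) : ∃ e' : X ⟶ X, e' ≫ e' = e' ∧ (homFunctor P).map e' = e := by
  obtain ⟨f, hf⟩ := exists_map_eq hA hP e
  let F : End X := f
  obtain ⟨e', g, he', -, hgf, n, -, hn⟩ := FittingCategory.fitting F
  let u : X ⟶ X := e'
  refine ⟨u, he', ?_⟩
  -- products in `End X` are compositions in the opposite order
  have h1 : f ≫ g = u := hgf
  have hn' : (F ^ n : End X) ≫ (𝟙 X - u) = 0 := hn
  have hpow : ∀ n : ℕ, e ≫ (homFunctor P).map (F ^ n : End X) = e := by
    intro n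
    induction n with
    | zero =>
      exact (congrArg (e ≫ ·) (CategoryTheory.Functor.map_id _ X)).trans (Category.comp_id e)
    | succ n ih =>
      have : (F ^ (n + 1) : End X) = f ≫ (F ^ n : End X) := pow_succ F n
      rw [this, Functor.map_comp, hf, ← Category.assoc, he, ih]
  have h3 : e ≫ (homFunctor P).map u = e := by
    have := congrArg (fun x => e ≫ (homFunctor P).map x) hn'
    simp only [Functor.map_comp, Functor.map_zero, comp_zero] at this
    rw [← Category.assoc, hpow, Functor.map_sub, CategoryTheory.Functor.map_id,
      Preadditive.comp_sub, Category.comp_id, sub_eq_zero] at this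
    exact this.symm
  calc (homFunctor P).map u = e ≫ (homFunctor P).map g := by rw [← h1, Functor.map_comp, hf]
    _ = e ≫ e ≫ (homFunctor P).map g := by rw [← Category.assoc, he]
    _ = e := by rw [← hf, ← Functor.map_comp, h1, hf, h3]

/-- Summands of `C(P, X)` come from summands of `X`. -/
lemma exists_isSummand_of_retract {X : C} {M : ModuleCat.{v} (End P)ᵐᵒᵖ}
    (ρ : Retract M ((homFunctor P).obj X)) :
    ∃ Y : C, IsSummand Y X ∧ Nonempty ((homFunctor P).obj Y ≅ M) := by
  obtain ⟨e', he', hm⟩ := exists_idempotent_lift hA hP (ρ.r ≫ ρ.i) (by simp)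
  obtain ⟨Y, s, r, hsr, hrs⟩ := IsIdempotentComplete.idempotents_split X e' he'
  refine ⟨Y, isSummand_of_retract ⟨s, r, hsr⟩,
    ⟨⟨(homFunctor P).map s ≫ ρ.r, ρ.i ≫ (homFunctor P).map r, ?_, ?_⟩⟩⟩
  · rw [Category.assoc, ← Category.assoc ρ.r, ← hm, ← Functor.map_comp, ← Functor.map_comp, ← hrs,
      Category.assoc, hsr, Category.comp_id, hsr, CategoryTheory.Functor.map_id]
  · rw [Category.assoc, ← Functor.map_comp_assoc, hrs, hm, Category.assoc]
    simp

lemma exists_inAdd_of_inAdd {U : C} {M : ModuleCat.{v} (End P)ᵐᵒᵖ}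
    (h : InAdd ((homFunctor P).obj U) M) :
    ∃ Y : C, InAdd U Y ∧ Nonempty ((homFunctor P).obj Y ≅ M) := by
  obtain ⟨n, ⟨ρ⟩⟩ := exists_retract_of_inAdd h
  obtain ⟨Y, hY, e⟩ := exists_isSummand_of_retract hA hP ρ
  exact ⟨Y, ⟨n, hY⟩, e⟩

lemma NoInjectiveSummand.indecomposable_obj {X : C} (hX : T.NoInjectiveSummand X)
    (h : Indecomposable X) : Indecomposable ((homFunctor P).obj X) := by
  refine ⟨fun h0 => h.1 (hX X (isSummand_self X) (injective_of_isZero_obj hA hP h0)), ?_⟩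
  intro M N a
  obtain ⟨e', he', hm⟩ := exists_idempotent_lift hA hP
    (a.hom ≫ biprod.fst ≫ biprod.inl ≫ a.inv) (by simp)
  obtain ⟨Y, s, r, hsr, hrs⟩ := IsIdempotentComplete.idempotents_split X e' he'
  obtain ⟨W, φ, hφ1, hφ2⟩ := exists_iso_biprod_of_retract s r hsr
  rcases h.2 _ _ φ with h0 | h0
  · left
    have he : e' = 0 := by rw [← hrs, h0.eq_of_src s 0, comp_zero]
    rw [he, Functor.map_zero] at hm
    refine (IsZero.iff_id_eq_zero M).2 ?_
    calc 𝟙 M = biprod.inl ≫ a.inv ≫ (a.hom ≫ biprod.fst ≫ biprod.inl ≫ a.inv) ≫ a.hom ≫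
          biprod.fst := by simp
      _ = 0 := by rw [← hm]; simp
  · right
    have he : e' = 𝟙 X := by
      have h1 : φ.hom ≫ biprod.fst ≫ biprod.inl = φ.hom := by
        conv_rhs => rw [← Category.comp_id φ.hom, ← biprod.total, Preadditive.comp_add,
          h0.eq_of_tgt biprod.snd 0, zero_comp, comp_zero, add_zero]
      rw [← hrs, ← hφ1, ← hφ2, Category.assoc, ← Category.assoc biprod.fst, ← Category.assoc, h1,
        Iso.hom_inv_id]
    rw [he, CategoryTheory.Functor.map_id] at hm
    refine (IsZero.iff_id_eq_zero N).2 ?_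
    calc 𝟙 N = biprod.inr ≫ a.inv ≫ 𝟙 _ ≫ a.hom ≫ biprod.snd := by simp
      _ = 0 := by rw [hm]; simp

lemma NoInjectiveSummand.indecomposable_of_obj {X : C} (hX : T.NoInjectiveSummand X)
    (h : Indecomposable ((homFunctor P).obj X)) : Indecomposable X := by
  refine ⟨fun h0 => h.1 (Functor.map_isZero (homFunctor P) h0), fun Y Z a => ?_⟩
  refine (h.2 _ _ (((homFunctor P).mapIso a).trans (homFunctorBiprod P Y Z))).imp
    (fun h0 => ?_) fun h0 => ?_
  · exact hX Y ⟨Z, ⟨a⟩⟩ (injective_of_isZero_obj hA hP h0)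
  · exact hX Z ((isSummand_right Y Z).of_iso a.symm) (injective_of_isZero_obj hA hP h0)

/-- Every indecomposable summand of `C(P, X)` is the image of one of `X`. -/
lemma NoInjectiveSummand.exists_indSummand {X : C} (hX : T.NoInjectiveSummand X)
    (M : IndSummand ((homFunctor P).obj X)) :
    ∃ Y : IndSummand X, Nonempty ((homFunctor P).obj Y.1 ≅ M.1) := by
  obtain ⟨Y, hY, ⟨e⟩⟩ := exists_isSummand_of_retract hA hP M.2.2.retract.some
  exact ⟨⟨Y, (hX.of_isSummand hY).indecomposable_of_obj hA hP
    (indecomposable_of_iso M.2.1 e.symm), hY⟩, ⟨e⟩⟩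

lemma isSummand_map {X Y : C} (h : IsSummand Y X) :
    IsSummand ((homFunctor P).obj Y) ((homFunctor P).obj X) :=
  isSummand_of_retract (h.retract.some.map (homFunctor P))

/-- If `X` has no injective summands, then `ind X` corresponds to `ind C(P, X)`. -/
lemma NoInjectiveSummand.exists_indClass_equiv {X : C} (hX : T.NoInjectiveSummand X) :
    ∃ h : IndClass X ≃ IndClass ((homFunctor P).obj X), ∀ Y M,
      h (cls Y) = cls M ↔ Nonempty ((homFunctor P).obj Y.1 ≅ M.1) := by
  refine ZeroAuslander.exists_indClass_equiv
    (fun Y M => Nonempty ((homFunctor P).obj Y.1 ≅ M.1)) (fun Y => ?_)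
    (fun M => hX.exists_indSummand hA hP M) (fun Y Y' M M' ⟨e⟩ ⟨e'⟩ => ?_)
    fun Y M M' ⟨e⟩ ⟨e'⟩ => ⟨e.trans e'⟩
  · exact ⟨⟨(homFunctor P).obj Y.1, (hX.of_isSummand Y.2.2).indecomposable_obj hA hP Y.2.1,
      isSummand_map hA hP Y.2.2⟩, ⟨Iso.refl _⟩⟩
  · refine ⟨fun ⟨f⟩ => ⟨e.symm.trans (((homFunctor P).mapIso f).trans e')⟩, fun ⟨f⟩ => ?_⟩
    obtain ⟨φ, -⟩ := (hX.of_isSummand Y.2.2).exists_iso hA hP (hX.of_isSummand Y'.2.2)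
      (e.trans (f.trans e'.symm))
    exact ⟨φ⟩

end Conservative

end Ideal

end HomFunctor

end Extriangulated

/-! ### Projective presentations and Ext-projective modules -/

namespace Extriangulated

section Presentations

variable {C : Type u} [Category.{v} C] [Preadditive C] [HasZeroObject C]
  [HasBinaryBiproducts C] [HasFiniteBiproducts C] {T : Extriangulated.{w} C} {P : C}

/-- Finitely generated modules are quotients of modules `C(P, Q)` with `Q` in `add P`. -/
lemma exists_cover [IsIdempotentComplete C] (M : Type v) [AddCommGroup M] [Module (End P)ᵐᵒᵖ M]
    [Module.Finite (End P)ᵐᵒᵖ M] :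
    ∃ (Q : C) (π : (homFunctor P).obj Q →ₗ[(End P)ᵐᵒᵖ] M), InAdd P Q ∧ Function.Surjective π := by
  obtain ⟨n, m, hm⟩ := Module.Finite.exists_fin (R := (End P)ᵐᵒᵖ) (M := M)
  let F : Fin n → C := fun _ => P
  let π : (homFunctor P).obj (⨁ F) →ₗ[(End P)ᵐᵒᵖ] M := ∑ j,
    LinearMap.toSpanSingleton (End P)ᵐᵒᵖ M (m j) ∘ₗ (regularIso P).inv.hom ∘ₗ
      ((homFunctor P).map (biproduct.π F j)).hom
  refine ⟨⨁ F, π, InAdd.biproduct fun _ => inAdd_self P, LinearMap.range_eq_top.1 ?_⟩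
  rw [eq_top_iff, ← hm, Submodule.span_le]
  rintro _ ⟨j, rfl⟩
  let x : (homFunctor P).obj (⨁ F) := biproduct.ι F j
  refine ⟨x, ?_⟩
  rw [LinearMap.sum_apply, Finset.sum_eq_single j]
  · have h1 : biproduct.ι F j ≫ biproduct.π F j = 𝟙 P := biproduct.ι_π_self F j
    refine Eq.trans ?_ (one_smul (End P)ᵐᵒᵖ (m j))
    exact congrArg (fun a : End P => MulOpposite.op a • m j) h1
  · intro i _ hi
    have h1 : biproduct.ι F j ≫ biproduct.π F i = 0 := biproduct.ι_π_ne F hi.symm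
    refine Eq.trans ?_ (zero_smul (End P)ᵐᵒᵖ (m i))
    exact congrArg (fun a : End P => MulOpposite.op a • m i) h1
  · simp

variable (hA : T.IsReducedZeroAuslander) (hP : T.IsProjectiveGenerator P)
include hA hP

omit hA in
/-- Morphisms `Q₁ ⟶ Y` extend along the first map of a projective resolution of `X` if and only if
`𝔼(X, Y)` vanishes. -/
lemma Realizes.extends_iff {X Y Q₁ Q₀ : C} {i : Q₁ ⟶ Q₀} {p : Q₀ ⟶ X} {δ : Extn T.E X Q₁}
    (h : T.Realizes i p δ) (h1 : InAdd P Q₁) (h0 : InAdd P Q₀) :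
    Extends ((homFunctor P).map i) ((homFunctor P).obj Y) ↔ T.ExtVanishes X Y := by
  constructor
  · intro hext θ
    obtain ⟨g, rfl⟩ := h.exists_push_eq θ (hP.extVanishes h0 _ _)
    obtain ⟨l, hl⟩ := hext ((homFunctor P).map g)
    obtain ⟨l', rfl⟩ := exists_map_eq_of_inAdd h0 l
    rw [h.push_eq_zero_iff]
    exact ⟨l', eq_of_inAdd h1 (by rw [Functor.map_comp, hl])⟩
  · intro hE φ
    obtain ⟨g, rfl⟩ := exists_map_eq_of_inAdd h1 φ
    obtain ⟨l, rfl⟩ := (h.push_eq_zero_iff g).1 (hE _)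
    exact ⟨(homFunctor P).map l, by rw [Functor.map_comp]⟩

/-- Classes in `𝔼(X, Y)` come from morphisms `Q₁ ⟶ Y` on a resolution of `X`, and these lift
to `V`. -/
lemma extVanishes_of_surjective {X V Y : C} (f : V ⟶ Y)
    (hf : Function.Surjective ((homFunctor P).map f).hom) (h : T.ExtVanishes X V) :
    T.ExtVanishes X Y := fun θ => by
  obtain ⟨Q₁, Q₀, i, p, δ, h1, h0, hδ⟩ := exists_resolution hA hP X
  obtain ⟨g, rfl⟩ := hδ.exists_push_eq θ (hP.extVanishes h0 _ _)
  obtain ⟨t, rfl⟩ := exists_lift_of_range h1 g f fun x => hf (x ≫ g : P ⟶ Y)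
  rw [push_comp, h (push T.E t δ), push_zero]

omit hA in
lemma subsingleton_ext_of_extVanishes (hA : T.IsReducedZeroAuslander) {X Y : C}
    {M N : ModuleCat.{v} (End P)ᵐᵒᵖ}
    (h : T.ExtVanishes X Y) (eX : (homFunctor P).obj X ≅ M) (eY : (homFunctor P).obj Y ≅ N) :
    Subsingleton (Abelian.Ext M N 1) := by
  obtain ⟨Q₁, Q₀, i, p, δ, h1, h0, hδ⟩ := exists_resolution hA hP X
  have hpr : CategoryTheory.Projective ((homFunctor P).obj Q₀) :=
    (IsProjective.iff_projective ((homFunctor P).obj Q₀)).1 (projective_obj h0)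
  refine subsingleton_ext_of_retract (X := (homFunctor P).obj X) ⟨eX.inv, eX.hom, by simp⟩
    (subsingleton_ext_of_extends ((homFunctor P).map i) ((homFunctor P).map p)
      (hδ.surjective_map hP.projective_self) hδ.exact_map fun g => ?_)
  obtain ⟨l, hl⟩ := (hδ.extends_iff hP h1 h0).2 h (g ≫ eY.inv)
  exact ⟨l ≫ eY.hom, by rw [← Category.assoc, hl]; simp⟩

/-- If `X` has no injective summands, the first map of every resolution of `X` is right minimal: an
endomorphism `h` of `Q₁` with `h ≫ i = 0` induces on `ΣQ₁` an endomorphism that factors through `X`,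
and this is radical since `ΣQ₁` is injective. -/
lemma exists_minimal_resolution_aux {X Q₁ Q₀ : C} {i : Q₁ ⟶ Q₀} {p : Q₀ ⟶ X} {δ : Extn T.E X Q₁}
    (hδ : T.Realizes i p δ) (h1 : InAdd P Q₁) [IsIdempotentComplete C] [FittingCategory C]
    (hX : T.NoInjectiveSummand X) {h : Q₁ ⟶ Q₁} (hi : h ≫ i = 0) : IsRadical h := by
  suffices key : ∀ h : Q₁ ⟶ Q₁, h ≫ i = 0 → IsIso (𝟙 Q₁ - h) by
    intro g
    have := key (g ≫ h) (by rw [Category.assoc, hi, comp_zero])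
    exact isIso_id_sub_comp_symm h g
  clear h hi
  intro h hi
  obtain ⟨S, hS⟩ := exists_suspension hA (hP.projective h1)
  obtain ⟨O, a, b, hO, ε, hε⟩ := id hS
  obtain ⟨g, hg⟩ := hδ.exists_pull_eq (push T.E h ε) (by rw [← push_comp, hi, push_hom_zero])
  obtain ⟨q, hq⟩ := hε.exists_pull_eq δ (ExtVanishes.of_isZero_right hO _)
  have := ((hX.isRadical' (hS.injective hA) g).comp_right q).isIso_sub
  obtain ⟨e, -, he⟩ := hε.exists_iso_left hε (Iso.refl O) (asIso (𝟙 S - g ≫ q))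
    (hO.eq_of_src _ _)
  have h2 : push T.E (𝟙 Q₁ - h - e.hom) ε = 0 := by
    rw [push_hom_sub, he, push_hom_sub, asIso_hom, pull_hom_sub, push_id, pull_id, pull_comp, hq, hg,
      sub_self]
  obtain ⟨l, hl⟩ := (hε.push_eq_zero_iff _).1 h2
  rw [hO.eq_of_src l 0, comp_zero] at hl
  rw [sub_eq_zero.1 hl.symm]
  infer_instance

section HomFinite

variable (k : Type*) [Field k] [Linear k C] (homFinite : ∀ X Y : C, Module.Finite k (X ⟶ Y))
  [IsIdempotentComplete C]
include homFinite

/-- `C(P, -)` is dense on finitely generated modules: a projective presentation lifts to an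
inflation between projective objects. -/
lemma exists_obj_iso (M : ModuleCat.{v} (End P)ᵐᵒᵖ) [Module.Finite (End P)ᵐᵒᵖ M] :
    ∃ X, Nonempty ((homFunctor P).obj X ≅ M) := by
  obtain ⟨Q₀, π, h0, hπ⟩ := exists_cover (P := P) M
  have := isNoetherianRing_end (P := P) k homFinite
  have := finite_obj (P := P) k homFinite Q₀
  have : IsNoetherian (End P)ᵐᵒᵖ ((homFunctor P).obj Q₀) :=
    isNoetherian_of_isNoetherianRing_of_finite _ _
  obtain ⟨Q₁, π', h1, hπ'⟩ := exists_cover (P := P) (LinearMap.ker π)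
  obtain ⟨i, hi⟩ := exists_map_eq_of_inAdd h1 (Y := Q₀)
    (ModuleCat.ofHom ((LinearMap.ker π).subtype ∘ₗ π'))
  obtain ⟨S, hS⟩ := exists_suspension hA (hP.projective h1)
  obtain ⟨X, p, δ, hδ⟩ := hS.inflation i
  obtain ⟨e, -⟩ := isIso_map_desc hδ.exact_map (hδ.surjective_map hP.projective_self)
    (g' := ModuleCat.ofHom π) (L' := M) (by
      rw [hi]
      intro x
      refine ⟨fun hx => ?_, ?_⟩
      · obtain ⟨y, hy⟩ := hπ' ⟨x, hx⟩
        exact ⟨y, congrArg Subtype.val hy⟩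
      · rintro ⟨y, rfl⟩
        exact (π' y).2) hπ
  exact ⟨X, ⟨e⟩⟩

lemma exists_injective_splitting (X : C) : ∃ X' J : C, Nonempty (X ≅ X' ⊞ J) ∧ T.Injective J ∧
    T.NoInjectiveSummand X' :=
  exists_maximal_splitting k homFinite (fun J => T.Injective J) (fun _ => injective_of_isZero)
    (fun _ _ => Injective.biprod) X

lemma exists_noInjectiveSummand_iso (M : ModuleCat.{v} (End P)ᵐᵒᵖ) [Module.Finite (End P)ᵐᵒᵖ M] :
    ∃ X, T.NoInjectiveSummand X ∧ Nonempty ((homFunctor P).obj X ≅ M) := by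
  obtain ⟨X, ⟨e⟩⟩ := exists_obj_iso hA hP k homFinite M
  obtain ⟨X', J, ⟨φ⟩, hJ, hX'⟩ := exists_injective_splitting hA hP k homFinite X
  exact ⟨X', hX', ⟨(isoBiprodZeroRight _ (isZero_obj_of_injective hA hP hJ)).trans
    ((homFunctorBiprod P X' J).symm.trans (((homFunctor P).mapIso φ.symm).trans e))⟩⟩

/-- The finitely generated projective modules are the modules `C(P, Q)` with `Q` in `add P`. -/
lemma exists_inAdd_iso (M : ModuleCat.{v} (End P)ᵐᵒᵖ) [Module.Finite (End P)ᵐᵒᵖ M]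
    [Module.Projective (End P)ᵐᵒᵖ M] :
    ∃ Q, InAdd P Q ∧ Nonempty ((homFunctor P).obj Q ≅ M) := by
  have := fittingCategory_of_finite k homFinite
  obtain ⟨Q, π, h, hπ⟩ := exists_cover (P := P) M
  obtain ⟨s, hs⟩ := π.exists_rightInverse_of_surjective (LinearMap.range_eq_top.2 hπ)
  obtain ⟨Y, hY, e⟩ := exists_isSummand_of_retract hA hP
    (X := Q) (M := M) ⟨ModuleCat.ofHom s, ModuleCat.ofHom π, ModuleCat.hom_ext hs⟩
  exact ⟨Y, h.of_isSummand hY, e⟩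

omit hA hP in
/-- A right minimal morphism out of an object of `add P` becomes a projective cover of its image: if
a submodule `L` of `C(P, Q)` has full image under `f`, then a cover `t` of `L` satisfies
`s ≫ t ≫ f = f` for some `s`, so `s ≫ t` is invertible and `L` is everything. -/
lemma isSuperfluous_ker {Q Y : C} (f : Q ⟶ Y) (hQ : InAdd P Q)
    (hf : ∀ h : Q ⟶ Q, h ≫ f = f → IsIso h) :
    IsSuperfluous (End P)ᵐᵒᵖ (LinearMap.ker ((homFunctor P).map f).hom) := by
  intro L hL
  have := isNoetherianRing_end (P := P) k homFinite
  have := finite_obj (P := P) k homFinite Q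
  have : IsNoetherian (End P)ᵐᵒᵖ ((homFunctor P).obj Q) :=
    isNoetherian_of_isNoetherianRing_of_finite _ _
  obtain ⟨W, π, hW, hπ⟩ := exists_cover (P := P) L
  obtain ⟨t, ht⟩ := exists_map_eq_of_inAdd hW (Y := Q) (ModuleCat.ofHom (L.subtype ∘ₗ π))
  have ht' : ∀ w, ((homFunctor P).map t).hom w = (π w : (homFunctor P).obj Q) := fun w =>
    LinearMap.congr_fun (congrArg ModuleCat.Hom.hom ht) w
  obtain ⟨s, hs⟩ := exists_lift_of_range hQ f (t ≫ f) fun g => by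
    let g' : (homFunctor P).obj Q := g
    have hg : g' ∈ L ⊔ LinearMap.ker ((homFunctor P).map f).hom := by
      rw [hL]; trivial
    obtain ⟨l, hl, κ, hκ, hlκ⟩ := Submodule.mem_sup.1 hg
    obtain ⟨x, hx⟩ := hπ ⟨l, hl⟩
    refine ⟨x, ?_⟩
    have h1 : ((homFunctor P).map t).hom x = l := by rw [ht', hx]
    have h2 : ((homFunctor P).map f).hom (((homFunctor P).map t).hom x) =
        ((homFunctor P).map f).hom g' := by
      rw [h1]
      refine Eq.trans ?_ (congrArg _ hlκ)
      rw [map_add, LinearMap.mem_ker.1 hκ, add_zero]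
    exact (Category.assoc _ _ _).symm.trans h2
  have := hf (s ≫ t) (by rw [Category.assoc, hs])
  refine eq_top_iff.2 fun x _ => ?_
  have h3 : ((homFunctor P).map t).hom
      ((((homFunctor P).map (inv (s ≫ t) ≫ s)).hom x)) = x := by
    change ((homFunctor P).map (inv (s ≫ t) ≫ s) ≫ (homFunctor P).map t).hom x = x
    rw [← Functor.map_comp, Category.assoc, IsIso.inv_hom_id, CategoryTheory.Functor.map_id]
    rfl
  rw [← h3, ht']
  exact (π _).2

variable [FittingCategory C]

/-- An object without injective summands has a resolution that `C(P, -)` sends to a minimal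
projective presentation. -/
lemma NoInjectiveSummand.exists_minimal_resolution {X : C} (hX : T.NoInjectiveSummand X) :
    ∃ (Q₁ Q₀ : C) (i : Q₁ ⟶ Q₀) (p : Q₀ ⟶ X) (δ : Extn T.E X Q₁), InAdd P Q₁ ∧ InAdd P Q₀ ∧
      T.Realizes i p δ ∧ (∀ h : Q₁ ⟶ Q₁, h ≫ i = 0 → IsRadical h) ∧
      ∃ q : MinProjPresentation (End P)ᵐᵒᵖ ((homFunctor P).obj X),
        ∀ N, Extends ((homFunctor P).map i) N → Extends q.d N := by
  obtain ⟨Q₀, p, hp⟩ := exists_isMinRightApprox k homFinite P X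
  obtain ⟨R₁, R₀, j, r, μ, hR1, hR0, hμ⟩ := exists_resolution hA hP X
  have hr : IsRightApprox P r := ⟨hR0, fun W g hW => hP.projective hW r ⟨_, _, _, hμ⟩ g⟩
  obtain ⟨Q₁, i, δ, hδ⟩ := deflation_of_isMinRightApprox hp hr ⟨_, _, _, hμ⟩
  have h1 : InAdd P Q₁ := (hP _).1 (projective_of_extVanishes fun Y =>
    hδ.extVanishes_left hA (hP.extVanishes hp.1.1 Y))
  have hrad : ∀ h : Q₁ ⟶ Q₁, h ≫ i = 0 → IsRadical h := fun h hi =>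
    exists_minimal_resolution_aux hA hP hδ h1 hX hi
  refine ⟨Q₁, Q₀, i, p, δ, h1, hp.1.1, hδ, hrad,
    { P₁ := (homFunctor P).obj Q₁
      P₀ := (homFunctor P).obj Q₀
      d := (homFunctor P).map i
      p := (homFunctor P).map p
      finite₁ := finite_obj k homFinite Q₁
      finite₀ := finite_obj k homFinite Q₀
      projective₁ := projective_obj h1
      projective₀ := projective_obj hp.1.1
      surjective := hδ.surjective_map hP.projective_self
      exact := hδ.exact_map.linearMap_ker_eq.symm
      minimal₀ := isSuperfluous_ker k homFinite p hp.1.1 hp.2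
      minimal₁ := isSuperfluous_ker k homFinite i h1 fun h hi => ?_ }, fun N hN => hN⟩
  have := (hrad (𝟙 Q₁ - h) (by rw [Preadditive.sub_comp, hi, Category.id_comp, sub_self])).isIso_sub
  rwa [sub_sub_cancel] at this

/-- `Hom(C(P, Y), τ C(P, X))` vanishes if and only if `𝔼(X, Y)` does. -/
lemma NoInjectiveSummand.homTauVanishes_iff {X Y : C} {M N : ModuleCat.{v} (End P)ᵐᵒᵖ}
    (hX : T.NoInjectiveSummand X) (eX : (homFunctor P).obj X ≅ M)
    (eY : (homFunctor P).obj Y ≅ N) : HomTauVanishes k N M ↔ T.ExtVanishes X Y := by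
  rw [ZeroAuslander.homTauVanishes_iff]
  constructor
  · rintro ⟨p, hp⟩
    have := p.finite₁
    have := p.finite₀
    have := p.projective₁
    have := p.projective₀
    obtain ⟨Q₁, h1, ⟨e1⟩⟩ := exists_inAdd_iso hA hP k homFinite p.P₁
    obtain ⟨Q₀, h0, ⟨e0⟩⟩ := exists_inAdd_iso hA hP k homFinite p.P₀
    -- the presentation lifts to a conflation `Q₁ ⟶ Q₀ ⟶ W`, and `C(P, W) ≅ M` makes `X` a retract
    -- of `W`
    obtain ⟨i, hi⟩ := exists_map_eq_of_inAdd h1 (e1.hom ≫ p.d ≫ e0.inv)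
    obtain ⟨S, hS⟩ := exists_suspension hA (hP.projective h1)
    obtain ⟨W, q, δ, hδ⟩ := hS.inflation i
    have hex : Function.Exact ((homFunctor P).map i).hom (e0.hom ≫ p.p).hom := by
      intro x
      have h2 : e0.hom.hom x ∈ LinearMap.range p.d.hom ↔ p.p.hom (e0.hom.hom x) = 0 := by
        rw [p.exact, LinearMap.mem_ker]
      refine h2.symm.trans ⟨?_, ?_⟩
      · rintro ⟨y, hy⟩
        refine ⟨e1.inv.hom y, ?_⟩
        have : (e1.inv ≫ (homFunctor P).map i).hom y = (p.d ≫ e0.inv).hom y := by rw [hi]; simp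
        refine this.trans ?_
        change e0.inv.hom (p.d.hom y) = x
        rw [hy]
        exact LinearMap.congr_fun (congrArg ModuleCat.Hom.hom e0.hom_inv_id) x
      · rintro ⟨y, rfl⟩
        refine ⟨e1.hom.hom y, ?_⟩
        have : (e1.hom ≫ p.d).hom y = ((homFunctor P).map i ≫ e0.hom).hom y := by rw [hi]; simp
        exact this
    have hsurj : Function.Surjective (e0.hom ≫ p.p).hom :=
      p.surjective.comp (e0.toLinearEquiv.surjective)
    obtain ⟨e, -⟩ := isIso_map_desc hex hsurj hδ.exact_map
      (hδ.surjective_map hP.projective_self)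
    obtain ⟨σ, -⟩ := hX.exists_retract hA hP (Y := W)
      ⟨eX.hom ≫ e.hom, e.inv ≫ eX.inv, by simp⟩
    refine ExtVanishes.of_retract_left ((hδ.extends_iff hP h1 h0).1 fun g => ?_) σ
    obtain ⟨l, hl⟩ := hp (e1.inv ≫ g ≫ eY.hom)
    refine ⟨e0.hom ≫ l ≫ eY.inv, ?_⟩
    rw [hi, Category.assoc, Category.assoc, Iso.inv_hom_id_assoc, reassoc_of% hl]
    simp
  · intro h
    obtain ⟨Q₁, Q₀, i, p, δ, h1, h0, hδ, -, q, hq⟩ :=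
      hX.exists_minimal_resolution hA hP k homFinite
    refine ⟨{ q with
      p := q.p ≫ eX.hom
      surjective := (eX.toLinearEquiv.surjective).comp q.surjective
      exact := ?_
      minimal₀ := ?_ }, ?_⟩
    · rw [q.exact]
      exact (LinearMap.ker_comp_of_ker_eq_bot q.p.hom eX.toLinearEquiv.ker).symm
    · have := q.minimal₀
      rwa [← LinearMap.ker_comp_of_ker_eq_bot q.p.hom eX.toLinearEquiv.ker] at this
    · refine hq N fun g => ?_
      obtain ⟨l, hl⟩ := (hδ.extends_iff hP h1 h0).2 h (g ≫ eY.inv)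
      exact ⟨l ≫ eY.hom, by rw [reassoc_of% hl]; simp⟩

/-- If `Ext¹(C(P, X), -)` vanishes on all quotients of `C(P, S)`, then `𝔼(X, S)` vanishes. A
morphism `g : Q₁ ⟶ S` on a minimal resolution of `X` need not be defined on the image of `C(P, i)`,
but it is so modulo `g (ker C(P, i))`; the resulting error is an endomorphism of `Q₁` killed by `i`,
hence radical. -/
lemma NoInjectiveSummand.extVanishes_of_ext {X S : C} (hX : T.NoInjectiveSummand X)
    (h : ∀ (N : ModuleCat.{v} (End P)ᵐᵒᵖ) (f : (homFunctor P).obj S ⟶ N), Epi f →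
      Subsingleton (Abelian.Ext ((homFunctor P).obj X) N 1)) : T.ExtVanishes X S := by
  obtain ⟨Q₁, Q₀, i, p, δ, h1, h0, hδ, hrad, -⟩ := hX.exists_minimal_resolution hA hP k homFinite
  intro θ
  obtain ⟨g, rfl⟩ := hδ.exists_push_eq θ (hP.extVanishes h0 _ _)
  -- the quotient of `C(P, S)` by the image of the kernel of `C(P, i)`
  let φ := ((homFunctor P).map g).hom
  let ι := ((homFunctor P).map i).hom
  let L : Submodule (End P)ᵐᵒᵖ ((homFunctor P).obj S) := (LinearMap.ker ι).map φ
  let R := LinearMap.range ι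
  let SC : ShortComplex (ModuleCat.{v} (End P)ᵐᵒᵖ) := ShortComplex.mk
    (ModuleCat.ofHom R.subtype) ((homFunctor P).map p) (ModuleCat.hom_ext (LinearMap.ext fun x =>
      hδ.exact_map.linearMap_ker_eq.symm.le x.2))
  have hSC : SC.ShortExact := by
    refine ShortComplex.ShortExact.mk' ?_ ?_ ?_
    · refine (ShortComplex.ShortExact.moduleCat_exact_iff_function_exact _).2 fun x => ?_
      refine (hδ.exact_map x).trans ⟨?_, ?_⟩
      · intro hx
        exact ⟨⟨x, hx⟩, rfl⟩
      · rintro ⟨y, rfl⟩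
        exact y.2
    · exact (ModuleCat.mono_iff_injective _).2 R.injective_subtype
    · exact (ModuleCat.epi_iff_surjective _).2 (hδ.surjective_map hP.projective_self)
  have hle : LinearMap.ker ι ≤ LinearMap.ker (L.mkQ ∘ₗ φ) := fun x hx => by
    rw [LinearMap.mem_ker, LinearMap.comp_apply, Submodule.mkQ_apply, Submodule.Quotient.mk_eq_zero]
    exact ⟨x, hx, rfl⟩
  have hepi : Epi (ModuleCat.ofHom L.mkQ) :=
    (ModuleCat.epi_iff_surjective _).2 (Submodule.mkQ_surjective L)
  obtain ⟨l, hl⟩ := exists_extension_of_subsingleton_ext hSC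
    (N := ModuleCat.of (End P)ᵐᵒᵖ ((homFunctor P).obj S ⧸ L))
    (h (ModuleCat.of (End P)ᵐᵒᵖ ((homFunctor P).obj S ⧸ L)) (ModuleCat.ofHom L.mkQ) hepi)
    (ModuleCat.ofHom ((LinearMap.ker ι).liftQ (L.mkQ ∘ₗ φ) hle ∘ₗ
      ι.quotKerEquivRange.symm.toLinearMap))
  have hl' : ∀ x, l.hom (ι x) = L.mkQ (φ x) := fun x => by
    have h2 := LinearMap.congr_fun (congrArg ModuleCat.Hom.hom hl) ⟨ι x, x, rfl⟩
    refine h2.trans ?_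
    change (LinearMap.ker ι).liftQ (L.mkQ ∘ₗ φ) hle (ι.quotKerEquivRange.symm ⟨ι x, x, rfl⟩) = _
    have : ι.quotKerEquivRange.symm ⟨ι x, x, rfl⟩ = Submodule.Quotient.mk x := by
      rw [LinearEquiv.symm_apply_eq]; rfl
    rw [this]; rfl
  have := projective_obj h0
  obtain ⟨m, hm⟩ := Module.projective_lifting_property L.mkQ l.hom (Submodule.mkQ_surjective L)
  obtain ⟨m', hm'⟩ := exists_map_eq_of_inAdd h0 (Y := S) (ModuleCat.ofHom m)
  -- `g - i ≫ m'` has its values in the image of the kernel, so it equals `s ≫ g` with `s ≫ i = 0`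
  obtain ⟨s, hs⟩ := exists_lift_of_range h1 (biprod.lift 0 (g - i ≫ m') : Q₁ ⟶ Q₀ ⊞ S)
    (biprod.lift i g) fun x => by
      have h3 : φ x - m (ι x) ∈ L := by
        rw [← Submodule.Quotient.mk_eq_zero, Submodule.Quotient.mk_sub, sub_eq_zero]
        exact (hl' x).symm.trans (LinearMap.congr_fun hm (ι x)).symm
      obtain ⟨y, hy, hyx⟩ := h3
      let y' : P ⟶ Q₁ := y
      refine ⟨y', ?_⟩
      refine biprod.hom_ext _ _ ?_ ?_
      · rw [Category.assoc, Category.assoc, biprod.lift_fst, biprod.lift_fst, comp_zero]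
        exact hy
      · rw [Category.assoc, Category.assoc, biprod.lift_snd, biprod.lift_snd,
          Preadditive.comp_sub, ← Category.assoc]
        have h4 : ((homFunctor P).map m').hom (ι x) = m (ι x) :=
          LinearMap.congr_fun (congrArg ModuleCat.Hom.hom hm') (ι x)
        exact hyx.trans (congrArg (φ x - ·) h4.symm)
  have hs1 : s ≫ i = 0 := by
    have := congrArg (· ≫ biprod.fst) hs
    simpa only [Category.assoc, biprod.lift_fst] using this
  have hs2 : s ≫ g = g - i ≫ m' := by
    have := congrArg (· ≫ biprod.snd) hs
    simpa only [Category.assoc, biprod.lift_snd] using this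
  have := (hrad s hs1).isIso_sub
  rw [hδ.push_eq_zero_iff]
  refine ⟨m', ?_⟩
  have e1 : (𝟙 Q₁ - s) ≫ i ≫ m' = i ≫ m' := by
    rw [Preadditive.sub_comp, reassoc_of% hs1]; simp
  have e2 : (𝟙 Q₁ - s) ≫ g = i ≫ m' := by rw [Preadditive.sub_comp, hs2]; simp
  rw [← cancel_epi (𝟙 Q₁ - s), e1, e2]

/-- Let `S` be a presilting object such that `P` has an `add S`-coresolution of length one. A class
of finitely generated modules that contains all quotients of modules in `add C(P, S)`, and on which
`𝔼(S, -)` vanishes, has `add C(P, S)` as its class of `Ext`-projectives. -/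
theorem inAdd_iff_extProjective {S S₀ S₁ : C} {i : P ⟶ S₀} {p : S₀ ⟶ S₁}
    {δ : Extn T.E S₁ P} (h : T.Realizes i p δ) (hS : T.Presilting S)
    (h0 : InAdd S S₀) (h1 : InAdd S S₁) (𝒳 : ModuleCat.{v} (End P)ᵐᵒᵖ → Prop)
    (hfin : ∀ X, 𝒳 X → Module.Finite (End P)ᵐᵒᵖ X)
    (hiso : ∀ X Y, Nonempty (X ≅ Y) → 𝒳 X → 𝒳 Y)
    (hquot : ∀ (V X : ModuleCat.{v} (End P)ᵐᵒᵖ) (f : V ⟶ X), InAdd ((homFunctor P).obj S) V →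
      Epi f → 𝒳 X)
    (hvan : ∀ Y : C, 𝒳 ((homFunctor P).obj Y) → T.ExtVanishes S Y)
    (X : ModuleCat.{v} (End P)ᵐᵒᵖ) :
    InAdd ((homFunctor P).obj S) X ↔ ExtProjective 𝒳 X := by
  constructor
  · intro hX
    refine ⟨hquot X X (𝟙 X) hX inferInstance, fun Y hY => ?_⟩
    have := hfin Y hY
    obtain ⟨Y', ⟨eY⟩⟩ := exists_obj_iso hA hP k homFinite Y
    obtain ⟨X', hX', ⟨eX⟩⟩ := exists_inAdd_of_inAdd hA hP hX
    exact subsingleton_ext_of_extVanishes hP hA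
      ((hvan Y' (hiso _ _ ⟨eY.symm⟩ hY)).inAdd_left hX') eX eY
  · rintro ⟨hX, hext⟩
    have := hfin X hX
    obtain ⟨X', hX', ⟨eX⟩⟩ := exists_noInjectiveSummand_iso hA hP k homFinite X
    have hSX : T.ExtVanishes S X' := hvan X' (hiso _ _ ⟨eX.symm⟩ hX)
    have hXS : T.ExtVanishes X' S := hX'.extVanishes_of_ext hA hP k homFinite fun N f hf =>
      subsingleton_ext_of_retract ⟨eX.hom, eX.inv, eX.hom_inv_id⟩
        (hext N (hquot _ _ f (inAdd_self _) hf))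
    have hinf : ∀ {Q V : C} (f : Q ⟶ V), InAdd P Q → T.Inflation f := fun {Q V} f hQ => by
      obtain ⟨J, hJ⟩ := exists_suspension hA (hP.projective hQ)
      exact hJ.inflation f
    obtain ⟨Q₁, Q₀, j, q, μ, hQ1, hQ0, hμ⟩ := exists_resolution hA hP X'
    obtain ⟨Y₀, Y₁, a, b, hY0, hY1, ε, hε⟩ :=
      exists_coresolution_of_inAdd k homFinite h hS h0 h1 hinf hQ1
    obtain ⟨Y₀', Y₁', a', b', hY0', hY1', ε', hε'⟩ :=
      exists_coresolution_of_inAdd k homFinite h hS h0 h1 hinf hQ0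
    -- the pushout `N` of `Q₀ ⟵ Q₁ ⟶ Y₀` is `Y₀ ⊞ X'`, and comparing the conflations `Q₀ ⟶ N ⟶ Y₁`
    -- and `Q₀ ⟶ Y₀' ⟶ Y₁'` shows that `N` lies in `add S`
    obtain ⟨N, m, n, m', n', hm1, hm2, -⟩ := exists_pushout hμ hε
    rw [hXS.inAdd_right hY0 (push T.E a μ)] at hm2
    obtain ⟨e, -⟩ := hm2.exists_iso_biprod
    obtain ⟨φ⟩ := exists_iso_of_common_left hm1 hε' (hS.extVanishes hY1 hY0')
      (((hS.extVanishes hY1' hY0).biprod_right (hSX.inAdd_left hY1')).of_iso_right e.symm)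
    have hXadd : InAdd S X' := InAdd.of_isSummand ((hY0'.biprod hY1).of_iso φ.symm)
      (((isSummand_right Y₀ X').of_iso e.symm).trans (isSummand_left N Y₁'))
    exact (inAdd_map hXadd).of_iso eX

end HomFinite

end Presentations

end Extriangulated

/-! ### Transport of approximations and of summands -/

section Transport

lemma numInd_congr {C : Type*} [Category* C] [Preadditive C] [HasZeroObject C]
    [HasBinaryBiproducts C] [HasFiniteBiproducts C] {X Y : C} (e : X ≅ Y) :
    numInd X = numInd Y := by
  obtain ⟨ρ, -⟩ := exists_indClass_equiv (B := X) (Z := Y) (fun M N => Nonempty (M.1 ≅ N.1))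
    (fun M => ⟨⟨M.1, M.2.1, M.2.2.of_iso e⟩, ⟨Iso.refl _⟩⟩)
    (fun N => ⟨⟨N.1, N.2.1, N.2.2.of_iso e.symm⟩, ⟨Iso.refl _⟩⟩)
    (fun _ _ _ _ ⟨f⟩ ⟨g⟩ => ⟨fun ⟨h⟩ => ⟨f.symm.trans (h.trans g)⟩,
      fun ⟨h⟩ => ⟨f.trans (h.trans g.symm)⟩⟩) fun _ _ _ ⟨f⟩ ⟨g⟩ => ⟨f.trans g⟩
  exact Nat.card_congr ρ

lemma numInd_eq_zero {C : Type*} [Category* C] [Preadditive C] [HasZeroObject C]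
    [HasBinaryBiproducts C] [HasFiniteBiproducts C] {X : C} (h : IsZero X) : numInd X = 0 := by
  have : IsEmpty (IndClass X) := ⟨fun x => by
    obtain ⟨Y, rfl⟩ := Quotient.exists_rep x
    obtain ⟨ρ⟩ := Y.2.2.retract
    refine Y.2.1.1 ((IsZero.iff_id_eq_zero _).2 ?_)
    rw [← ρ.retract, h.eq_of_tgt ρ.i 0, zero_comp]⟩
  exact Nat.card_of_isEmpty

lemma HomTauVanishes.of_iso (k : Type*) [Field k] {Λ : Type v} [Ring Λ] [Algebra k Λ]
    {X Y M : ModuleCat.{v} Λ} (h : HomTauVanishes k X M) (e : X ≅ Y) : HomTauVanishes k Y M := by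
  rw [homTauVanishes_iff] at h ⊢
  obtain ⟨p, hp⟩ := h
  refine ⟨p, fun g => ?_⟩
  obtain ⟨l, hl⟩ := hp (g ≫ e.inv)
  exact ⟨l ≫ e.hom, by rw [reassoc_of% hl]; simp⟩

end Transport

namespace Extriangulated

section Suspension

variable {C : Type u} [Category.{v} C] [Preadditive C] [HasZeroObject C]
  [HasBinaryBiproducts C] [HasFiniteBiproducts C] {T : Extriangulated.{w} C}

lemma Projective.of_retract {Q Q' : C} (h : T.Projective Q) (ρ : Retract Q' Q) :
    T.Projective Q' :=
  projective_of_extVanishes fun X => (h.extVanishes X).of_retract_left ρ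

lemma Injective.inAdd {J X : C} (h : T.Injective J) (hX : InAdd J X) : T.Injective X :=
  injective_of_extVanishes fun W => (h.extVanishes W).inAdd_right hX

variable (hA : T.IsReducedZeroAuslander)
include hA

lemma IsSuspension.isSummand_left {W J X Y : C} (h : T.IsSuspension W J)
    (h' : T.IsSuspension X Y) (hY : IsSummand Y J) : IsSummand X W := by
  obtain ⟨Y', ⟨e⟩⟩ := hY
  have hJ : T.Injective J := h.injective hA
  obtain ⟨X', hX'⟩ := exists_desuspension hA
    (hJ.of_retract (IsSummand.retract ((ZeroAuslander.isSummand_right Y Y').of_iso e.symm)).some)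
  obtain ⟨φ⟩ := h.exists_iso_left (h'.biprod hX') e
  exact ⟨X', ⟨φ⟩⟩

lemma IsSuspension.isSummand_right {W J X Y : C} (h : T.IsSuspension W J)
    (h' : T.IsSuspension X Y) (hX : IsSummand X W) : IsSummand Y J := by
  obtain ⟨X', ⟨e⟩⟩ := hX
  have hW : T.Projective W := h.projective hA
  obtain ⟨Y', hY'⟩ := exists_suspension hA
    (hW.of_retract (IsSummand.retract ((ZeroAuslander.isSummand_right X X').of_iso e.symm)).some)
  obtain ⟨φ⟩ := h.exists_iso_right (h'.biprod hY') e
  exact ⟨Y', ⟨φ⟩⟩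

lemma IsSuspension.indecomposable_left {X Y : C} (h : T.IsSuspension X Y)
    (hY : Indecomposable Y) : Indecomposable X := by
  refine ⟨fun h0 => hY.1 (h.isZero_right h0), fun A B e => ?_⟩
  have hX : T.Projective X := h.projective hA
  obtain ⟨A', hA'⟩ := exists_suspension hA (hX.of_retract (IsSummand.retract ⟨B, ⟨e⟩⟩).some)
  obtain ⟨B', hB'⟩ := exists_suspension hA
    (hX.of_retract (IsSummand.retract ((ZeroAuslander.isSummand_right A B).of_iso e.symm)).some)
  obtain ⟨φ⟩ := h.exists_iso_right (hA'.biprod hB') e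
  exact (hY.2 _ _ φ).imp hA'.isZero_left hB'.isZero_left

lemma IsSuspension.indecomposable_right {X Y : C} (h : T.IsSuspension X Y)
    (hX : Indecomposable X) : Indecomposable Y := by
  refine ⟨fun h0 => hX.1 (h.isZero_left h0), fun A B e => ?_⟩
  have hY : T.Injective Y := h.injective hA
  obtain ⟨A', hA'⟩ := exists_desuspension hA (hY.of_retract (IsSummand.retract ⟨B, ⟨e⟩⟩).some)
  obtain ⟨B', hB'⟩ := exists_desuspension hA
    (hY.of_retract (IsSummand.retract ((ZeroAuslander.isSummand_right A B).of_iso e.symm)).some)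
  obtain ⟨φ⟩ := h.exists_iso_left (hA'.biprod hB') e
  exact (hX.2 _ _ φ).imp hA'.isZero_right hB'.isZero_right

end Suspension

/-! ### Images of exchange triangles -/

section Images

variable {C : Type u} [Category.{v} C] [Preadditive C] [HasZeroObject C]
  [HasBinaryBiproducts C] [HasFiniteBiproducts C] {T : Extriangulated.{w} C} {P U : C}
  [IsIdempotentComplete C] [FittingCategory C]

/-- An injective summand of a left mutable object would be a summand of its approximation. -/
lemma IsLeftMutable.noInjectiveSummand {B : C} (h : T.IsLeftMutable U B) :
    T.NoInjectiveSummand B := fun J hJB hJ => by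
  obtain ⟨V, b, hb, hbU⟩ := (h.of_isSummand hJB).exists_inflation
  obtain ⟨r, hr⟩ := hJ b hb (𝟙 J)
  exact h.noCommonSummand J hJB (hbU.1.of_retract ⟨b, r, hr⟩)

variable (hA : T.IsReducedZeroAuslander) (hP : T.IsProjectiveGenerator P)
include hA hP

/-- `C(P, -)` preserves minimal left approximations that are inflations. -/
lemma map_isMinLeftApprox {X V : C} {b : X ⟶ V} (hb : IsMinLeftApprox U b)
    (hinf : T.Inflation b) :
    IsMinLeftApprox ((homFunctor P).obj U) ((homFunctor P).map b) := by
  refine ⟨⟨inAdd_map hb.1.1, fun W g hW => ?_⟩, fun h hh => ?_⟩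
  · obtain ⟨W', hW', ⟨e⟩⟩ := exists_inAdd_of_inAdd hA hP hW
    obtain ⟨g', hg'⟩ := exists_map_eq hA hP (g ≫ e.inv)
    obtain ⟨l, hl⟩ := hb.1.2 W' g' hW'
    refine ⟨(homFunctor P).map l ≫ e.hom, ?_⟩
    rw [← Functor.map_comp_assoc, hl, hg', Category.assoc, Iso.inv_hom_id, Category.comp_id]
  · obtain ⟨h', rfl⟩ := exists_map_eq hA hP h
    -- a lift of `h` fixes `b` only up to a morphism through an injective object `J`; it is
    -- corrected by extending `X ⟶ J` along the inflation `b`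
    obtain ⟨J, j, l, hJ, hjl⟩ := exists_factorization_of_map_eq_zero hA hP (f := b ≫ h' - b)
      (by rw [Functor.map_sub, Functor.map_comp, hh, sub_self])
    obtain ⟨j', rfl⟩ := hJ b hinf j
    have := hb.2 (h' - j' ≫ l) (by
      rw [Preadditive.comp_sub, ← Category.assoc, hjl, sub_sub_cancel])
    have h1 : (homFunctor P).map h' = (homFunctor P).map (h' - j' ≫ l) := by
      rw [Functor.map_sub, map_eq_zero_of_factorization hA hP hJ, sub_zero]
    rw [h1]
    infer_instance

omit [FittingCategory C] in
lemma map_isRightApprox [FittingCategory C] {V Y : C} {c : V ⟶ Y} (hc : IsRightApprox U c) :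
    IsRightApprox ((homFunctor P).obj U) ((homFunctor P).map c) := by
  refine ⟨inAdd_map hc.1, fun W g hW => ?_⟩
  obtain ⟨W', hW', ⟨e⟩⟩ := exists_inAdd_of_inAdd hA hP hW
  obtain ⟨g', hg'⟩ := exists_map_eq hA hP (e.hom ≫ g)
  obtain ⟨l, hl⟩ := hc.2 W' g' hW'
  refine ⟨e.inv ≫ (homFunctor P).map l, ?_⟩
  rw [Category.assoc, ← Functor.map_comp, hl, hg', Iso.inv_hom_id_assoc]

section Triangle

variable {X V Y : C} {b : X ⟶ V} {c : V ⟶ Y} {δ : Extn T.E Y X}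
  (h : T.IsExchangeTriangle U b c δ) {M : ModuleCat.{v} (End P)ᵐᵒᵖ}
  (eX : (homFunctor P).obj X ≅ M)
include h eX

/-- The minimal left approximations of `M ≅ C(P, X)` are the maps isomorphic to `C(P, b)`. -/
lemma IsExchangeTriangle.exists_iso_of_isMinLeftApprox {V' : ModuleCat.{v} (End P)ᵐᵒᵖ}
    {m : M ⟶ V'} (hm : IsMinLeftApprox ((homFunctor P).obj U) m) :
    ∃ e : (homFunctor P).obj V ≅ V', (homFunctor P).map b ≫ e.hom = eX.hom ≫ m := by
  have h1 := map_isMinLeftApprox hA hP h.2.1 ⟨_, _, _, h.1⟩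
  obtain ⟨e, he⟩ := h1.exists_iso (hm.comp_iso eX (Iso.refl V'))
  exact ⟨e, by simpa using he⟩

lemma IsExchangeTriangle.isMinLeftApprox_map :
    IsMinLeftApprox ((homFunctor P).obj U) (eX.inv ≫ (homFunctor P).map b) := by
  have h1 := (map_isMinLeftApprox hA hP h.2.1 ⟨_, _, _, h.1⟩).comp_iso eX.symm (Iso.refl _)
  simpa using h1

omit eX in
/-- The cokernel of `C(P, b)` is `C(P, Y)`, which is zero precisely if `Y` is injective. -/
lemma IsExchangeTriangle.surjective_map_iff :
    Function.Surjective ((homFunctor P).map b).hom ↔ T.Injective Y := by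
  constructor
  · intro hs
    refine injective_of_isZero_obj hA hP ((IsZero.iff_id_eq_zero _).2
      (homFunctor_hom_ext fun y => ?_))
    obtain ⟨v, rfl⟩ := h.1.surjective_map hP.projective_self y
    exact (h.1.exact_map v).2 (hs v)
  · intro hY v
    have h0 : ((homFunctor P).map c) = 0 := (isZero_obj_of_injective hA hP hY).eq_of_tgt _ _
    exact (h.1.exact_map v).1 (LinearMap.congr_fun (congrArg ModuleCat.Hom.hom h0) v)

/-- The minimal left approximation of `C(P, X)` is an epimorphism precisely if the other end of
the exchange triangle is injective. -/
lemma IsExchangeTriangle.hasEpiApprox_iff :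
    HasEpiApprox ((homFunctor P).obj U) M ↔ T.Injective Y := by
  rw [← h.surjective_map_iff hA hP]
  constructor
  · rintro ⟨V', m, hm, hepi⟩
    obtain ⟨e, he⟩ := h.exists_iso_of_isMinLeftApprox hA hP eX hm
    have : (homFunctor P).map b = eX.hom ≫ m ≫ e.inv := by
      rw [← Category.assoc, ← he, Category.assoc, Iso.hom_inv_id, Category.comp_id]
    rw [← ModuleCat.epi_iff_surjective, this]
    infer_instance
  · intro hs
    have := (ModuleCat.epi_iff_surjective _).2 hs
    exact ⟨_, _, h.isMinLeftApprox_map hA hP eX, inferInstance⟩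

/-- The modules exchanged with `C(P, X)` are those isomorphic to `C(P, Y)`. -/
lemma IsExchangeTriangle.buanMarshModule_iff {N : ModuleCat.{v} (End P)ᵐᵒᵖ} :
    BuanMarshModule ((homFunctor P).obj U) M N ↔ Nonempty ((homFunctor P).obj Y ≅ N) := by
  constructor
  · rintro ⟨V', m, g, hex, hg, hm, -⟩
    obtain ⟨e, he⟩ := h.exists_iso_of_isMinLeftApprox hA hP eX hm
    have hex' : Function.Exact ((homFunctor P).map b).hom (e.hom ≫ g).hom := by
      intro x
      refine (hex (e.hom.hom x)).trans ⟨?_, ?_⟩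
      · rintro ⟨y, hy⟩
        refine ⟨eX.inv.hom y, ?_⟩
        have h1 : eX.inv ≫ (homFunctor P).map b = m ≫ e.inv := by
          rw [Iso.inv_comp_eq, ← Category.assoc, ← he, Category.assoc, Iso.hom_inv_id,
            Category.comp_id]
        refine (LinearMap.congr_fun (congrArg ModuleCat.Hom.hom h1) y).trans ?_
        change e.inv.hom (m.hom y) = x
        rw [hy]
        exact LinearMap.congr_fun (congrArg ModuleCat.Hom.hom e.hom_inv_id) x
      · rintro ⟨y, rfl⟩
        exact ⟨eX.hom.hom y, (LinearMap.congr_fun (congrArg ModuleCat.Hom.hom he) y).symm⟩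
    obtain ⟨φ, -⟩ := isIso_map_desc h.1.exact_map (h.1.surjective_map hP.projective_self) hex'
      (hg.comp e.toLinearEquiv.surjective)
    exact ⟨φ⟩
  · rintro ⟨φ⟩
    refine ⟨(homFunctor P).obj V, eX.inv ≫ (homFunctor P).map b, (homFunctor P).map c ≫ φ.hom,
      ?_, φ.toLinearEquiv.surjective.comp (h.1.surjective_map hP.projective_self),
      h.isMinLeftApprox_map hA hP eX, ?_⟩
    · intro x
      have h1 : ((homFunctor P).map c ≫ φ.hom).hom x = 0 ↔ ((homFunctor P).map c).hom x = 0 :=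
        φ.toLinearEquiv.map_eq_zero_iff
      refine h1.trans ((h.1.exact_map x).trans ⟨?_, ?_⟩)
      · rintro ⟨y, rfl⟩
        refine ⟨eX.hom.hom y, ?_⟩
        have h2 : eX.hom ≫ eX.inv ≫ (homFunctor P).map b = (homFunctor P).map b := by simp
        exact LinearMap.congr_fun (congrArg ModuleCat.Hom.hom h2) y
      · rintro ⟨y, rfl⟩
        exact ⟨eX.inv.hom y, rfl⟩
    · have h1 := (map_isRightApprox hA hP h.2.2.1).comp_iso φ (Iso.refl _)
      simpa using h1

/-- If the exchange triangle ends in an injective object `Y = ΣW`, then `C(P, X)` is exchanged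
with the shifted projective module `C(P, W)`: the rotated conflation is `W ⟶ X ⟶ V`. -/
lemma IsExchangeTriangle.buanMarshShifted_iff {B W W₁ : C} {Q : ModuleCat.{v} (End P)ᵐᵒᵖ}
    (hWY : T.IsSuspension W Y) (hVB : T.ExtVanishes V B) (hXB : InAdd B X)
    (hX : Indecomposable X) (hXi : T.NoInjectiveSummand X) (hUX : NoCommonSummand U X)
    (hU : T.NoInjectiveSummand U)
    (hW : Indecomposable W) (hW₁ : Indecomposable W₁) (hPW₁ : InAdd P W₁)
    (eQ : (homFunctor P).obj W₁ ≅ Q) :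
    BuanMarshShifted ((homFunctor P).obj U) ((homFunctor P).obj B) M Q ↔
      Nonempty ((homFunctor P).obj W ≅ Q) := by
  obtain ⟨O, a, b', hO, ε, hε⟩ := id hWY
  obtain ⟨d, μ, hd⟩ := h.1.exists_rotate_left hε hO
  have hPW : InAdd P W := (hP W).1 (hWY.projective hA)
  have hYi : T.Injective Y := hWY.injective hA
  have hsurj := (h.surjective_map_iff hA hP).2 hYi
  -- `d` is nonzero, since otherwise `X` would be isomorphic to `V`
  have hd0 : d ≠ 0 := by
    rintro rfl
    have hinj : Function.Injective ((homFunctor P).map b).hom := by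
      rw [injective_iff_map_eq_zero]
      intro x hx
      obtain ⟨y, rfl⟩ := (hd.exact_map x).1 hx
      rw [Functor.map_zero]; rfl
    have hiso : IsIso ((homFunctor P).map b) :=
      (ConcreteCategory.isIso_iff_bijective ((homFunctor P).map b)).2 ⟨hinj, hsurj⟩
    have := hXi.isIso_of_isIso_map hA hP (hU.inAdd h.2.1.1.1) b
    exact hX.1 (hUX X (isSummand_self X) (h.2.1.1.1.of_iso (asIso b).symm))
  constructor
  · rintro ⟨V', d₁, m, hex, hm, -, hmin⟩
    obtain ⟨e, he⟩ := h.exists_iso_of_isMinLeftApprox hA hP eX hmin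
    obtain ⟨d', hd'⟩ := exists_map_eq_of_inAdd hPW₁ (eQ.hom ≫ d₁ ≫ eX.inv)
    have hk : ∀ x, ((homFunctor P).map b).hom x = 0 ↔ m.hom (eX.hom.hom x) = 0 := fun x => by
      have h1 : e.hom.hom (((homFunctor P).map b).hom x) = m.hom (eX.hom.hom x) :=
        LinearMap.congr_fun (congrArg ModuleCat.Hom.hom he) x
      rw [← h1]
      exact e.toLinearEquiv.map_eq_zero_iff.symm
    have hex' : Function.Exact ((homFunctor P).map d').hom ((homFunctor P).map b).hom := by
      intro x
      refine (hk x).trans ((hex _).trans ⟨?_, ?_⟩)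
      · rintro ⟨y, hy⟩
        refine ⟨eQ.inv.hom y, ?_⟩
        have h1 : eQ.inv ≫ (homFunctor P).map d' = d₁ ≫ eX.inv := by rw [hd']; simp
        refine (LinearMap.congr_fun (congrArg ModuleCat.Hom.hom h1) y).trans ?_
        change eX.inv.hom (d₁.hom y) = x
        rw [hy]
        exact LinearMap.congr_fun (congrArg ModuleCat.Hom.hom eX.hom_inv_id) x
      · rintro ⟨y, rfl⟩
        refine ⟨eQ.hom.hom y, ?_⟩
        have h1 : (homFunctor P).map d' ≫ eX.hom = eQ.hom ≫ d₁ := by rw [hd']; simp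
        exact (LinearMap.congr_fun (congrArg ModuleCat.Hom.hom h1) y).symm
    -- `d` and `d'` have the same image, so they factor through each other
    obtain ⟨t, ht⟩ := exists_lift_of_range hPW d d' fun x =>
      (hex' _).1 ((hd.exact_map _).2 ⟨x, rfl⟩)
    obtain ⟨s, hs⟩ := exists_lift_of_range hPW₁ d' d fun x =>
      (hd.exact_map _).1 ((hex' _).2 ⟨x, rfl⟩)
    have hts : IsIso (t ≫ s) := by
      refine (isIso_or_isNilpotent_of_indecomposable hW (t ≫ s)).resolve_right ?_
      rintro ⟨n, hn⟩
      let F : End W := t ≫ s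
      have hpow : ∀ n : ℕ, (F ^ n : End W) ≫ d = d := by
        intro n
        induction n with
        | zero => exact Category.id_comp d
        | succ n ih =>
          have : (F ^ (n + 1) : End W) = (t ≫ s) ≫ (F ^ n : End W) := pow_succ F n
          rw [this, Category.assoc, ih, Category.assoc, hs, ht]
      have := hpow n
      rw [show F ^ n = 0 from hn] at this
      exact hd0 (this.symm.trans zero_comp)
    have hst : t ≫ (s ≫ inv (t ≫ s)) = 𝟙 W := by rw [← Category.assoc, IsIso.hom_inv_id]
    have := isIso_of_retract_indecomposable hW₁ hW.1 t _ hst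
    exact ⟨((homFunctor P).mapIso (asIso t)).trans eQ⟩
  · rintro ⟨φ⟩
    refine ⟨(homFunctor P).obj V, φ.inv ≫ (homFunctor P).map d ≫ eX.hom,
      eX.inv ≫ (homFunctor P).map b, ?_, ?_, ?_, h.isMinLeftApprox_map hA hP eX⟩
    · intro x
      have h1 : (eX.inv ≫ (homFunctor P).map b).hom x = 0 ↔
          eX.inv.hom x ∈ Set.range ((homFunctor P).map d).hom := hd.exact_map (eX.inv.hom x)
      refine h1.trans ⟨?_, ?_⟩
      · rintro ⟨y, hy⟩
        refine ⟨φ.hom.hom y, ?_⟩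
        have h2 : φ.hom ≫ φ.inv ≫ (homFunctor P).map d ≫ eX.hom =
          (homFunctor P).map d ≫ eX.hom := by simp
        refine (LinearMap.congr_fun (congrArg ModuleCat.Hom.hom h2) y).trans ?_
        change eX.hom.hom (((homFunctor P).map d).hom y) = x
        rw [hy]
        exact LinearMap.congr_fun (congrArg ModuleCat.Hom.hom eX.inv_hom_id) x
      · rintro ⟨y, rfl⟩
        refine ⟨φ.inv.hom y, ?_⟩
        have h2 : (φ.inv ≫ (homFunctor P).map d ≫ eX.hom) ≫ eX.inv =
          φ.inv ≫ (homFunctor P).map d := by simp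
        exact (LinearMap.congr_fun (congrArg ModuleCat.Hom.hom h2) y).symm
    · exact hsurj.comp eX.symm.toLinearEquiv.surjective
    · suffices hmin : IsMinLeftApprox ((homFunctor P).obj B) ((homFunctor P).map d) from
        hmin.comp_iso φ.symm eX
      refine ⟨⟨inAdd_map hXB, fun N g hN => ?_⟩, fun g hg => ?_⟩
      · obtain ⟨N', hN', ⟨e⟩⟩ := exists_inAdd_of_inAdd hA hP hN
        obtain ⟨g', hg'⟩ := exists_map_eq_of_inAdd hPW (g ≫ e.inv)
        obtain ⟨l, rfl⟩ := (hd.push_eq_zero_iff g').1 (hVB.inAdd_right hN' _)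
        refine ⟨(homFunctor P).map l ≫ e.hom, ?_⟩
        rw [← Functor.map_comp_assoc, hg', Category.assoc, Iso.inv_hom_id, Category.comp_id]
      · obtain ⟨g', rfl⟩ := exists_map_eq hA hP g
        have hdg : d ≫ g' = d := eq_of_inAdd hPW (by rw [Functor.map_comp, hg])
        have : IsIso g' := by
          refine (isIso_or_isNilpotent_of_indecomposable hX g').resolve_right ?_
          rintro ⟨n, hn⟩
          let F : End X := g'
          have hpow : ∀ n : ℕ, d ≫ (F ^ n : End X) = d := by
            intro n
            induction n with
            | zero => exact Category.comp_id d
            | succ n ih =>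
              have : (F ^ (n + 1) : End X) = g' ≫ (F ^ n : End X) := pow_succ F n
              rw [this, ← Category.assoc, hdg, ih]
          have := hpow n
          rw [show F ^ n = 0 from hn] at this
          exact hd0 (this.symm.trans comp_zero)
        infer_instance

end Triangle

end Images

end Extriangulated

/-! ### The Bongartz and the co-Bongartz complement of a `τ`-rigid module -/

namespace Extriangulated

section ModuleComplements

variable {C : Type u} [Category.{v} C] [Preadditive C] [HasZeroObject C]
  [HasBinaryBiproducts C] [HasFiniteBiproducts C] {T : Extriangulated.{w} C} {P U : C}
  [IsIdempotentComplete C]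

lemma IsCoBongartzComplement.presilting (hA : T.IsReducedZeroAuslander) (hU : T.Presilting U)
    {Z : C} (hZ : T.IsCoBongartzComplement P U Z) : T.Presilting (Z ⊞ U) := by
  obtain ⟨L, U'', U₀, g, c, hg, ⟨δ, hδ⟩, hU₀, ⟨eL⟩, -⟩ := hZ
  have hLU : T.ExtVanishes L U := hδ.extVanishes_of_isLeftApprox hg.1 hU
  have hUL : T.ExtVanishes U L :=
    hδ.extVanishes_right hA (hU.extVanishes (inAdd_self U) hg.1.1)
  have hLL : T.ExtVanishes L L := hδ.extVanishes_right hA (hLU.inAdd_right hg.1.1)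
  have ρ : Retract Z L := (IsSummand.retract ((isSummand_left Z U₀).of_iso eL.symm)).some
  have h1 : T.ExtVanishes (Z ⊞ U) Z :=
    ((hLL.of_retract_left ρ).of_retract_right ρ).biprod_left (hUL.of_retract_right ρ)
  have h2 : T.ExtVanishes (Z ⊞ U) U :=
    (hLU.of_retract_left ρ).biprod_left (hU.extVanishes (inAdd_self U) (inAdd_self U))
  exact h1.biprod_right h2

/-- If every morphism `P ⟶ S` factors through `W ⟶ S` with `W` in `add U`, then every object of
`add S` has the same property. -/
lemma exists_surjective_of_inAdd {S W V : C} (hW : InAdd U W) (w : W ⟶ S)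
    (hw : ∀ g : P ⟶ S, ∃ l : P ⟶ W, l ≫ w = g) (hV : InAdd S V) :
    ∃ (W' : C) (w' : W' ⟶ V), InAdd U W' ∧
      Function.Surjective ((homFunctor P).map w').hom := by
  obtain ⟨n, s, r, hsr⟩ := hV.exists_sum
  refine ⟨⨁ fun _ : Fin n => W, biproduct.desc fun i => w ≫ r i,
    InAdd.biproduct fun _ => hW, fun g => ?_⟩
  have key : ∀ g : P ⟶ V, ∃ l : P ⟶ ⨁ fun _ : Fin n => W,
      l ≫ biproduct.desc (fun i => w ≫ r i) = g := by
    intro g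
    choose l hl using fun i => hw (g ≫ s i)
    refine ⟨biproduct.lift l, ?_⟩
    rw [biproduct.lift_desc]
    simp_rw [← Category.assoc, hl, Category.assoc]
    rw [← Preadditive.comp_sum, hsr, Category.comp_id]
  exact key g

variable [FittingCategory C] (hA : T.IsReducedZeroAuslander) (hP : T.IsProjectiveGenerator P)
include hA hP

lemma NoInjectiveSummand.numInd_obj {X : C} (hX : T.NoInjectiveSummand X) :
    numInd ((homFunctor P).obj X) = numInd X := by
  obtain ⟨h, -⟩ := hX.exists_indClass_equiv hA hP
  exact (Nat.card_congr h).symm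

lemma numInd_regular : numInd (ModuleCat.of (End P)ᵐᵒᵖ (End P)ᵐᵒᵖ) = numInd P :=
  (numInd_congr (regularIso P)).trans
    ((NoInjectiveSummand.of_inAdd hA hP (inAdd_self P)).numInd_obj hA hP)

lemma NoInjectiveSummand.noCommonSummand_obj {X : C} (hX : T.NoInjectiveSummand X)
    (h : NoCommonSummand U X) :
    NoCommonSummand ((homFunctor P).obj U) ((homFunctor P).obj X) := by
  intro M hM hMU
  obtain ⟨Y, hYX, ⟨e⟩⟩ := exists_isSummand_of_retract hA hP hM.retract.some
  obtain ⟨V, hV, ⟨e'⟩⟩ := exists_inAdd_of_inAdd hA hP hMU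
  obtain ⟨σ, -⟩ := (hX.of_isSummand hYX).exists_retract hA hP (Retract.ofIso (e.trans e'.symm))
  exact ((homFunctor P).map_isZero (h Y hYX (hV.of_retract σ))).of_iso e.symm

/-- For `J = ΣW` the assignment `X ↦ C(P, ΩX)` is a bijection from `ind J` to `ind C(P, W)`. -/
lemma IsSuspension.exists_indClass_equiv {W J : C} (h : T.IsSuspension W J) :
    ∃ f : IndClass J ≃ IndClass ((homFunctor P).obj W), ∀ X M, f (cls X) = cls M ↔
      ∃ ΩX : C, T.Projective ΩX ∧ T.IsSuspension ΩX X.1 ∧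
        Nonempty ((homFunctor P).obj ΩX ≅ M.1) := by
  have hproj : ∀ {Q : C}, T.Projective Q → T.NoInjectiveSummand Q := fun {Q} hQ =>
    NoInjectiveSummand.of_inAdd hA hP ((hP Q).1 hQ)
  have hW : T.NoInjectiveSummand W := hproj (h.projective hA)
  refine ZeroAuslander.exists_indClass_equiv _ ?_ ?_ ?_ ?_
  · intro X
    obtain ⟨W₁, h₁⟩ := exists_desuspension hA
      (Injective.of_retract (h.injective hA) X.2.2.retract.some)
    have hp : T.Projective W₁ := h₁.projective hA
    exact ⟨⟨(homFunctor P).obj W₁, (hproj hp).indecomposable_obj hA hP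
      (h₁.indecomposable_left hA X.2.1), isSummand_map hA hP (h.isSummand_left hA h₁ X.2.2)⟩,
      W₁, hp, h₁, ⟨Iso.refl _⟩⟩
  · intro M
    obtain ⟨W₁, e⟩ := hW.exists_indSummand hA hP M
    have hp : T.Projective W₁.1 :=
      Projective.of_retract (h.projective hA) W₁.2.2.retract.some
    obtain ⟨Y, hY⟩ := exists_suspension hA hp
    exact ⟨⟨Y, hY.indecomposable_right hA W₁.2.1, h.isSummand_right hA hY W₁.2.2⟩,
      W₁.1, hp, hY, e⟩
  · rintro X X' M M' ⟨W₁, hp, h₁, ⟨e⟩⟩ ⟨W₂, hp', h₂, ⟨e'⟩⟩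
    constructor
    · rintro ⟨φ⟩
      obtain ⟨ψ⟩ := h₁.exists_iso_left h₂ φ
      exact ⟨e.symm.trans (((homFunctor P).mapIso ψ).trans e')⟩
    · rintro ⟨φ⟩
      obtain ⟨ψ, -⟩ := (hproj hp).exists_iso hA hP (hproj hp') (e.trans (φ.trans e'.symm))
      exact h₁.exists_iso_right h₂ ψ
  · rintro X M M' ⟨W₁, hp, h₁, ⟨e⟩⟩ ⟨φ⟩
    exact ⟨W₁, hp, h₁, ⟨e.trans φ⟩⟩

section HomFinite

variable (k : Type*) [Field k] [Linear k C]
  (homFinite : ∀ X Y : C, Module.Finite k (X ⟶ Y))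
include homFinite

lemma NoInjectiveSummand.isTauRigid {X : C} {M : ModuleCat.{v} (End P)ᵐᵒᵖ}
    (hX : T.NoInjectiveSummand X) (h : T.Presilting X) (e : (homFunctor P).obj X ≅ M) :
    IsTauRigid k M := by
  have := finite_obj (P := P) k homFinite X
  exact ⟨Module.Finite.equiv e.toLinearEquiv,
    (hX.homTauVanishes_iff hA hP k homFinite e e).2 h⟩

/-- A quotient of a module in `add C(P, S)` is the image of a morphism out of an object of
`add S`. -/
lemma exists_map_of_epi {S : C} {V M : ModuleCat.{v} (End P)ᵐᵒᵖ}
    (hV : InAdd ((homFunctor P).obj S) V) (f : V ⟶ M) (hf : Epi f) :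
    ∃ (V' X' : C) (f' : V' ⟶ X'), InAdd S V' ∧
      Function.Surjective ((homFunctor P).map f').hom ∧
      Nonempty ((homFunctor P).obj X' ≅ M) := by
  obtain ⟨V', hV', ⟨eV⟩⟩ := exists_inAdd_of_inAdd hA hP hV
  have hs : Function.Surjective (eV.hom ≫ f).hom :=
    (ModuleCat.epi_iff_surjective _).1 inferInstance
  have := finite_obj (P := P) k homFinite V'
  have : Module.Finite (End P)ᵐᵒᵖ M := Module.Finite.of_surjective _ hs
  obtain ⟨X', ⟨eX⟩⟩ := exists_obj_iso hA hP k homFinite M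
  obtain ⟨f', hf'⟩ := exists_map_eq hA hP (eV.hom ≫ f ≫ eX.inv)
  refine ⟨V', X', f', hV', ?_, ⟨eX⟩⟩
  rw [hf']
  exact (ModuleCat.epi_iff_surjective _).1 inferInstance

/-- `C(P, B)` is the Bongartz complement of `C(P, U)`. It is `τ`-tilting by the count of summands,
and on the torsion class of modules `C(P, Y)` with `𝔼(U, Y) = 0` also `𝔼(B, -)` vanishes. -/
theorem IsBongartzComplement.isBongartzModule (hC : IsKrullSchmidt C) {B Z : C}
    (hU : T.Presilting U) (hB : T.IsBongartzComplement P U B)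
    (hZ : T.IsCoBongartzComplement P U Z) (hUi : T.NoInjectiveSummand U) :
    IsBongartzModule k ((homFunctor P).obj U) ((homFunctor P).obj B) := by
  have hPp : T.Projective P := hP.projective_self
  have hBi : T.NoInjectiveSummand B := (hB.isLeftMutable hA hPp hU hZ).noInjectiveSummand
  have hS : T.Presilting (B ⊞ U) := hB.presilting hA hPp hU hZ
  have hUB : NoCommonSummand U B := by
    obtain ⟨_, _, _, _, _, _, _, _, _, _, _, h⟩ := hB
    exact h
  have hSi := hBi.biprod hUi
  have hPU : IsZero (ModuleCat.of (End P)ᵐᵒᵖ PUnit.{v + 1}) :=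
    ModuleCat.isZero_of_subsingleton _
  let eS := homFunctorBiprod P B U
  refine ⟨⟨hSi.isTauRigid hA hP k homFinite hS eS, ?_, ?_, fun f => hPU.eq_of_src f 0, ?_⟩,
    fun X => (inAdd_congr eS.symm X).trans ?_, hBi.noCommonSummand_obj hA hP hUB⟩
  · exact inferInstanceAs (Module.Finite (End P)ᵐᵒᵖ PUnit.{v + 1})
  · exact inferInstanceAs (Module.Projective (End P)ᵐᵒᵖ PUnit.{v + 1})
  · rw [numInd_eq_zero hPU, add_zero, ← numInd_congr eS, hSi.numInd_obj hA hP,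
      numInd_biprod hC hUB, hB.numInd_add k homFinite hC hA hP hU hZ, numInd_regular hA hP]
  · obtain ⟨K, U', U₀, g, b, ⟨δ, hδ⟩, hU', hU₀, ⟨eK⟩, -⟩ := hB.exists_conflation hA hPp hU
    have hK : InAdd (B ⊞ U) K :=
      ((isSummand_left B U).inAdd.biprod (hU₀.mono (isSummand_right B U))).of_iso eK.symm
    refine inAdd_iff_extProjective hA hP k homFinite hδ hS hK (hU'.mono (isSummand_right B U))
      _ (fun X h => h.1) ?_ ?_ ?_ X
    · rintro X Y ⟨e⟩ ⟨hf, ht⟩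
      exact ⟨Module.Finite.equiv e.toLinearEquiv, ht.of_iso k e⟩
    · intro V M f hV hf
      obtain ⟨V', X', f', hV', hf', ⟨e⟩⟩ := exists_map_of_epi hA hP k homFinite hV f hf
      have := finite_obj (P := P) k homFinite X'
      exact ⟨Module.Finite.equiv e.toLinearEquiv,
        (hUi.homTauVanishes_iff hA hP k homFinite (Iso.refl _) e).2
          (extVanishes_of_surjective hA hP f' hf'
            (hS.extVanishes (isSummand_right B U).inAdd hV'))⟩
    · rintro Y ⟨-, ht⟩
      have hY := (hUi.homTauVanishes_iff hA hP k homFinite (Iso.refl _) (Iso.refl _)).1 ht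
      exact (hB.extVanishes_of_extVanishes hA hPp hU hY).biprod_left hY

/-- `add C(P, Z ⊞ U)` is the class of `Ext`-projectives in `Gen C(P, U)`. -/
lemma IsCoBongartzComplement.inAdd_iff_extProjective_gen {Z : C} (hU : T.Presilting U)
    (hZ : T.IsCoBongartzComplement P U Z) (X : ModuleCat.{v} (End P)ᵐᵒᵖ) :
    InAdd ((homFunctor P).obj (Z ⊞ U)) X ↔ ExtProjective (Gen ((homFunctor P).obj U)) X := by
  have hS : T.Presilting (Z ⊞ U) := hZ.presilting hA hU
  obtain ⟨L, U'', U₀, g, c, hg, ⟨δ, hδ⟩, hU₀, ⟨eL⟩, -⟩ := hZ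
  have hL : InAdd (Z ⊞ U) L :=
    ((isSummand_left Z U).inAdd.biprod (hU₀.mono (isSummand_right Z U))).of_iso eL.symm
  refine inAdd_iff_extProjective hA hP k homFinite hδ hS (hg.1.1.mono (isSummand_right Z U)) hL
    _ ?_ ?_ ?_ ?_ X
  · rintro M ⟨V, f, hV, hf⟩
    obtain ⟨-, X', -, -, -, ⟨e⟩⟩ := exists_map_of_epi hA hP k homFinite hV f hf
    have := finite_obj (P := P) k homFinite X'
    exact Module.Finite.equiv e.toLinearEquiv
  · rintro M N ⟨e⟩ ⟨V, f, hV, hf⟩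
    exact ⟨V, f ≫ e.hom, hV, inferInstance⟩
  · intro V M f hV hf
    obtain ⟨V', X', f', hV', hf', ⟨e⟩⟩ := exists_map_of_epi hA hP k homFinite hV f hf
    -- `Z` is a quotient of `L`, hence of `U''`, after applying `C(P, -)`.
    let w : U'' ⊞ U ⟶ Z ⊞ U := biprod.desc (c ≫ eL.hom ≫ biprod.fst ≫ biprod.inl) biprod.inr
    have hw : ∀ t : P ⟶ Z ⊞ U, ∃ l : P ⟶ U'' ⊞ U, l ≫ w = t := by
      intro t
      obtain ⟨l, hl⟩ := hP.projective_self c ⟨_, g, δ, hδ⟩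
        (t ≫ biprod.fst ≫ biprod.inl ≫ eL.inv)
      refine ⟨biprod.lift l (t ≫ biprod.snd), ?_⟩
      rw [biprod.lift_desc, reassoc_of% hl]
      simp only [Iso.inv_hom_id_assoc, biprod.inl_fst_assoc, Category.assoc]
      rw [← Preadditive.comp_add, biprod.total, Category.comp_id]
    obtain ⟨W, w', hW, hw'⟩ := exists_surjective_of_inAdd
      (hg.1.1.biprod (inAdd_self U)) w hw hV'
    refine ⟨(homFunctor P).obj W, (homFunctor P).map w' ≫ (homFunctor P).map f' ≫ e.hom,
      inAdd_map hW, ?_⟩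
    have := (ModuleCat.epi_iff_surjective _).2 hw'
    have := (ModuleCat.epi_iff_surjective _).2 hf'
    infer_instance
  · rintro Y ⟨V, f, hV, hf⟩
    obtain ⟨V', hV', ⟨eV⟩⟩ := exists_inAdd_of_inAdd hA hP hV
    obtain ⟨f', hf'⟩ := exists_map_eq hA hP (eV.hom ≫ f)
    refine extVanishes_of_surjective hA hP f' ?_
      (hS.extVanishes (inAdd_self _) (hV'.mono (isSummand_right Z U)))
    rw [hf']
    exact (ModuleCat.epi_iff_surjective _).1 inferInstance

/-- The co-Bongartz complement of `C(P, U)` consists of the module `C(P, Z')` and the shifted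
projective module `C(P, W)` with `ΣW = J`. Homomorphisms from `C(P, W)` to `C(P, Z' ⊞ U)` vanish
because they are classes in `𝔼(J, Z' ⊞ U)`. -/
theorem IsCoBongartzComplement.isCoBongartzModule (hC : IsKrullSchmidt C) {B Z Z' J W : C}
    (hU : T.Presilting U) (hB : T.IsBongartzComplement P U B)
    (hZ : T.IsCoBongartzComplement P U Z) (hUi : T.NoInjectiveSummand U)
    (hs : T.IsInjectiveSplitting Z Z' J W) :
    IsCoBongartzModule k ((homFunctor P).obj U) ((homFunctor P).obj Z')
      ((homFunctor P).obj W) := by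
  obtain ⟨⟨e⟩, hJ, hZ'i, hW, hWJ⟩ := hs
  replace hZ'i : T.NoInjectiveSummand Z' := hZ'i
  have hPp : T.Projective P := hP.projective_self
  have hS : T.Presilting (Z ⊞ U) := hZ.presilting hA hU
  have hUZ : NoCommonSummand U Z := by
    obtain ⟨_, _, _, _, _, _, _, _, _, h⟩ := hZ
    exact h
  have hZ's : IsSummand Z' Z := (isSummand_left Z' J).of_iso e.symm
  have hJs : IsSummand J Z := (isSummand_right Z' J).of_iso e.symm
  have hZ'S : InAdd (Z ⊞ U) (Z' ⊞ U) :=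
    (InAdd.of_isSummand (isSummand_left Z U).inAdd hZ's).biprod (isSummand_right Z U).inAdd
  have hJS : InAdd (Z ⊞ U) J := InAdd.of_isSummand (isSummand_left Z U).inAdd hJs
  have hUZ' := hUZ.of_isSummand hZ's
  have hXi := hZ'i.biprod hUi
  have hJZ' : NoCommonSummand J Z' := fun X hX hXJ => hZ'i X hX (hJ.inAdd hXJ)
  let eX := homFunctorBiprod P Z' U
  refine ⟨⟨hXi.isTauRigid hA hP k homFinite (hS.extVanishes hZ'S hZ'S) eX,
    finite_obj k homFinite W, projective_obj ((hP W).1 hW), fun f => ?_, ?_⟩, fun X => ?_,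
    hZ'i.noCommonSummand_obj hA hP hUZ'⟩
  · obtain ⟨φ, hφ⟩ := exists_map_eq hA hP (f ≫ eX.inv)
    obtain ⟨O, a, b, hO, δ, hδ⟩ := hWJ
    obtain ⟨l, hl⟩ := (hδ.push_eq_zero_iff φ).1 (hS.extVanishes hJS hZ'S _)
    have h0 : φ = 0 := by rw [← hl, hO.eq_of_src l 0, comp_zero]
    rw [h0, Functor.map_zero] at hφ
    rw [← cancel_mono eX.inv, ← hφ, zero_comp]
  · obtain ⟨ρ, -⟩ := (hB.exchange hA hPp hU k homFinite hZ).exists_equiv k homFinite hU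
      (hB.isLeftMutable hA hPp hU hZ)
    obtain ⟨f, -⟩ := hWJ.exists_indClass_equiv hA hP
    have h1 : numInd B = numInd Z := Nat.card_congr ρ
    have h2 : numInd J = numInd ((homFunctor P).obj W) := Nat.card_congr f
    have h3 : numInd Z = numInd Z' + numInd J := by
      rw [numInd_congr e, numInd_biprod hC hJZ']
    have h4 := hB.numInd_add k homFinite hC hA hP hU hZ
    rw [← numInd_congr eX, hXi.numInd_obj hA hP, numInd_biprod hC hUZ', numInd_regular hA hP]
    omega
  · refine (inAdd_congr ?_ X).trans
      (hZ.inAdd_iff_extProjective_gen hA hP k homFinite hU X)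
    exact (biprod.mapIso ((isoBiprodZeroRight _ (isZero_obj_of_injective hA hP hJ)).trans
      ((homFunctorBiprod P Z' J).symm.trans ((homFunctor P).mapIso e.symm)))
      (Iso.refl _)).trans (homFunctorBiprod P Z U).symm

end HomFinite

end ModuleComplements

end Extriangulated

/-! ### Comparison of the exchange with the Buan-Marsh exchange -/

lemma exists_cls_eq {C : Type*} [Category* C] [Preadditive C] [HasZeroObject C]
    [HasBinaryBiproducts C] [HasFiniteBiproducts C] {B : C} (x : IndClass B) :
    ∃ X : IndSummand B, cls X = x :=
  Quotient.exists_rep x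

namespace Extriangulated

section BuanMarsh

variable {C : Type u} [Category.{v} C] [Preadditive C] [HasZeroObject C]
  [HasBinaryBiproducts C] [HasFiniteBiproducts C] {T : Extriangulated.{w} C} {P U : C}
  [IsIdempotentComplete C] [FittingCategory C]

/-- A decomposition of the right end of an exchange triangle induces one of the left end. -/
lemma Exchange.exists_iso_biprod (k : Type*) [Field k] [Linear k C]
    (homFinite : ∀ X Y : C, Module.Finite k (X ⟶ Y)) {B Z Z' Z'' : C} (h : T.Exchange U B Z)
    (hU : T.Presilting U) (e : Z ≅ Z' ⊞ Z'') :
    ∃ B' B'' : C, Nonempty (B ≅ B' ⊞ B'') ∧ T.Exchange U B' Z' ∧ T.Exchange U B'' Z'' := by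
  have hZ := h.isRightMutable hU
  obtain ⟨B', h'⟩ := (hZ.of_isSummand ((ZeroAuslander.isSummand_left Z' Z'').of_iso e.symm)).exists_exchange
    k homFinite
  obtain ⟨B'', h''⟩ := (hZ.of_isSummand ((ZeroAuslander.isSummand_right Z' Z'').of_iso e.symm)).exists_exchange
    k homFinite
  exact ⟨B', B'', h.exists_iso_left (h'.biprod h'') e, h', h''⟩

variable (hA : T.IsReducedZeroAuslander) (hP : T.IsProjectiveGenerator P)
include hA hP

/-- Every indecomposable summand of `C(P, B)` comes from an exchange triangle. -/
lemma NoInjectiveSummand.exists_exchange {B Z : C} (hB : T.NoInjectiveSummand B)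
    {ρ : IndClass B ≃ IndClass Z}
    (hρ : ∀ (X : IndSummand B) (Y : IndSummand Z), ρ (cls X) = cls Y ↔ T.Exchange U X.1 Y.1)
    (M : IndSummand ((homFunctor P).obj B)) :
    ∃ (X : IndSummand B) (Y : IndSummand Z), ρ (cls X) = cls Y ∧ T.Exchange U X.1 Y.1 ∧
      Nonempty ((homFunctor P).obj X.1 ≅ M.1) := by
  obtain ⟨X, e⟩ := hB.exists_indSummand hA hP M
  obtain ⟨Y, hY⟩ := exists_cls_eq (ρ (cls X))
  exact ⟨X, Y, hY.symm, (hρ X Y).1 hY.symm, e⟩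

section Bijections

variable {B Z : C} (hB : T.NoInjectiveSummand B) {ρ : IndClass B ≃ IndClass Z}
  (hρ : ∀ (X : IndSummand B) (Y : IndSummand Z), ρ (cls X) = cls Y ↔ T.Exchange U X.1 Y.1)
include hB hρ

/-- If the right end has no injective summands, no indecomposable summand of the left end has an
epimorphic approximation. -/
lemma NoInjectiveSummand.not_hasEpiApprox (hZ : T.NoInjectiveSummand Z)
    (M : IndSummand ((homFunctor P).obj B)) : ¬ HasEpiApprox ((homFunctor P).obj U) M.1 := by
  obtain ⟨X, Y, -, ⟨V, b, c, δ, h⟩, ⟨e⟩⟩ := hB.exists_exchange hA hP hρ M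
  rw [h.hasEpiApprox_iff hA hP e]
  exact fun hY => Y.2.1.1 (hZ Y.1 Y.2.2 hY)

/-- If the right end is injective, the approximations of all indecomposable summands of the left end
are epimorphisms. -/
lemma NoInjectiveSummand.hasEpiApprox (hZ : T.Injective Z)
    (M : IndSummand ((homFunctor P).obj B)) : HasEpiApprox ((homFunctor P).obj U) M.1 := by
  obtain ⟨X, Y, -, ⟨V, b, c, δ, h⟩, ⟨e⟩⟩ := hB.exists_exchange hA hP hρ M
  exact (h.hasEpiApprox_iff hA hP e).2 (Injective.of_retract hZ Y.2.2.retract.some)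

variable {f : IndClass B ≃ IndClass ((homFunctor P).obj B)}
  (hf : ∀ X M, f (cls X) = cls M ↔ Nonempty ((homFunctor P).obj X.1 ≅ M.1))
include hf

/-- The transport of `ρ` along `C(P, -)` is the Buan-Marsh exchange of modules. -/
lemma NoInjectiveSummand.equiv_eq_iff_buanMarshModule
    {g : IndClass Z ≃ IndClass ((homFunctor P).obj Z)}
    (hg : ∀ X M, g (cls X) = cls M ↔ Nonempty ((homFunctor P).obj X.1 ≅ M.1))
    (M : IndSummand ((homFunctor P).obj B)) (N : IndSummand ((homFunctor P).obj Z)) :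
    (f.symm.trans (ρ.trans g)) (cls M) = cls N ↔
      BuanMarshModule ((homFunctor P).obj U) M.1 N.1 := by
  obtain ⟨X, Y, hXY, ⟨V, b, c, δ, h⟩, ⟨e⟩⟩ := hB.exists_exchange hA hP hρ M
  have hM : f.symm (cls M) = cls X := f.symm_apply_eq.2 ((hf X M).2 ⟨e⟩).symm
  rw [Equiv.trans_apply, Equiv.trans_apply, hM, hXY, hg, h.buanMarshModule_iff hA hP e]

/-- For `Z = ΣW`, the transport of `ρ` along `C(P, -)` and `C(P, Ω(-))` is the Buan-Marsh exchange
with shifted projective modules. -/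
lemma NoInjectiveSummand.equiv_eq_iff_buanMarshShifted {W B₀ : C} (hWZ : T.IsSuspension W Z)
    (hUi : T.NoInjectiveSummand U) (hUB₀ : T.ExtVanishes U B₀) (hBB₀ : IsSummand B B₀)
    (hUB : NoCommonSummand U B)
    {g : IndClass Z ≃ IndClass ((homFunctor P).obj W)}
    (hg : ∀ X M, g (cls X) = cls M ↔ ∃ ΩX : C, T.Projective ΩX ∧ T.IsSuspension ΩX X.1 ∧
      Nonempty ((homFunctor P).obj ΩX ≅ M.1))
    (M : IndSummand ((homFunctor P).obj B)) (Q : IndSummand ((homFunctor P).obj W)) :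
    (f.symm.trans (ρ.trans g)) (cls M) = cls Q ↔
      BuanMarshShifted ((homFunctor P).obj U) ((homFunctor P).obj B₀) M.1 Q.1 := by
  obtain ⟨X, Y, hXY, ⟨V, b, c, δ, h⟩, ⟨e⟩⟩ := hB.exists_exchange hA hP hρ M
  have hM : f.symm (cls M) = cls X := f.symm_apply_eq.2 ((hf X M).2 ⟨e⟩).symm
  have hPW : InAdd P W := (hP W).1 (hWZ.projective hA)
  obtain ⟨W₁, ⟨eQ⟩⟩ := (NoInjectiveSummand.of_inAdd hA hP hPW).exists_indSummand hA hP Q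
  obtain ⟨Ω, hΩ⟩ := exists_desuspension hA
    (Injective.of_retract (hWZ.injective hA) Y.2.2.retract.some)
  rw [Equiv.trans_apply, Equiv.trans_apply, hM, hXY, hg,
    h.buanMarshShifted_iff hA hP e hΩ (hUB₀.inAdd_left h.2.1.1.1)
      (IsSummand.inAdd (X.2.2.trans hBB₀)) X.2.1 (hB.of_isSummand X.2.2)
      (hUB.of_isSummand X.2.2) hUi (hΩ.indecomposable_left hA Y.2.1) W₁.2.1
      (hPW.of_isSummand W₁.2.2) eQ]
  constructor
  · rintro ⟨Ω', -, hΩ', ⟨e'⟩⟩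
    obtain ⟨φ⟩ := hΩ.exists_iso_left hΩ' (Iso.refl _)
    exact ⟨((homFunctor P).mapIso φ).trans e'⟩
  · exact fun e' => ⟨Ω, hΩ.projective hA, hΩ, e'⟩

end Bijections

lemma exists_isInjectiveSplitting (k : Type*) [Field k] [Linear k C]
    (homFinite : ∀ X Y : C, Module.Finite k (X ⟶ Y)) (Z : C) :
    ∃ Z' J W : C, T.IsInjectiveSplitting Z Z' J W := by
  obtain ⟨Z', J, e, hJ, hZ'⟩ := exists_injective_splitting hA hP k homFinite Z
  obtain ⟨W, hW⟩ := exists_desuspension hA hJ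
  exact ⟨Z', J, W, e, hJ, hZ', hW.projective hA, hW⟩

end BuanMarsh

end Extriangulated

end ZeroAuslander

theorem mainTheorem7 {k : Type*} [Field k] {C : Type u} [Category.{v} C] [Preadditive C]
    [HasZeroObject C] [HasBinaryBiproducts C] [HasFiniteBiproducts C] [Linear k C]
    (homFinite : ∀ X Y : C, Module.Finite k (X ⟶ Y)) (krullSchmidt : IsKrullSchmidt C)
    (T : Extriangulated.{w} C) (zeroAuslander : T.IsReducedZeroAuslander)
    (P : C) (hP : T.IsProjectiveGenerator P) (U : C) (hU : T.Presilting U) :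
    -- the two complements exist
    (∃ B : C, T.IsBongartzComplement P U B) ∧ (∃ Z : C, T.IsCoBongartzComplement P U Z) ∧
    ∀ B Z : C, T.IsBongartzComplement P U B → T.IsCoBongartzComplement P U Z →
      -- the exchange triangle `B ⟶ Ubar ⟶ Z` exists
      (∃ (V : C) (b : B ⟶ V) (c : V ⟶ Z) (δ : Extn T.E Z B), T.IsExchangeTriangle U b c δ) ∧
      -- it is a direct sum of exchange triangles with indecomposable ends, one for each member of
      -- a given decomposition of `B` into indecomposables
      (∀ (V : C) (b : B ⟶ V) (c : V ⟶ Z) (δ : Extn T.E Z B), T.IsExchangeTriangle U b c δ →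
        ∀ (n : ℕ) (X : Fin n → C) (e : B ≅ ⨁ X), (∀ i, Indecomposable (X i)) →
        ∃ (W Y : Fin n → C) (x : ∀ i, X i ⟶ W i) (y : ∀ i, W i ⟶ Y i)
          (ε : ∀ i, Extn T.E (Y i) (X i)) (eV : V ≅ ⨁ W) (eZ : Z ≅ ⨁ Y),
          (∀ i, Indecomposable (Y i)) ∧ (∀ i, T.IsExchangeTriangle U (x i) (y i) (ε i)) ∧
          b ≫ eV.hom = e.hom ≫ biproduct.map x ∧ c ≫ eZ.hom = eV.hom ≫ biproduct.map y ∧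
          push T.E e.hom δ = pull T.E eZ.hom (extBigSum T.E ε)) ∧
      -- every minimal approximation of an indecomposable summand is part of such a triangle
      (∀ (X : IndSummand B) (V : C) (b : X.1 ⟶ V), IsMinLeftApprox U b →
        ∃ (Y : IndSummand Z) (c : V ⟶ Y.1) (δ : Extn T.E Y.1 X.1),
          T.IsExchangeTriangle U b c δ) ∧
      (∀ (Y : IndSummand Z) (V : C) (c : V ⟶ Y.1), IsMinRightApprox U c →
        ∃ (X : IndSummand B) (b : X.1 ⟶ V) (δ : Extn T.E Y.1 X.1),
          T.IsExchangeTriangle U b c δ) ∧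
      -- the triangles define a bijection
      (∃ ρ : IndClass B ≃ IndClass Z, ∀ (X : IndSummand B) (Y : IndSummand Z),
        ρ (cls X) = cls Y ↔ T.Exchange U X.1 Y.1) ∧
      -- the number of non-isomorphic indecomposable triangles is `|P| - |U|`
      Finite (IndClass B) ∧ numInd B + numInd U = numInd P ∧
      -- compatibility with the Buan-Marsh exchange for `C(P, U)`
      ((∀ X : C, IsSummand X U → T.Injective X → IsZero X) →
        (∃ Z' J W : C, T.IsInjectiveSplitting Z Z' J W) ∧
        ∀ Z' J W : C, T.IsInjectiveSplitting Z Z' J W →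
        let H : C ⥤ ModuleCat.{v} (End P)ᵐᵒᵖ := preadditiveCoyonedaObj P
        IsTauRigid k (H.obj U) ∧
        IsBongartzModule k (H.obj U) (H.obj B) ∧
        IsCoBongartzModule k (H.obj U) (H.obj Z') (H.obj W) ∧
        ∃ B' B'' : C, Nonempty (B ≅ B' ⊞ B'') ∧
        ∃ (ρ' : IndClass B' ≃ IndClass Z') (ρ'' : IndClass B'' ≃ IndClass J)
          (σ' : IndClass (H.obj B') ≃ IndClass (H.obj Z'))
          (σ'' : IndClass (H.obj B'') ≃ IndClass (H.obj W))
          (hB : IndClass B ≃ IndClass (H.obj B))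
          (hB' : IndClass B' ≃ IndClass (H.obj B')) (hB'' : IndClass B'' ≃ IndClass (H.obj B''))
          (hZ' : IndClass Z' ≃ IndClass (H.obj Z')) (hJ : IndClass J ≃ IndClass (H.obj W)),
          -- `ρ'` and `ρ''` are the restrictions of the exchange bijection in `C`
          (∀ (X : IndSummand B') (Y : IndSummand Z'),
            ρ' (cls X) = cls Y ↔ T.Exchange U X.1 Y.1) ∧
          (∀ (X : IndSummand B'') (Y : IndSummand J),
            ρ'' (cls X) = cls Y ↔ T.Exchange U X.1 Y.1) ∧
          -- `σ'` and `σ''` are the two cases of the Buan-Marsh exchange bijection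
          (∀ X : IndSummand (H.obj B'), ¬ HasEpiApprox (H.obj U) X.1) ∧
          (∀ X : IndSummand (H.obj B''), HasEpiApprox (H.obj U) X.1) ∧
          (∀ (X : IndSummand (H.obj B')) (Y : IndSummand (H.obj Z')),
            σ' (cls X) = cls Y ↔ BuanMarshModule (H.obj U) X.1 Y.1) ∧
          (∀ (X : IndSummand (H.obj B'')) (Q : IndSummand (H.obj W)),
            σ'' (cls X) = cls Q ↔ BuanMarshShifted (H.obj U) (H.obj B) X.1 Q.1) ∧
          -- the horizontal bijections are given by `H_P`
          (∀ (X : IndSummand B) (M : IndSummand (H.obj B)),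
            hB (cls X) = cls M ↔ Nonempty (H.obj X.1 ≅ M.1)) ∧
          (∀ (X : IndSummand B') (M : IndSummand (H.obj B')),
            hB' (cls X) = cls M ↔ Nonempty (H.obj X.1 ≅ M.1)) ∧
          (∀ (X : IndSummand B'') (M : IndSummand (H.obj B'')),
            hB'' (cls X) = cls M ↔ Nonempty (H.obj X.1 ≅ M.1)) ∧
          (∀ (X : IndSummand Z') (M : IndSummand (H.obj Z')),
            hZ' (cls X) = cls M ↔ Nonempty (H.obj X.1 ≅ M.1)) ∧
          (∀ (X : IndSummand J) (M : IndSummand (H.obj W)),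
            hJ (cls X) = cls M ↔
              ∃ ΩX : C, T.Projective ΩX ∧ T.IsSuspension ΩX X.1 ∧ Nonempty (H.obj ΩX ≅ M.1)) ∧
          -- the two squares commute
          (∀ x : IndClass B', hZ' (ρ' x) = σ' (hB' x)) ∧
          (∀ x : IndClass B'', hJ (ρ'' x) = σ'' (hB'' x))) := by
  have := krullSchmidt.isIdempotentComplete
  have := fittingCategory_of_finite k homFinite
  have hPp : T.Projective P := hP.projective_self
  refine ⟨Extriangulated.exists_isBongartzComplement zeroAuslander hU k homFinite hPp,
    Extriangulated.exists_isCoBongartzComplement zeroAuslander hU k homFinite hPp,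
    fun B Z hB hZ => ?_⟩
  have hm : T.IsLeftMutable U B := hB.isLeftMutable zeroAuslander hPp hU hZ
  have hBZ : T.Exchange U B Z := hB.exchange zeroAuslander hPp hU k homFinite hZ
  refine ⟨hBZ, fun V b c δ h => h.exists_decomposition k homFinite hU hm,
    hBZ.exists_triangle_left k homFinite hU hm, hBZ.exists_triangle_right k homFinite hU hm,
    hBZ.exists_equiv k homFinite hU hm, krullSchmidt.finite_indClass B,
    hB.numInd_add k homFinite krullSchmidt zeroAuslander hP hU hZ, fun hUi => ?_⟩
  refine ⟨Extriangulated.exists_isInjectiveSplitting zeroAuslander hP k homFinite Z,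
    fun Z' J W hs => ?_⟩
  replace hUi : T.NoInjectiveSummand U := hUi
  have hBi : T.NoInjectiveSummand B := hm.noInjectiveSummand
  refine ⟨hUi.isTauRigid zeroAuslander hP k homFinite hU (Iso.refl _),
    hB.isBongartzModule zeroAuslander hP k homFinite krullSchmidt hU hZ hUi,
    hZ.isCoBongartzModule zeroAuslander hP k homFinite krullSchmidt hU hB hUi hs, ?_⟩
  obtain ⟨⟨e⟩, hJ, hZ', -, hWJ⟩ := hs
  replace hZ' : T.NoInjectiveSummand Z' := hZ'
  obtain ⟨B', B'', ⟨eB⟩, h', h''⟩ := hBZ.exists_iso_biprod k homFinite hU e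
  have hB' : IsSummand B' B := (isSummand_left B' B'').of_iso eB.symm
  have hB'' : IsSummand B'' B := (isSummand_right B' B'').of_iso eB.symm
  have hBi' := hBi.of_isSummand hB'
  have hBi'' := hBi.of_isSummand hB''
  obtain ⟨ρ', hρ'⟩ := h'.exists_equiv k homFinite hU (hm.of_isSummand hB')
  obtain ⟨ρ'', hρ''⟩ := h''.exists_equiv k homFinite hU (hm.of_isSummand hB'')
  obtain ⟨f, hf⟩ := hBi.exists_indClass_equiv zeroAuslander hP
  obtain ⟨f', hf'⟩ := hBi'.exists_indClass_equiv zeroAuslander hP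
  obtain ⟨f'', hf''⟩ := hBi''.exists_indClass_equiv zeroAuslander hP
  obtain ⟨g', hg'⟩ := hZ'.exists_indClass_equiv zeroAuslander hP
  obtain ⟨g'', hg''⟩ := hWJ.exists_indClass_equiv zeroAuslander hP
  exact ⟨B', B'', ⟨eB⟩, ρ', ρ'', f'.symm.trans (ρ'.trans g'), f''.symm.trans (ρ''.trans g''),
    f, f', f'', g', g'', hρ', hρ'',
    hBi'.not_hasEpiApprox zeroAuslander hP hρ' hZ',
    hBi''.hasEpiApprox zeroAuslander hP hρ'' hJ,
    hBi'.equiv_eq_iff_buanMarshModule zeroAuslander hP hρ' hf' hg',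
    hBi''.equiv_eq_iff_buanMarshShifted zeroAuslander hP hρ'' hf'' hWJ hUi hm.extVanishes hB''
      (hm.noCommonSummand.of_isSummand hB'') hg'',
    hf, hf', hf'', hg', hg'',
    fun x => (congrArg (fun y => g' (ρ' y)) (f'.symm_apply_apply x)).symm,
    fun x => (congrArg (fun y => g'' (ρ'' y)) (f''.symm_apply_apply x)).symm⟩
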